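/- Let $\mathbb K$ be $\mathbb R$ or $\mathbb C$ and let $\mathcal G=(\mathfrak g,[\,,\,],\varpi,\varphi)$ be a finite-dimensional Lie quasi-bialgebra over $\mathbb K$: $(\mathfrak g,[\,,\,])$ is a Lie algebra, $\varpi\colon\mathfrak g\to\bigwedge^2\mathfrak g$ a 1-cocycle and $\varphi\in\bigwedge^3\mathfrak g$, such that $\langle\xi\otimes\eta\otimes\zeta,\mathrm{ad}_x^{(3)}\varphi\rangle=\mathrm{Cycl}_{(\xi,\eta,\zeta)}\langle\xi,\varpi_{\varpi_x\eta}\zeta\rangle$ and $\mathrm{Cycl}_{(\xi,\eta,\zeta)}\big(\langle\zeta,\varpi_{\varphi(\xi,\eta)}\theta\rangle+\langle\xi,\varpi_{\varphi(\zeta,\theta)}\eta\rangle\big)=0$, where $\varphi(\xi,\eta)=\langle\xi\otimes\eta\otimes1,\varphi\rangle$. Elements of $\bigwedge^2\mathfrak g$ are viewed as skew maps $\mathfrak g^*\to\mathfrak g$, and $\mathrm{ad}^*$, $\mathrm{Ad}^*$ denote transposes. Assume $\mathcal G$ is bidynamical: there is a reductive decomposition $\mathfrak g=\mathfrak l\oplus\mathfrak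 m$ ($\mathfrak l$ a subalgebra, $[\mathfrak l,\mathfrak m]\subset\mathfrak m$), which we fix, $\varpi_{\mathfrak l}=0$, and $\varphi$ vanishes on $(\mathfrak l^\perp)^3$. Let $i\colon\mathfrak l\to\mathfrak g$ be the inclusion and $s\colon\mathfrak l^*\to\mathfrak g^*$ the transpose of the projection on $\mathfrak l$ along $\mathfrak m$ (image $\mathfrak m^\perp$). **Canonical $\ell$-matrix.** A dynamical $\ell$-matrix on an open $U\subset\mathfrak l^*$ is a map $l\colon U\to\bigwedge^2\mathfrak g$ with $$\mathrm{Cycl}_{(\xi,\eta,\zeta)}\big(\langle\zeta,d_pl(i^*\xi)\eta\rangle-\langle\zeta,[l_p\xi,l_p\eta]\rangle-\langle\zeta,\varpi_{l_p\xi}\eta\rangle\big)=\langle\xi\otimes\eta\otimes\zeta,\varphi\rangle,$$ $$d_pl(\mathrm{ad}^*_zp)+\varpi_z+\mathrm{ad}_zl_p+l_p\mathrm{ad}_z^*=0\qquad(z\in\mathfrak l).$$ The canonical one, $l^{can}_{\mathcal G}$, is the analytic dynamical $\ell$-matrix near $0$ with $l_0=0$ and $l_p\,sp=0$. Its domain of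 analyticity $U_{\mathcal G}$ is the union of all connected open neighbourhoods of $0$ in $\mathfrak l^*$ on which there is an analytic dynamical $\ell$-matrix with these two properties. **Double and dual.** The double of $\mathcal G$ is $\mathfrak d=\mathfrak g\oplus\mathfrak g^*$ with the bracket extending that of $\mathfrak g$ such that $[x,\xi]=\varpi_x\xi-\mathrm{ad}^*_x\xi$ and $[\xi,\eta]=\varphi(\xi,\eta)-\langle\xi,\varpi_\bullet\eta\rangle$; $\mathfrak d^*=\mathfrak d$ through the canonical form $(x+\xi,y+\eta)=\langle\xi,y\rangle+\langle\eta,x\rangle$, and $j\colon\mathfrak g\to\mathfrak d$ is the inclusion. The dual $\mathcal G^\star$ is the Lie quasi-bialgebra on $\mathfrak g^\star=\mathfrak l\oplus\mathfrak l^\perp\subset\mathfrak d$ defined by the complement $\mathfrak m^\perp\oplus\mathfrak m\cong(\mathfrak g^\star)^*$ (identified by the form), with reversed cobracket: $\varpi^\star_X\eta=-\mathrm p_{\mathfrak g^\star}[X,\eta]$ and $\varphi^\star(\eta,\eta')=\mathrm p_{\mathfrak g^\star}[\eta,\eta']$ for $X\in\mathfrak g^\star$, $\eta,\eta'\in\mathfrak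 m^\perp\oplus\mathfrak m$. Let $\mathfrak d^\star=\mathfrak g^\star\oplus(\mathfrak g^\star)^*$ be its double, identified with $\mathfrak d$ as a vector space, $j^\star\colon\mathfrak g^\star\to\mathfrak d^\star$ the inclusion, and $K=\mathrm p_{\mathfrak l\oplus\mathfrak l^\perp}-\mathrm p_{\mathfrak m^\perp\oplus\mathfrak m}\colon\mathfrak d^\star\to\mathfrak d$. **Gauge transform.** On $\mathfrak d$ use the cobracket $\partial_Xr=\mathrm{ad}_Xr+r\,\mathrm{ad}_X^*$ with $r=\tfrac12(\mathrm p_{\mathfrak g^*}-\mathrm p_{\mathfrak g})\in\bigwedge^2\mathfrak d$. For $\lambda\colon\mathfrak l^*\to\bigwedge^2\mathfrak d$ and $\sigma=e^{X}$ with $X\colon\mathfrak l^*\to\mathfrak d$, set $$\lambda^\sigma_p=\mathrm{Ad}_{\sigma_p}\lambda_p\mathrm{Ad}^*_{\sigma_p}+\big(\rho_p\,i^*\mathrm{Ad}^*_{\sigma_p}-i\,\rho_p^*\big)+\pi_{\sigma_p},$$ where $i$ is now the inclusion $\mathfrak l\to\mathfrak d$, $\mathrm{Ad}_{\sigma_p}=e^{\mathrm{ad}_{X_p}}$,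 $\rho_p=\frac{e^{\mathrm{ad}_{X_p}}-1}{\mathrm{ad}_{X_p}}\circ d_pX\colon\mathfrak l^*\to\mathfrak d$ is the right logarithmic derivative of $\sigma$, and $\pi_{\sigma_p}=\int_0^1e^{t\,\mathrm{ad}_{X_p}}(\partial_{X_p}r)\,(e^{t\,\mathrm{ad}_{X_p}})^*\,dt$ is the value at $\sigma_p$ of the group cocycle integrating $\partial r$. Let $\varsigma^{-1}$ be the map $p\mapsto e^{-sp}$. **Statement.** 1. $l^{can}_{\mathcal G}$ is well defined: $U_{\mathcal G}$ is a connected open neighbourhood of $0$, there is an analytic dynamical $\ell$-matrix $l^{can}_{\mathcal G}$ on $U_{\mathcal G}$ with $l_0=0$ and $l_p\,sp=0$, and every analytic dynamical $\ell$-matrix with these two properties on a connected open neighbourhood of $0$ is a restriction of it. The dual $\mathcal G^\star$ is a bidynamical Lie quasi-bialgebra with respect to $\mathfrak g^\star=\mathfrak l\oplus\mathfrak l^\perp$ (so $l^{can}_{\mathcal G^\star}$ is defined), and $K$ is an isomorphism of Lie algebras $\mathfrak d^\star\to\mathfrak d$. 2. Both canonical $\ell$-matrices have the same domain of analyticity: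 $U_{\mathcal G^\star}=U_{\mathcal G}$. 3. For all $p\in U_{\mathcal G}$, as elements of $\mathfrak d\otimes\mathfrak d=\mathrm{Hom}(\mathfrak d^*,\mathfrak d)$, $$K\,j^\star\,(l^{can}_{\mathcal G^\star})_p\,{j^\star}^*K^*=\big(j\,l^{can}_{\mathcal G}\,j^*\big)^{\varsigma^{-1}}_p-\mathrm p_{\mathfrak l}+\mathrm p_{\mathfrak m^\perp},$$ where $\mathrm p_{\mathfrak l}$ and $\mathrm p_{\mathfrak m^\perp}$ are the projections for $\mathfrak d=\mathfrak l\oplus\mathfrak m\oplus\mathfrak l^\perp\oplus\mathfrak m^\perp$. -/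

import Mathlib

open Set
open scoped Topology Nat

noncomputable section

namespace Bidynamical

section Linear

variable {𝕜 : Type*} [RCLike 𝕜]
variable {E : Type*} [NormedAddCommGroup E] [NormedSpace 𝕜 E]
variable {F : Type*} [NormedAddCommGroup F] [NormedSpace 𝕜 F]

/-- The transpose `T* : F* → E*` of a linear map `T : E → F`. -/
def tr (T : E →L[𝕜] F) : StrongDual 𝕜 F →L[𝕜] StrongDual 𝕜 E :=
  ContinuousLinearMap.precomp 𝕜 T

@[simp] theorem tr_apply (T : E →L[𝕜] F) (ξ : StrongDual 𝕜 F) (x : E) : tr T ξ x = ξ (T x) := rfl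

variable (𝕜 E) in
/-- The `k`-th coordinate functional of a chosen basis of `E`. -/
def coordDual [FiniteDimensional 𝕜 E] (k : Fin (Module.finrank 𝕜 E)) : StrongDual 𝕜 E :=
  LinearMap.toContinuousLinearMap ((Module.finBasis 𝕜 E).coord k)

/-- The canonical identification `E** = E` of a finite-dimensional space with its bidual, written in
a basis; it does not depend on the basis, see `apply_ofBidual`. -/
def ofBidual [FiniteDimensional 𝕜 E] : StrongDual 𝕜 (StrongDual 𝕜 E) →L[𝕜] E :=
  ∑ k, (ContinuousLinearMap.apply 𝕜 𝕜 (coordDual 𝕜 E k)).smulRight (Module.finBasis 𝕜 E k)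

theorem apply_ofBidual [FiniteDimensional 𝕜 E] (f : StrongDual 𝕜 (StrongDual 𝕜 E))
    (ξ : StrongDual 𝕜 E) : ξ (ofBidual f) = f ξ := by
  have hξ : ξ = ∑ k, ξ (Module.finBasis 𝕜 E k) • coordDual 𝕜 E k := by
    apply ContinuousLinearMap.ext
    intro x
    have h := congrArg ξ ((Module.finBasis 𝕜 E).sum_repr x).symm
    rw [map_sum] at h
    rw [h]
    simp [coordDual, mul_comm]
  have hf : ofBidual f = ∑ k, f (coordDual 𝕜 E k) • Module.finBasis 𝕜 E k := by
    simp [ofBidual]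
  rw [hf, map_sum]
  conv_rhs => rw [hξ, map_sum]
  simp [mul_comm]

variable (𝕜) in
/-- The entire function `(e^A - 1) / A = ∑ Aⁿ / (n+1)!` of an endomorphism `A`. -/
def expDiv (A : E →L[𝕜] E) : E →L[𝕜] E :=
  ∑' n : ℕ, (((n + 1)! : ℕ) : 𝕜)⁻¹ • A ^ n

end Linear

/-- The data `(g, [ , ], ϖ, φ)` of a Lie quasi-bialgebra on a space `V = g`. Elements of `⋀²g` are
viewed as skew maps `g* → g`, so `cobracket x = ϖ_x : g* → g`, and `assoc ξ η = ⟨ξ ⊗ η ⊗ 1, φ⟩`. -/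
structure LieQuasiData (𝕜 V : Type*) [RCLike 𝕜] [NormedAddCommGroup V] [NormedSpace 𝕜 V] where
  bracket : V →ₗ[𝕜] V →ₗ[𝕜] V
  cobracket : V →ₗ[𝕜] StrongDual 𝕜 V →ₗ[𝕜] V
  assoc : StrongDual 𝕜 V →ₗ[𝕜] StrongDual 𝕜 V →ₗ[𝕜] V

/-- A vector space decomposition `g = l ⊕ m`, given by the inclusion `i : l → g` and the projection
`p : g → l` along `m = ker p`. -/
structure Splitting (𝕜 L V : Type*) [RCLike 𝕜] [NormedAddCommGroup L] [NormedSpace 𝕜 L]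
    [NormedAddCommGroup V] [NormedSpace 𝕜 V] where
  i : L →L[𝕜] V
  p : V →L[𝕜] L
  p_i : ∀ z, p (i z) = z

section Defs

variable {𝕜 : Type*} [RCLike 𝕜]
variable {L : Type*} [NormedAddCommGroup L] [NormedSpace 𝕜 L]
variable {V : Type*} [NormedAddCommGroup V] [NormedSpace 𝕜 V]

/-- `s : l* → g*`, the adjoint of the projection `g → l`; its image is `m^⊥`. -/
def Splitting.s (S : Splitting 𝕜 L V) : StrongDual 𝕜 L →L[𝕜] StrongDual 𝕜 V := tr S.p

namespace LieQuasiData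

variable [FiniteDimensional 𝕜 V]

/-- `ad_x : g → g`. -/
def ad (G : LieQuasiData 𝕜 V) (x : V) : V →L[𝕜] V := LinearMap.toContinuousLinearMap (G.bracket x)

/-- `ad*_x : g* → g*`, the transpose of `ad_x` (without sign). -/
def adT (G : LieQuasiData 𝕜 V) (x : V) : StrongDual 𝕜 V →L[𝕜] StrongDual 𝕜 V := tr (G.ad x)

@[simp] theorem ad_apply (G : LieQuasiData 𝕜 V) (x y : V) : G.ad x y = G.bracket x y := rfl

@[simp] theorem adT_apply (G : LieQuasiData 𝕜 V) (x y : V) (ξ : StrongDual 𝕜 V) :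
    G.adT x ξ y = ξ (G.bracket x y) := rfl

/-- `ϖ_x` as an element of the space `Hom(g*, g)`, which contains `⋀²g`. -/
def cobracketL (G : LieQuasiData 𝕜 V) (x : V) : StrongDual 𝕜 V →L[𝕜] V :=
  LinearMap.toContinuousLinearMap (G.cobracket x)

/-- The axioms of a Lie quasi-bialgebra: `(g, [ , ])` is a Lie algebra, `ϖ : g → ⋀²g` is a
1-cocycle, `φ ∈ ⋀³g`, `ad_x^{(3)} φ` is the cyclic sum of `⟨ξ, ϖ_{ϖ_x η} ζ⟩`, and `ϖ` and `φ` satisfy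
the compatibility condition in `⋀⁴g`. -/
structure IsLieQuasiBialgebra (G : LieQuasiData 𝕜 V) : Prop where
  bracket_self : ∀ x, G.bracket x x = 0
  jacobi : ∀ x y z, G.bracket x (G.bracket y z) + G.bracket y (G.bracket z x)
    + G.bracket z (G.bracket x y) = 0
  cobracket_skew : ∀ (x : V) (ξ η : StrongDual 𝕜 V), η (G.cobracket x ξ) = -ξ (G.cobracket x η)
  cobracket_cocycle : ∀ x y ξ, G.cobracket (G.bracket x y) ξ
    = (G.bracket x (G.cobracket y ξ) + G.cobracket y (G.adT x ξ))
      - (G.bracket y (G.cobracket x ξ) + G.cobracket x (G.adT y ξ))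
  assoc_skew : ∀ ξ η, G.assoc η ξ = -G.assoc ξ η
  assoc_cyclic : ∀ ξ η ζ : StrongDual 𝕜 V, ξ (G.assoc η ζ) = ζ (G.assoc ξ η)
  ad_assoc : ∀ (x : V) (ξ η ζ : StrongDual 𝕜 V),
    ζ (G.assoc (G.adT x ξ) η) + ζ (G.assoc ξ (G.adT x η)) + (G.adT x ζ) (G.assoc ξ η)
      = ξ (G.cobracket (G.cobracket x η) ζ) + η (G.cobracket (G.cobracket x ζ) ξ)
        + ζ (G.cobracket (G.cobracket x ξ) η)
  pentagon : ∀ ξ η ζ θ : StrongDual 𝕜 V,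
    (ζ (G.cobracket (G.assoc ξ η) θ) + ξ (G.cobracket (G.assoc ζ θ) η))
      + (ξ (G.cobracket (G.assoc η ζ) θ) + η (G.cobracket (G.assoc ξ θ) ζ))
      + (η (G.cobracket (G.assoc ζ ξ) θ) + ζ (G.cobracket (G.assoc η θ) ξ)) = 0

/-- `G` is a bidynamical Lie quasi-bialgebra with respect to `g = l ⊕ m`: the decomposition is
reductive, `ϖ_l = 0`, and `φ ≡ 0 mod l` (`φ` vanishes on `l^⊥ × l^⊥ × l^⊥`). -/
structure IsBidynamical (G : LieQuasiData 𝕜 V) (S : Splitting 𝕜 L V) : Prop where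
  isLieQuasiBialgebra : G.IsLieQuasiBialgebra
  subalgebra : ∀ z w : L, G.bracket (S.i z) (S.i w) ∈ range S.i
  reductive : ∀ (z : L) (u : V), S.p u = 0 → S.p (G.bracket (S.i z) u) = 0
  cobracket_l : ∀ z : L, G.cobracket (S.i z) = 0
  assoc_mod_l : ∀ ξ η ζ : StrongDual 𝕜 V, tr S.i ξ = 0 → tr S.i η = 0 → tr S.i ζ = 0 →
    ζ (G.assoc ξ η) = 0

/-- The map `ad*_z : l* → l*`, transpose of `ad_z : l → l`, for `z ∈ l`. -/
def adTL (G : LieQuasiData 𝕜 V) (S : Splitting 𝕜 L V) (z : L) (q : StrongDual 𝕜 L) :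
    StrongDual 𝕜 L :=
  q ∘L S.p ∘L G.ad (S.i z) ∘L S.i

/-- `ℓ ∈ Dynl(U, G)`: on `U`, the map `ℓ` is a classical dynamical `ℓ`-matrix associated
with `G`, i.e. it takes values in `⋀²g`, solves the generalized classical dynamical Yang-Baxter
equation, and is `l`-equivariant. -/
structure IsDynamicalLMatrix (G : LieQuasiData 𝕜 V) (S : Splitting 𝕜 L V)
    (U : Set (StrongDual 𝕜 L)) (ℓ : StrongDual 𝕜 L → (StrongDual 𝕜 V →L[𝕜] V)) : Prop where
  skew : ∀ q ∈ U, ∀ ξ η : StrongDual 𝕜 V, η (ℓ q ξ) = -ξ (ℓ q η)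
  yangBaxter : ∀ q ∈ U, ∀ ξ η ζ : StrongDual 𝕜 V,
    (ζ (fderiv 𝕜 ℓ q (tr S.i ξ) η) - ζ (G.bracket (ℓ q ξ) (ℓ q η)) - ζ (G.cobracket (ℓ q ξ) η))
    + (ξ (fderiv 𝕜 ℓ q (tr S.i η) ζ) - ξ (G.bracket (ℓ q η) (ℓ q ζ))
        - ξ (G.cobracket (ℓ q η) ζ))
    + (η (fderiv 𝕜 ℓ q (tr S.i ζ) ξ) - η (G.bracket (ℓ q ζ) (ℓ q ξ))
        - η (G.cobracket (ℓ q ζ) ξ))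
    = ζ (G.assoc ξ η)
  equivariant : ∀ q ∈ U, ∀ z : L,
    fderiv 𝕜 ℓ q (G.adTL S z q) + G.cobracketL (S.i z)
      + G.ad (S.i z) ∘L ℓ q + ℓ q ∘L G.adT (S.i z) = 0

/-- `ℓ` is, on the connected open neighbourhood `U` of `0`, an analytic representative of the
canonical dynamical `ℓ`-matrix of `G` and `g = l ⊕ m`: the one with `ℓ_0 = 0` and `ℓ_q(s q) = 0`. -/
structure IsCanonicalOn (G : LieQuasiData 𝕜 V) (S : Splitting 𝕜 L V)
    (U : Set (StrongDual 𝕜 L)) (ℓ : StrongDual 𝕜 L → (StrongDual 𝕜 V →L[𝕜] V)) : Prop where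
  isOpen : IsOpen U
  isPreconnected : IsPreconnected U
  zero_mem : (0 : StrongDual 𝕜 L) ∈ U
  analytic : AnalyticOnNhd 𝕜 ℓ U
  dynamical : G.IsDynamicalLMatrix S U ℓ
  map_zero : ℓ 0 = 0
  apply_s : ∀ q ∈ U, ℓ q (S.s q) = 0

/-- The domain of analyticity of the canonical `ℓ`-matrix: the union of all connected open
neighbourhoods of `0` in `l*` on which it exists as an analytic map. -/
def analyticityDomain (G : LieQuasiData 𝕜 V) (S : Splitting 𝕜 L V) : Set (StrongDual 𝕜 L) :=
  {q | ∃ ℓ U, G.IsCanonicalOn S U ℓ ∧ q ∈ U}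

open scoped Classical in
/-- The canonical dynamical `ℓ`-matrix `l^can_{G,l,m}` (with value `0` outside its domain of
analyticity). -/
def lcan (G : LieQuasiData 𝕜 V) (S : Splitting 𝕜 L V) (q : StrongDual 𝕜 L) :
    StrongDual 𝕜 V →L[𝕜] V :=
  if h : ∃ ℓ U, G.IsCanonicalOn S U ℓ ∧ q ∈ U then h.choose q else 0

/-- The infinitesimal adjoint action `t ↦ ad_x t + t ad*_x` on bivectors. -/
def adBivector (G : LieQuasiData 𝕜 V) (x : V) :
    (StrongDual 𝕜 V →L[𝕜] V) →L[𝕜] (StrongDual 𝕜 V →L[𝕜] V) :=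
  ContinuousLinearMap.compL 𝕜 (StrongDual 𝕜 V) V V (G.ad x)
    + (ContinuousLinearMap.compL 𝕜 (StrongDual 𝕜 V) (StrongDual 𝕜 V) V).flip (G.adT x)

/-- `Ad_{e^x} = e^{ad_x}`. -/
def AdExp (G : LieQuasiData 𝕜 V) (x : V) : V →L[𝕜] V := NormedSpace.exp (G.ad x)

/-- The right logarithmic derivative `r_{σ_q⁻¹}(T_q σ) : l* → g` of `σ = e^X`, `X : l* → g`, that is
`((e^{ad X_q} - 1) / ad X_q) ∘ d_q X`. -/
def logDerivExp (G : LieQuasiData 𝕜 V) (X : StrongDual 𝕜 L → V) (q : StrongDual 𝕜 L) :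
    StrongDual 𝕜 L →L[𝕜] V :=
  expDiv 𝕜 (G.ad (X q)) ∘L fderiv 𝕜 X q

/-- The value `π_{e^x} = ∫₀¹ Ad_{e^{tx}} ϖ_x Ad*_{e^{tx}} dt` at `e^x` of the group 1-cocycle `π`
integrating `ϖ`; the integral is `((e^a - 1) / a) ϖ_x` with `a = adBivector x`. -/
def cocycleExp (G : LieQuasiData 𝕜 V) (x : V) : StrongDual 𝕜 V →L[𝕜] V :=
  expDiv 𝕜 (G.adBivector x) (G.cobracketL x)

/-- The gauge transform `ℓ^σ_q = Ad_{σ_q} ℓ_q Ad*_{σ_q} + θ^σ_q + π_{σ_q}` of `ℓ` by `σ = e^X`, where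
`θ^σ_q = r_{σ_q⁻¹}(T_q σ) i* Ad*_{σ_q} - i (r_{σ_q⁻¹}(T_q σ))*`. -/
def gaugeExp [FiniteDimensional 𝕜 L] (G : LieQuasiData 𝕜 V) (i : L →L[𝕜] V)
    (X : StrongDual 𝕜 L → V) (ℓ : StrongDual 𝕜 L → (StrongDual 𝕜 V →L[𝕜] V))
    (q : StrongDual 𝕜 L) : StrongDual 𝕜 V →L[𝕜] V :=
  G.AdExp (X q) ∘L ℓ q ∘L tr (G.AdExp (X q))
    + (G.logDerivExp X q ∘L tr i ∘L tr (G.AdExp (X q))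
        - i ∘L ofBidual ∘L tr (G.logDerivExp X q))
    + G.cocycleExp (X q)

end LieQuasiData

/-! ### The double `d = g ⊕ g*` -/

section Double

variable [FiniteDimensional 𝕜 V]

/-- The bracket of the canonical double, with `[x, ξ] = ϖ_x ξ - ad*_x ξ` and
`[ξ, η] = ⟨ξ ⊗ η ⊗ 1, φ⟩ - ⟨ξ, ϖ_• η⟩`. -/
def LieQuasiData.doubleBracket (G : LieQuasiData 𝕜 V) :
    (V × StrongDual 𝕜 V) →ₗ[𝕜] (V × StrongDual 𝕜 V) →ₗ[𝕜] (V × StrongDual 𝕜 V) :=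
  LinearMap.mk₂ 𝕜
    (fun X Y =>
      (G.bracket X.1 Y.1 + G.cobracket X.1 Y.2 - G.cobracket Y.1 X.2 + G.assoc X.2 Y.2,
        -G.adT X.1 Y.2 + G.adT Y.1 X.2
          - LinearMap.toContinuousLinearMap (X.2.toLinearMap ∘ₗ G.cobracket.flip Y.2)))
    (by
      intro X X' Y
      ext
      · simp; abel
      · simp; ring)
    (by
      intro c X Y
      ext
      · simp [smul_sub, smul_add]
      · simp; ring)
    (by
      intro X Y Y'
      ext
      · simp; abel
      · simp; ring)
    (by
      intro c X Y
      ext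
      · simp [smul_sub, smul_add]
      · simp; ring)

variable (𝕜 V) in
/-- The identification `d* = d` by the canonical bilinear form
`(x + ξ, y + η) = ⟨ξ, y⟩ + ⟨η, x⟩` of the double. -/
def sharp : StrongDual 𝕜 (V × StrongDual 𝕜 V) →L[𝕜] (V × StrongDual 𝕜 V) :=
  (ofBidual ∘L tr (ContinuousLinearMap.inr 𝕜 V (StrongDual 𝕜 V))).prod
    (tr (ContinuousLinearMap.inl 𝕜 V (StrongDual 𝕜 V)))

variable (𝕜 V) in
/-- The `r`-matrix `½ (p_{g*} - p_g) ∈ ⋀²d`. -/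
def rMatrix : StrongDual 𝕜 (V × StrongDual 𝕜 V) →L[𝕜] (V × StrongDual 𝕜 V) :=
  (2⁻¹ : 𝕜) •
    ((ContinuousLinearMap.inr 𝕜 V (StrongDual 𝕜 V) ∘L ContinuousLinearMap.snd 𝕜 V (StrongDual 𝕜 V)
      - ContinuousLinearMap.inl 𝕜 V (StrongDual 𝕜 V)
        ∘L ContinuousLinearMap.fst 𝕜 V (StrongDual 𝕜 V)) ∘L sharp 𝕜 V)

/-- The Lie quasi-bialgebra structure `G^{(2)} = (d, [ , ]_d, ∂r, j^{(3)} φ)` on the double, where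
`∂_X r = ad_X r + r ad*_X`. -/
def LieQuasiData.double (G : LieQuasiData 𝕜 V) : LieQuasiData 𝕜 (V × StrongDual 𝕜 V) where
  bracket := G.doubleBracket
  cobracket := LinearMap.mk₂ 𝕜
    (fun X f => G.doubleBracket X (rMatrix 𝕜 V f)
      + rMatrix 𝕜 V (tr (LinearMap.toContinuousLinearMap (G.doubleBracket X)) f))
    (by
      intro X X' f
      have h : tr (LinearMap.toContinuousLinearMap (G.doubleBracket (X + X'))) f
          = tr (LinearMap.toContinuousLinearMap (G.doubleBracket X)) f
            + tr (LinearMap.toContinuousLinearMap (G.doubleBracket X')) f := by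
        apply ContinuousLinearMap.ext
        intro Y
        simp only [tr_apply, LinearMap.coe_toContinuousLinearMap', map_add,
          add_apply]
      rw [h, map_add, map_add, LinearMap.add_apply]
      abel)
    (by
      intro c X f
      have h : tr (LinearMap.toContinuousLinearMap (G.doubleBracket (c • X))) f
          = c • tr (LinearMap.toContinuousLinearMap (G.doubleBracket X)) f := by
        apply ContinuousLinearMap.ext
        intro Y
        simp only [tr_apply, LinearMap.coe_toContinuousLinearMap', map_smul,
          smul_apply]
      rw [h, map_smul, map_smul, LinearMap.smul_apply, smul_add])
    (by
      intro X f f'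
      simp only [map_add]
      abel)
    (by
      intro c X f
      simp only [map_smul, smul_add])
  assoc := ((G.assoc.compl₁₂ (tr (ContinuousLinearMap.inl 𝕜 V (StrongDual 𝕜 V))).toLinearMap
    (tr (ContinuousLinearMap.inl 𝕜 V (StrongDual 𝕜 V))).toLinearMap).compr₂
      (LinearMap.inl 𝕜 V (StrongDual 𝕜 V)))

end Double

/-! ### The dual over `l` -/

namespace Splitting

/-- The subspace `g^⋆ = l ⊕ l^⊥` of the double `d = g ⊕ g*`. -/
def dualSubspace (S : Splitting 𝕜 L V) : Submodule 𝕜 (V × StrongDual 𝕜 V) :=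
  (LinearMap.range S.i.toLinearMap).prod (LinearMap.ker (tr S.i).toLinearMap)

/-- The space `g^⋆ = l ⊕ l^⊥` as a normed space of its own. -/
def DualSpace (S : Splitting 𝕜 L V) : Type _ := S.dualSubspace

instance (S : Splitting 𝕜 L V) : NormedAddCommGroup S.DualSpace :=
  inferInstanceAs (NormedAddCommGroup S.dualSubspace)

instance (S : Splitting 𝕜 L V) : NormedSpace 𝕜 S.DualSpace :=
  inferInstanceAs (NormedSpace 𝕜 S.dualSubspace)

instance [FiniteDimensional 𝕜 V] (S : Splitting 𝕜 L V) : FiniteDimensional 𝕜 S.DualSpace :=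
  inferInstanceAs (FiniteDimensional 𝕜 S.dualSubspace)

/-- The inclusion of `g^⋆` in `d`. -/
def inclDual (S : Splitting 𝕜 L V) : S.DualSpace →L[𝕜] (V × StrongDual 𝕜 V) :=
  S.dualSubspace.subtypeL

/-- The projection `p_{l ⊕ l^⊥}` of `d` on `g^⋆` along `m ⊕ m^⊥`. -/
def projDual (S : Splitting 𝕜 L V) : (V × StrongDual 𝕜 V) →L[𝕜] S.DualSpace :=
  ((S.i ∘L S.p).prodMap (ContinuousLinearMap.id 𝕜 (StrongDual 𝕜 V) - S.s ∘L tr S.i)).codRestrict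
    S.dualSubspace (by
      rintro ⟨x, ξ⟩
      refine ⟨⟨S.p x, rfl⟩, ?_⟩
      change tr S.i (ξ - S.s (tr S.i ξ)) = 0
      ext z
      simp [Splitting.s, S.p_i])

/-- The decomposition `g^⋆ = l ⊕ l^⊥`: the inclusion `l → g^⋆` and the projection `g^⋆ → l` along
`l^⊥`. -/
def dual (S : Splitting 𝕜 L V) : Splitting 𝕜 L S.DualSpace where
  i := (ContinuousLinearMap.inl 𝕜 V (StrongDual 𝕜 V) ∘L S.i).codRestrict S.dualSubspace (by
    intro z
    exact ⟨⟨z, rfl⟩, map_zero (tr S.i)⟩)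
  p := S.p ∘L ContinuousLinearMap.fst 𝕜 V (StrongDual 𝕜 V) ∘L S.inclDual
  p_i := by
    intro z
    exact S.p_i z

variable [FiniteDimensional 𝕜 V]

/-- The identification of `(g^⋆)*` with the complement `m ⊕ m^⊥` of `g^⋆` in `d` by the canonical
bilinear form. -/
def complDual (S : Splitting 𝕜 L V) : StrongDual 𝕜 S.DualSpace →L[𝕜] (V × StrongDual 𝕜 V) :=
  (ofBidual ∘L tr (S.projDual ∘L ContinuousLinearMap.inr 𝕜 V (StrongDual 𝕜 V))).prod
    (S.s ∘L tr S.dual.i)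

/-- The map `complDual` is given by the canonical form: `(complDual f, X) = f X` for `X ∈ g^⋆`. -/
theorem complDual_pairing (S : Splitting 𝕜 L V) (f : StrongDual 𝕜 S.DualSpace) (X : S.DualSpace) :
    (S.complDual f).2 (S.inclDual X).1 + (S.inclDual X).2 (S.complDual f).1 = f X := by
  have h1 : (S.inclDual X).2 (S.complDual f).1 = f (S.projDual (0, (S.inclDual X).2)) :=
    apply_ofBidual _ _
  have h2 : (S.complDual f).2 (S.inclDual X).1 = f (S.dual.i (S.p (S.inclDual X).1)) := rfl
  rw [h1, h2, ← map_add]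
  congr 1
  obtain ⟨⟨x, ξ⟩, ⟨z, hz⟩, hξ⟩ := X
  have hz' : S.i z = x := hz
  have hξ' : tr S.i ξ = 0 := hξ
  apply Subtype.ext
  change (S.i (S.p x), (0 : StrongDual 𝕜 V)) + (S.i (S.p 0), ξ - S.s (tr S.i ξ)) = (x, ξ)
  simp [← hz', hξ', S.p_i]

/-- The image of `complDual` lies in `m ⊕ m^⊥`. -/
theorem projDual_complDual (S : Splitting 𝕜 L V) (f : StrongDual 𝕜 S.DualSpace) :
    S.projDual (S.complDual f) = 0 := by
  have hp : ∀ α : StrongDual 𝕜 L, α (S.p (S.complDual f).1) = 0 := by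
    intro α
    have h : (S.s α) (S.complDual f).1 = f (S.projDual (0, S.s α)) := apply_ofBidual _ _
    have h0 : S.projDual (0, S.s α) = 0 := by
      apply Subtype.ext
      change (S.i (S.p 0), S.s α - S.s (tr S.i (S.s α))) = ((0, 0) : V × StrongDual 𝕜 V)
      have : tr S.i (S.s α) = α := by ext z; simp [Splitting.s, S.p_i]
      simp [this]
    rw [h0, map_zero] at h
    exact h
  have hp' : S.p (S.complDual f).1 = 0 := by
    by_contra hne
    obtain ⟨g, _, hg⟩ := exists_dual_vector 𝕜 (S.p (S.complDual f).1) (norm_ne_zero_iff.mpr hne)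
    rw [hp g] at hg
    have := norm_ne_zero_iff.mpr hne
    exact this (by exact_mod_cast hg.symm)
  have h2 : (S.complDual f).2 = S.s (tr S.dual.i f) := rfl
  have h3 : tr S.i (S.s (tr S.dual.i f)) = tr S.dual.i f := by
    ext z; simp [Splitting.s, S.p_i]
  apply Subtype.ext
  change (S.i (S.p (S.complDual f).1), (S.complDual f).2 - S.s (tr S.i (S.complDual f).2))
    = ((0, 0) : V × StrongDual 𝕜 V)
  rw [hp', h2, h3, map_zero, sub_self]

/-- The canonical inclusion `j^⋆ : g^⋆ → d^⋆ = g^⋆ ⊕ (g^⋆)*`. -/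
def jDual (S : Splitting 𝕜 L V) : S.DualSpace →L[𝕜] (S.DualSpace × StrongDual 𝕜 S.DualSpace) :=
  ContinuousLinearMap.inl 𝕜 S.DualSpace (StrongDual 𝕜 S.DualSpace)

/-- The isomorphism `K = p_{l ⊕ l^⊥} - p_{m ⊕ m^⊥}` between the double `d^⋆ = g^⋆ ⊕ (g^⋆)*` of the
dual and the double `d`, where `d^⋆` and `d` are identified by `(X, f) ↦ X + complDual f`. -/
def K (S : Splitting 𝕜 L V) :
    (S.DualSpace × StrongDual 𝕜 S.DualSpace) →L[𝕜] (V × StrongDual 𝕜 V) :=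
  S.inclDual ∘L ContinuousLinearMap.fst 𝕜 S.DualSpace (StrongDual 𝕜 S.DualSpace)
    - S.complDual ∘L ContinuousLinearMap.snd 𝕜 S.DualSpace (StrongDual 𝕜 S.DualSpace)

/-- The canonical inclusion `j : g → d = g ⊕ g*`. -/
def j (_S : Splitting 𝕜 L V) : V →L[𝕜] (V × StrongDual 𝕜 V) :=
  ContinuousLinearMap.inl 𝕜 V (StrongDual 𝕜 V)

/-- The projection `p_l` of `d` on `l` along `m ⊕ g*`, as an element of `d ⊗ d = Hom(d*, d)`. -/
def projL (S : Splitting 𝕜 L V) :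
    StrongDual 𝕜 (V × StrongDual 𝕜 V) →L[𝕜] (V × StrongDual 𝕜 V) :=
  (S.i ∘L S.p).prodMap (0 : StrongDual 𝕜 V →L[𝕜] StrongDual 𝕜 V) ∘L sharp 𝕜 V

/-- The projection `p_{m^⊥}` of `d` on `m^⊥` along `g ⊕ l^⊥`, as an element of
`d ⊗ d = Hom(d*, d)`. -/
def projMPerp (S : Splitting 𝕜 L V) :
    StrongDual 𝕜 (V × StrongDual 𝕜 V) →L[𝕜] (V × StrongDual 𝕜 V) :=
  (0 : V →L[𝕜] V).prodMap (S.s ∘L tr S.i) ∘L sharp 𝕜 V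

/-- The element `-s q ∈ g* ⊆ d` for `q ∈ l*`, so that `ς⁻¹ : q ↦ e^{-sq}` is the exponential of
`negS`. -/
def negS (S : Splitting 𝕜 L V) (q : StrongDual 𝕜 L) : V × StrongDual 𝕜 V := (0, -S.s q)

end Splitting

/-- The dual over `l` of `G`: the Lie quasi-bialgebra of the Manin quasi-triple
`(d, l ⊕ l^⊥, m^⊥ ⊕ m)` with the sign of its cobracket reversed. For the Lie quasi-bialgebra
of a Manin quasi-triple `(d, a, b)` one has `ϖ_x ξ = p_a [x, ξ]` and `⟨ξ ⊗ η ⊗ 1, φ⟩ = p_a [ξ, η]`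
for `x ∈ a` and `ξ, η ∈ b = a*`. -/
def LieQuasiData.dual [FiniteDimensional 𝕜 V] (G : LieQuasiData 𝕜 V) (S : Splitting 𝕜 L V) :
    LieQuasiData 𝕜 S.DualSpace where
  bracket := (G.doubleBracket.compl₁₂ S.inclDual.toLinearMap S.inclDual.toLinearMap).compr₂
    S.projDual.toLinearMap
  cobracket := -(G.doubleBracket.compl₁₂ S.inclDual.toLinearMap S.complDual.toLinearMap).compr₂
    S.projDual.toLinearMap
  assoc := (G.doubleBracket.compl₁₂ S.complDual.toLinearMap S.complDual.toLinearMap).compr₂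
    S.projDual.toLinearMap

end Defs

end Bidynamical

end

/-! The double d = g ⊕ g* is a Lie algebra with an invariant form, and skewness of `ℓ q` says that
its graph is isotropic in d. Write A = ad_{sq} and E_k(A) = ∑ Aⁿ/(n+k)!, so that E_0 = e^A and E_1 =
(e^A - 1)/A. The canonical ℓ-matrix is explicit. For η = η' + η'' in l^⊥ ⊕ m^⊥ put F_k η = E_k(A) η'
+ E_{k+1}(A) η''. The operator `frame` sends η to F_0 η - p_l F_1 η; it is entire in q, and the
ℓ-matrix is characterised by `ℓ q ∘L frameSnd = frameFst`, that is, the graph contains the image of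
g*.

Existence. The defining properties become identities for the frame: skewness is isotropy
(`frame_isotropic`), equivariance is the derivative along coadjoint orbits (`fderiv_frame_adTL`),
and the Yang-Baxter equation is a Maurer-Cartan identity (`cyclic_fderiv_frame`). These come from
identities between the E_k(ad y) in any quadratic Lie algebra, proved by replacing A with tA and
differentiating in t. They yield the equations for ℓ where `frameSnd` is onto. Such points are
dense, since `frameSnd` is 1 at 0, and continuity gives the rest.

Uniqueness. Contracting the Yang-Baxter equation with sq and using `ℓ q (s q) = 0` leaves an
equation for the radial derivative of ℓ. The defect `ℓ ∘ frameSnd - frameFst` then solves a Fuchsian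
equation without resonances at positive integers, so it vanishes (`comp_frameSnd`). Local solutions
therefore agree and glue over the union of their domains.

Duality. K respects the brackets of the doubles, reverses the sign of the form, commutes with p_l
and p_{m^⊥}, and sends sq to -sq. It thus carries the frame of the dual at q to the frame of G at -q
(`K_frame`). Under d* = d the right side of the formula is the operator `gaugeOp`
(`gaugeExp_dForm`). It kills g^⋆, and on the transported frame it returns the dual ℓ-matrix
(`gaugeOp_complDual`). The resulting relation expresses either ℓ-matrix through the other with
coefficients entire in q, so the domains coincide. -/

open Set
open scoped Topology Nat

noncomputable section

namespace Bidynamical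

/-! ### Entire functions ∑ Aⁿ/(n+k)! in a Banach algebra -/

section ExpTail

variable {𝕜 : Type*} [RCLike 𝕜] {𝔸 : Type*} [NormedRing 𝔸] [NormedAlgebra 𝕜 𝔸]

variable (𝕜) in
/-- The entire function `∑ Aⁿ / (n + k)!`. -/
def expTail (k : ℕ) (A : 𝔸) : 𝔸 := ∑' n : ℕ, (((n + k)! : ℕ) : 𝕜)⁻¹ • A ^ n

theorem norm_inv_factorial_add_le (n k : ℕ) :
    ‖(((n + k)! : ℕ) : 𝕜)⁻¹‖ ≤ ‖((n ! : ℕ) : 𝕜)⁻¹‖ := by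
  rw [norm_inv, norm_inv, RCLike.norm_natCast, RCLike.norm_natCast]
  have h : ((n ! : ℕ) : ℝ) ≤ ((n + k)! : ℕ) := by
    exact_mod_cast Nat.factorial_le (Nat.le_add_right n k)
  have h0 : (0 : ℝ) < (n ! : ℕ) := by exact_mod_cast Nat.factorial_pos n
  exact inv_anti₀ h0 h

theorem summable_norm_expTail (k : ℕ) (A : 𝔸) :
    Summable fun n : ℕ => ‖(((n + k)! : ℕ) : 𝕜)⁻¹ • A ^ n‖ := by
  refine Summable.of_nonneg_of_le (fun _ => norm_nonneg _) (fun n => ?_)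
    (NormedSpace.norm_expSeries_summable' (𝕂 := 𝕜) A)
  rw [norm_smul, norm_smul]
  exact mul_le_mul_of_nonneg_right (norm_inv_factorial_add_le n k) (norm_nonneg _)

theorem expTail_zero_left (A : 𝔸) : expTail 𝕜 0 A = NormedSpace.exp A := by
  rw [NormedSpace.exp_eq_tsum 𝕜]
  rfl

variable [CompleteSpace 𝔸]

theorem hasSum_expTail (k : ℕ) (A : 𝔸) :
    HasSum (fun n : ℕ => (((n + k)! : ℕ) : 𝕜)⁻¹ • A ^ n) (expTail 𝕜 k A) :=
  (summable_norm_expTail k A).of_norm.hasSum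

/-- Removing the constant term 1/k! from one series leaves A times the next. This relation replaces
division by A, which need not be invertible. -/
theorem mul_expTail_succ (k : ℕ) (A : 𝔸) :
    A * expTail 𝕜 (k + 1) A = expTail 𝕜 k A - ((k ! : ℕ) : 𝕜)⁻¹ • (1 : 𝔸) := by
  have h1 := (hasSum_expTail (𝕜 := 𝕜) (k + 1) A).mul_left A
  have h2 := (hasSum_nat_add_iff' 1).2 (hasSum_expTail (𝕜 := 𝕜) k A)
  simp only [Finset.range_one, Finset.sum_singleton, zero_add, pow_zero] at h2
  have h : (fun n : ℕ => A * ((((n + (k + 1))! : ℕ) : 𝕜)⁻¹ • A ^ n))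
      = fun n : ℕ => (((n + 1 + k)! : ℕ) : 𝕜)⁻¹ • A ^ (n + 1) := by
    funext n
    rw [mul_smul_comm, ← pow_succ', show n + 1 + k = n + (k + 1) by ring]
  rw [h] at h1
  exact h1.unique h2

theorem commute_expTail {A B : 𝔸} (h : Commute A B) (k : ℕ) : Commute (expTail 𝕜 k A) B := by
  have h1 := (hasSum_expTail (𝕜 := 𝕜) k A).mul_left B
  have h2 := (hasSum_expTail (𝕜 := 𝕜) k A).mul_right B
  have h : (fun n : ℕ => B * ((((n + k)! : ℕ) : 𝕜)⁻¹ • A ^ n))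
      = fun n : ℕ => ((((n + k)! : ℕ) : 𝕜)⁻¹ • A ^ n) * B := by
    funext n
    rw [mul_smul_comm, smul_mul_assoc, (h.pow_left n).eq]
  rw [h] at h1
  exact h2.unique h1

theorem expTail_succ_mul (k : ℕ) (A : 𝔸) :
    expTail 𝕜 (k + 1) A * A = expTail 𝕜 k A - ((k ! : ℕ) : 𝕜)⁻¹ • (1 : 𝔸) := by
  rw [(commute_expTail (Commute.refl A) _).eq, mul_expTail_succ]

theorem expTail_zero_right (k : ℕ) : expTail 𝕜 k (0 : 𝔸) = ((k ! : ℕ) : 𝕜)⁻¹ • 1 := by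
  have h := mul_expTail_succ (𝕜 := 𝕜) k (0 : 𝔸)
  rw [zero_mul] at h
  exact (sub_eq_zero.1 h.symm)

-- Consecutive coefficients have quotient 1/(n+k+1), which tends to 0, so the radius of convergence
-- is infinite.
variable (𝕜 𝔸) in
theorem analyticAt_expTail (k : ℕ) (A : 𝔸) : AnalyticAt 𝕜 (expTail 𝕜 k : 𝔸 → 𝔸) A := by
  have hr : (FormalMultilinearSeries.ofScalars 𝔸
      (fun n => (((n + k)! : ℕ) : 𝕜)⁻¹)).radius = ⊤ := by
    refine FormalMultilinearSeries.ofScalars_radius_eq_top_of_tendsto 𝔸 _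
      (Filter.Eventually.of_forall fun n => ?_) ?_
    · exact inv_ne_zero (Nat.cast_ne_zero.2 (Nat.factorial_ne_zero _))
    · have h : ∀ n : ℕ, ‖(((n.succ + k)! : ℕ) : 𝕜)⁻¹‖ / ‖(((n + k)! : ℕ) : 𝕜)⁻¹‖
          = 1 / (((n + k : ℕ) : ℝ) + 1) := by
        intro n
        rw [norm_inv, norm_inv, RCLike.norm_natCast, RCLike.norm_natCast,
          show n.succ + k = (n + k) + 1 by omega, Nat.factorial_succ]
        have : (((n + k)! : ℕ) : ℝ) ≠ 0 := Nat.cast_ne_zero.2 (Nat.factorial_ne_zero _)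
        push_cast
        field_simp
      simp_rw [h]
      exact (tendsto_one_div_add_atTop_nhds_zero_nat (𝕜 := ℝ)).comp
        (Filter.tendsto_add_atTop_nat k)
  have h := (FormalMultilinearSeries.ofScalars 𝔸
    (fun n => (((n + k)! : ℕ) : 𝕜)⁻¹)).hasFPowerSeriesOnBall (by rw [hr]; exact ENNReal.zero_lt_top)
  rw [hr] at h
  have h2 := h.analyticAt_of_mem (y := A) (by simp)
  refine h2.congr (Filter.Eventually.of_forall fun B => ?_)
  exact FormalMultilinearSeries.ofScalars_sum_eq _ _

/-- Term by term, t^(n+k+1)/(n+k+1)! is a primitive of t^(n+k)/(n+k)!. The scaled tails are thus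
successive primitives vanishing at t = 0, and the identities below follow by comparing derivatives
in t and values at 0. -/
theorem hasDerivAt_pow_smul_expTail_succ (k : ℕ) (A : 𝔸) (t : 𝕜) :
    HasDerivAt (fun t : 𝕜 => t ^ (k + 1) • expTail 𝕜 (k + 1) (t • A))
      (t ^ k • expTail 𝕜 k (t • A)) t := by
  -- On the ball of radius R the differentiated series is dominated by R^k times the norms of the
  -- terms of E_k(RA). The ball contains t, and 0, where every term of the original series vanishes.
  set R : ℝ := ‖t‖ + 1 with hR
  have hR0 : 0 ≤ R := by positivity
  have key : HasDerivAt
      (fun z : 𝕜 => ∑' n : ℕ, (z ^ (n + (k + 1)) * (((n + (k + 1))! : ℕ) : 𝕜)⁻¹) • A ^ n)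
      (∑' n : ℕ, (t ^ (n + k) * (((n + k)! : ℕ) : 𝕜)⁻¹) • A ^ n) t := by
    refine hasDerivAt_tsum_of_isPreconnected (F := 𝔸)
      (g := fun (n : ℕ) (z : 𝕜) => (z ^ (n + (k + 1)) * (((n + (k + 1))! : ℕ) : 𝕜)⁻¹) • A ^ n)
      (g' := fun (n : ℕ) (t : 𝕜) => (t ^ (n + k) * (((n + k)! : ℕ) : 𝕜)⁻¹) • A ^ n)
      (t := Metric.ball (0 : 𝕜) R) (y₀ := (0 : 𝕜))
      (u := fun n => R ^ k * ‖(((n + k)! : ℕ) : 𝕜)⁻¹ • ((R : 𝕜) • A) ^ n‖) ?_ Metric.isOpen_ball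
      (convex_ball (0 : 𝕜) R).isPreconnected ?_ ?_ ?_ ?_ ?_
    · exact (summable_norm_expTail k _).mul_left _
    · intro n y _
      have h := ((hasDerivAt_pow (n + (k + 1)) y).mul_const
        ((((n + (k + 1))! : ℕ) : 𝕜)⁻¹)).smul_const (A ^ n)
      convert h using 2
      rw [show n + (k + 1) = (n + k) + 1 by ring, Nat.factorial_succ]
      have h1 : (((n + k)! : ℕ) : 𝕜) ≠ 0 := Nat.cast_ne_zero.2 (Nat.factorial_ne_zero _)
      have h2 : ((n + k + 1 : ℕ) : 𝕜) ≠ 0 := Nat.cast_ne_zero.2 (Nat.succ_ne_zero _)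
      rw [Nat.add_sub_cancel, Nat.cast_mul]
      field_simp
    · intro n y hy
      have hy' : ‖y‖ ≤ R := by
        have := mem_ball_zero_iff.1 hy
        exact this.le
      have hRn : ‖(R : 𝕜) ^ n‖ = R ^ n := by
        rw [norm_pow, RCLike.norm_ofReal, abs_of_nonneg hR0]
      rw [smul_pow, smul_smul, norm_smul, norm_smul, norm_mul, norm_mul, hRn, norm_pow y]
      calc ‖y‖ ^ (n + k) * ‖(((n + k)! : ℕ) : 𝕜)⁻¹‖ * ‖A ^ n‖
          ≤ R ^ (n + k) * ‖(((n + k)! : ℕ) : 𝕜)⁻¹‖ * ‖A ^ n‖ := by gcongr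
        _ = _ := by ring
    · simp [hR]; positivity
    · simp
    · simp [hR]
  convert key using 1
  · funext z
    rw [← (hasSum_expTail (𝕜 := 𝕜) (k + 1) (z • A)).tsum_eq]
    rw [← (hasSum_expTail (𝕜 := 𝕜) (k + 1) (z • A)).summable.tsum_const_smul]
    congr 1
    funext n
    rw [smul_pow, smul_smul, smul_smul]
    congr 1
    ring
  · rw [← (hasSum_expTail (𝕜 := 𝕜) k (t • A)).tsum_eq]
    rw [← (hasSum_expTail (𝕜 := 𝕜) k (t • A)).summable.tsum_const_smul]
    congr 1
    funext n
    rw [smul_pow, smul_smul, smul_smul]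
    congr 1
    ring

theorem hasDerivAt_expTail_zero (A : 𝔸) (t : 𝕜) :
    HasDerivAt (fun t : 𝕜 => expTail 𝕜 0 (t • A)) (A * expTail 𝕜 0 (t • A)) t := by
  simp_rw [expTail_zero_left]
  exact hasDerivAt_exp_smul_const' A t

end ExpTail

end Bidynamical
end

/-! ### Calculus: intertwined and adjoint operators, exchange of derivatives -/

open Set
open scoped Topology Nat

noncomputable section

namespace Bidynamical

section Calculus

variable {𝕜 : Type*} [RCLike 𝕜]
variable {E : Type*} [NormedAddCommGroup E] [NormedSpace 𝕜 E] [CompleteSpace E]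
variable {F : Type*} [NormedAddCommGroup F] [NormedSpace 𝕜 F] [CompleteSpace F]

theorem hasSum_expTail_apply (k : ℕ) (A : E →L[𝕜] E) (x : E) :
    HasSum (fun n : ℕ => (((n + k)! : ℕ) : 𝕜)⁻¹ • (A ^ n) x) (expTail 𝕜 k A x) := by
  have h := hasSum_expTail (𝕜 := 𝕜) k A
  simpa using (ContinuousLinearMap.apply 𝕜 E x).hasSum h

/-- Power series of intertwined operators are intertwined. -/
theorem map_expTail_apply (T : E →L[𝕜] F) (A : E →L[𝕜] E) (B : F →L[𝕜] F)
    (h : ∀ x, T (A x) = B (T x)) (k : ℕ) (x : E) :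
    T (expTail 𝕜 k A x) = expTail 𝕜 k B (T x) := by
  have hn : ∀ n x, T ((A ^ n) x) = (B ^ n) (T x) := by
    intro n
    induction n with
    | zero => intro x; rfl
    | succ n ih => intro x; rw [pow_succ, pow_succ, mul_apply_eq_comp, ih, h]; rfl
  have h1 := T.hasSum (hasSum_expTail_apply k A x)
  have h2 := hasSum_expTail_apply k B (T x)
  simp only [map_smul, hn] at h1
  exact h1.unique h2

/-- Power series of operators adjoint for a pairing are adjoint. -/
theorem expTail_adjoint (b : E →L[𝕜] F →L[𝕜] 𝕜) (A : E →L[𝕜] E) (B : F →L[𝕜] F)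
    (h : ∀ x y, b (A x) y = b x (B y)) (k : ℕ) (x : E) (y : F) :
    b (expTail 𝕜 k A x) y = b x (expTail 𝕜 k B y) := by
  have hn : ∀ n x y, b ((A ^ n) x) y = b x ((B ^ n) y) := by
    intro n
    induction n with
    | zero => intro x y; rfl
    | succ n ih =>
      intro x y
      rw [pow_succ, pow_succ', mul_apply_eq_comp, mul_apply_eq_comp, ih, h]
  have h1 := (b.flip y).hasSum (hasSum_expTail_apply k A x)
  have h2 := (b x).hasSum (hasSum_expTail_apply k B y)
  simp only [map_smul, hn, ContinuousLinearMap.flip_apply] at h1 h2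
  exact h1.unique h2

theorem eq_of_hasDerivAt_zero {f : 𝕜 → F} (h : ∀ t, HasDerivAt f 0 t) (t : 𝕜) : f t = f 0 :=
  is_const_of_deriv_eq_zero (fun t => (h t).differentiableAt) (fun t => (h t).deriv) t 0

theorem eq_of_hasDerivAt_eq {f g f' : 𝕜 → F} (hf : ∀ t, HasDerivAt f (f' t) t)
    (hg : ∀ t, HasDerivAt g (f' t) t) (h0 : f 0 = g 0) (t : 𝕜) : f t = g t := by
  have h := eq_of_hasDerivAt_zero (f := fun t => f t - g t)
    (fun t => by simpa using (hf t).fun_sub (hg t)) t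
  simpa [h0, sub_eq_zero] using h

/-- The function g is the partial derivative of f in t, so this is the symmetry of the second
derivative of f. It lets equations in t be differentiated with respect to the operator. -/
theorem hasDerivAt_fderiv_swap {f g : 𝕜 × E → F} (hf : ∀ z, AnalyticAt 𝕜 f z)
    (hg : ∀ z, AnalyticAt 𝕜 g z) (hfg : ∀ t B, HasDerivAt (fun t => f (t, B)) (g (t, B)) t)
    (A C : E) (t : 𝕜) :
    HasDerivAt (fun t => fderiv 𝕜 (fun B => f (t, B)) A C)
      (fderiv 𝕜 (fun B => g (t, B)) A C) t := by
  have hin : ∀ t : 𝕜, HasFDerivAt (fun B : E => (t, B)) (ContinuousLinearMap.inr 𝕜 𝕜 E) A :=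
    fun t => hasFDerivAt_prodMk_right t A
  have h1 : ∀ t, fderiv 𝕜 (fun B => f (t, B)) A C = fderiv 𝕜 f (t, A) (0, C) := by
    intro t
    have h : fderiv 𝕜 (fun B => f (t, B)) A = _ :=
      ((hf (t, A)).differentiableAt.hasFDerivAt.comp A (hin t)).fderiv
    rw [h]
    simp
  have h2 : fderiv 𝕜 (fun B => g (t, B)) A C = fderiv 𝕜 g (t, A) (0, C) := by
    have h : fderiv 𝕜 (fun B => g (t, B)) A = _ :=
      ((hg (t, A)).differentiableAt.hasFDerivAt.comp A (hin t)).fderiv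
    rw [h]
    simp
  have h3 : ∀ z : 𝕜 × E, g z = fderiv 𝕜 f z (1, 0) := by
    rintro ⟨t, B⟩
    have h := (hf (t, B)).differentiableAt.hasFDerivAt.comp_hasDerivAt t
      ((hasDerivAt_id t).prodMk (hasDerivAt_const t B))
    exact (hfg t B).unique h
  have hff : ∀ z, HasFDerivAt (fderiv 𝕜 f) (fderiv 𝕜 (fderiv 𝕜 f) z) z :=
    fun z => (hf z).fderiv.differentiableAt.hasFDerivAt
  have hsymm : IsSymmSndFDerivAt 𝕜 f (t, A) :=
    ((hf (t, A)).contDiffAt (n := minSmoothness 𝕜 2)).isSymmSndFDerivAt le_rfl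
  have h4 : fderiv 𝕜 g (t, A) (0, C) = fderiv 𝕜 (fderiv 𝕜 f) (t, A) (0, C) (1, 0) := by
    have : g = fun z => fderiv 𝕜 f z (1, 0) := funext h3
    rw [this, ((hff (t, A)).clm_apply (hasFDerivAt_const _ _)).fderiv]
    simp
  simp_rw [h1]
  rw [h2, h4, hsymm.eq]
  have h5 := (hff (t, A)).comp_hasDerivAt t ((hasDerivAt_id t).prodMk (hasDerivAt_const t A))
  simpa using h5.clm_apply (hasDerivAt_const t ((0, C) : 𝕜 × E))

end Calculus

/-! ### Directional derivatives of the tails -/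

section DerivExpTail

variable {𝕜 : Type*} [RCLike 𝕜] {𝔸 : Type*} [NormedRing 𝔸] [NormedAlgebra 𝕜 𝔸] [CompleteSpace 𝔸]

variable (𝕜) in
/-- The derivative of `expTail k` at `A` in the direction `C`. -/
def dExpTail (k : ℕ) (A C : 𝔸) : 𝔸 := fderiv 𝕜 (expTail 𝕜 k) A C

theorem analyticAt_smul_expTail (k : ℕ) (z : 𝕜 × 𝔸) :
    AnalyticAt 𝕜 (fun z : 𝕜 × 𝔸 => z.1 ^ k • expTail 𝕜 k (z.1 • z.2)) z := by
  have h1 : AnalyticAt 𝕜 (fun z : 𝕜 × 𝔸 => z.1 • z.2) z := analyticAt_fst.smul analyticAt_snd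
  exact (analyticAt_fst.pow k).smul
    (AnalyticAt.fun_comp (g := expTail 𝕜 k) (analyticAt_expTail 𝕜 𝔸 k _) h1)

theorem fderiv_smul_expTail (k : ℕ) (A C : 𝔸) (t : 𝕜) :
    fderiv 𝕜 (fun B : 𝔸 => t ^ k • expTail 𝕜 k (t • B)) A C
      = t ^ (k + 1) • dExpTail 𝕜 k (t • A) C := by
  have h1 : HasFDerivAt (fun B : 𝔸 => t • B) (t • ContinuousLinearMap.id 𝕜 𝔸) A :=
    (hasFDerivAt_id A).const_smul t
  have h2 := ((analyticAt_expTail 𝕜 𝔸 k (t • A)).differentiableAt.hasFDerivAt.comp A h1).const_smul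
    (t ^ k)
  have h3 : fderiv 𝕜 (fun B : 𝔸 => t ^ k • expTail 𝕜 k (t • B)) A = _ := h2.fderiv
  rw [h3]
  simp [dExpTail, smul_smul, pow_succ]

/-- The primitive relation between consecutive tails, differentiated in A. The additional factor t
is the chain rule for B ↦ tB. -/
theorem hasDerivAt_dExpTail_succ (k : ℕ) (A C : 𝔸) (t : 𝕜) :
    HasDerivAt (fun t : 𝕜 => t ^ (k + 2) • dExpTail 𝕜 (k + 1) (t • A) C)
      (t ^ (k + 1) • dExpTail 𝕜 k (t • A) C) t := by
  have h := hasDerivAt_fderiv_swap (analyticAt_smul_expTail (𝕜 := 𝕜) (𝔸 := 𝔸) (k + 1))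
    (analyticAt_smul_expTail k) (fun t B => hasDerivAt_pow_smul_expTail_succ k B t) A C t
  simpa only [fderiv_smul_expTail] using h

/-- Duhamel's equation: the linear equation for e^{tB} is differentiated in B, and the derivative of
the coefficient B gives the inhomogeneous term. -/
theorem hasDerivAt_dExpTail_zero (A C : 𝔸) (t : 𝕜) :
    HasDerivAt (fun t : 𝕜 => t • dExpTail 𝕜 0 (t • A) C)
      (C * expTail 𝕜 0 (t • A) + A * (t • dExpTail 𝕜 0 (t • A) C)) t := by
  have h := hasDerivAt_fderiv_swap (f := fun z : 𝕜 × 𝔸 => z.1 ^ 0 • expTail 𝕜 0 (z.1 • z.2))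
    (g := fun z : 𝕜 × 𝔸 => z.2 * (z.1 ^ 0 • expTail 𝕜 0 (z.1 • z.2)))
    (analyticAt_smul_expTail 0)
    (fun z => analyticAt_snd.mul (analyticAt_smul_expTail 0 z))
    (fun t B => by simpa using hasDerivAt_expTail_zero B t) A C t
  have h1 : DifferentiableAt 𝕜 (fun B : 𝔸 => t ^ 0 • expTail 𝕜 0 (t • B)) A := by
    refine ((analyticAt_expTail 𝕜 𝔸 0 (t • A)).differentiableAt.comp A
      (differentiableAt_id.const_smul t)).const_smul (t ^ 0)
  have h2 : fderiv 𝕜 (fun B : 𝔸 => B * (t ^ 0 • expTail 𝕜 0 (t • B))) A = _ :=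
    ((hasFDerivAt_id A).mul' h1.hasFDerivAt).fderiv
  simp only [fderiv_smul_expTail, h2, zero_add, pow_one] at h
  refine h.congr_deriv ?_
  have h3 := fderiv_smul_expTail 0 A C t
  simp only [pow_zero, one_smul, zero_add, pow_one] at h3
  simp [add_comm, h3]

theorem expTail_neg_mul (A : 𝔸) : expTail 𝕜 0 (-A) * expTail 𝕜 0 A = 1 := by
  have h := eq_of_hasDerivAt_zero
    (f := fun t : 𝕜 => expTail 𝕜 0 (t • (-A)) * expTail 𝕜 0 (t • A)) (fun t => by
      refine ((hasDerivAt_expTail_zero (-A) t).mul (hasDerivAt_expTail_zero A t)).congr_deriv ?_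
      rw [← (commute_expTail ((Commute.refl (-A)).smul_left t) 0).eq]
      noncomm_ring) 1
  simpa [expTail_zero_right] using h

theorem eq_zero_of_hasDerivAt_mul {A : 𝔸} {W : 𝕜 → 𝔸} (hW : ∀ t, HasDerivAt W (A * W t) t)
    (h0 : W 0 = 0) (t : 𝕜) : W t = 0 := by
  have hexp : ∀ t : 𝕜, HasDerivAt (fun t : 𝕜 => expTail 𝕜 0 (t • (-A)))
      (expTail 𝕜 0 (t • (-A)) * (-A)) t := by
    intro t
    refine (hasDerivAt_expTail_zero (𝕜 := 𝕜) (-A) t).congr_deriv ?_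
    exact (commute_expTail ((Commute.refl (-A)).smul_left t) 0).eq.symm
  have h1 := eq_of_hasDerivAt_zero (f := fun t => expTail 𝕜 0 (t • (-A)) * W t) (fun t => by
    refine ((hexp t).mul (hW t)).congr_deriv ?_
    noncomm_ring) t
  simp only [h0, mul_zero] at h1
  have h2 : expTail 𝕜 0 (-(t • (-A))) * expTail 𝕜 0 (t • (-A)) = (1 : 𝔸) := by
    exact expTail_neg_mul _
  calc W t = expTail 𝕜 0 (-(t • (-A))) * expTail 𝕜 0 (t • (-A)) * W t := by rw [h2, one_mul]
    _ = 0 := by rw [mul_assoc, h1, mul_zero]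

/-- Duhamel's equation has one solution vanishing at 0, so the derivative of the exponential is
found by exhibiting any solution. -/
theorem dExpTail_zero_eq {A C : 𝔸} {Z : 𝕜 → 𝔸}
    (hZ : ∀ t, HasDerivAt Z (C * expTail 𝕜 0 (t • A) + A * Z t) t) (h0 : Z 0 = 0) (t : 𝕜) :
    t • dExpTail 𝕜 0 (t • A) C = Z t := by
  have h := eq_zero_of_hasDerivAt_mul (𝕜 := 𝕜) (A := A)
    (W := fun t => t • dExpTail 𝕜 0 (t • A) C - Z t) (fun t => by
      refine ((hasDerivAt_dExpTail_zero A C t).sub (hZ t)).congr_deriv ?_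
      rw [mul_sub]; abel) (by simp [h0]) t
  exact sub_eq_zero.1 h

/-- The derivative of `expTail k` at `A` in the direction of a commutator `[A, C]`. -/
theorem dExpTail_commutator (k : ℕ) (A C : 𝔸) :
    dExpTail 𝕜 k A (A * C - C * A) = expTail 𝕜 k A * C - C * expTail 𝕜 k A := by
  -- This is the infinitesimal form of the compatibility of power series with conjugation. For k = 0
  -- the right side solves Duhamel's equation; each further case is the primitive in t of the
  -- preceding one.
  have key : ∀ t : 𝕜, t ^ (k + 1) • dExpTail 𝕜 k (t • A) (A * C - C * A)
      = (t ^ k • expTail 𝕜 k (t • A)) * C - C * (t ^ k • expTail 𝕜 k (t • A)) := by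
    induction k with
    | zero =>
      intro t
      rw [zero_add, pow_one]
      refine dExpTail_zero_eq (Z := fun t => (t ^ 0 • expTail 𝕜 0 (t • A)) * C
        - C * (t ^ 0 • expTail 𝕜 0 (t • A))) (fun t => ?_) ?_ t
      · simp only [pow_zero, one_smul]
        refine (((hasDerivAt_expTail_zero A t).mul_const C).fun_sub
          ((hasDerivAt_expTail_zero A t).const_mul C)).congr_deriv ?_
        noncomm_ring
      · simp [expTail_zero_right]
    | succ k ih =>
      refine eq_of_hasDerivAt_eq (fun t => ?_)
        (fun t => ((hasDerivAt_pow_smul_expTail_succ k A t).mul_const C).sub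
          ((hasDerivAt_pow_smul_expTail_succ k A t).const_mul C)) (by simp)
      rw [← ih t]
      exact hasDerivAt_dExpTail_succ k A _ t
  simpa using key 1

theorem hasDerivAt_smul_expTail_one (A : 𝔸) (t : 𝕜) :
    HasDerivAt (fun t : 𝕜 => t • expTail 𝕜 1 (t • A)) (expTail 𝕜 0 (t • A)) t := by
  simpa using hasDerivAt_pow_smul_expTail_succ 0 A t

theorem smul_expTail_one_mul (A : 𝔸) (t : 𝕜) :
    A * (t • expTail 𝕜 1 (t • A)) = expTail 𝕜 0 (t • A) - 1 := by
  rw [mul_smul_comm, ← smul_mul_assoc, mul_expTail_succ]; simp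

theorem smul_expTail_one_neg (A : 𝔸) (t : 𝕜) :
    t • expTail 𝕜 1 (t • (-A)) = expTail 𝕜 0 (t • (-A)) * (t • expTail 𝕜 1 (t • A)) := by
  refine eq_of_hasDerivAt_eq (g := fun t => expTail 𝕜 0 (t • (-A)) * (t • expTail 𝕜 1 (t • A)))
    (fun t => hasDerivAt_smul_expTail_one (-A) t) (fun t => ?_) (by simp) t
  refine ((hasDerivAt_expTail_zero (-A) t).mul (hasDerivAt_smul_expTail_one A t)).congr_deriv ?_
  have h1 := expTail_neg_mul (𝕜 := 𝕜) (t • A)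
  rw [← smul_neg] at h1
  rw [h1, neg_mul, neg_mul, ← (commute_expTail ((Commute.refl A).neg_left.smul_left t) 0).eq,
    mul_assoc, smul_expTail_one_mul, mul_sub, h1]
  simp

theorem expTail_one_neg (A : 𝔸) :
    expTail 𝕜 1 (-A) = expTail 𝕜 0 (-A) * expTail 𝕜 1 A := by
  simpa using smul_expTail_one_neg (𝕜 := 𝕜) A 1

/-- Formally both sides are (e^A + e^{-A} - 2)/A². Differentiating in t avoids dividing by A. -/
theorem expTail_one_mul_neg (A : 𝔸) :
    expTail 𝕜 1 A * expTail 𝕜 1 (-A) = expTail 𝕜 2 A + expTail 𝕜 2 (-A) := by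
  have h := eq_of_hasDerivAt_eq (𝕜 := 𝕜) (F := 𝔸)
    (f := fun t => (t • expTail 𝕜 1 (t • A)) * (t • expTail 𝕜 1 (t • (-A))))
    (fun t => (hasDerivAt_smul_expTail_one A t).mul (hasDerivAt_smul_expTail_one (-A) t))
    (g := fun t => t ^ 2 • expTail 𝕜 2 (t • A) + t ^ 2 • expTail 𝕜 2 (t • (-A))) (fun t => by
      refine ((hasDerivAt_pow_smul_expTail_succ 1 A t).fun_add
        (hasDerivAt_pow_smul_expTail_succ 1 (-A) t)).congr_deriv ?_
      have h1 := smul_expTail_one_neg (𝕜 := 𝕜) A t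
      have h2 := smul_expTail_one_neg (𝕜 := 𝕜) (-A) t
      rw [neg_neg] at h2
      have h3 : (t • expTail 𝕜 1 (t • A)) * expTail 𝕜 0 (t • (-A))
          = expTail 𝕜 0 (t • (-A)) * (t • expTail 𝕜 1 (t • A)) := by
        refine ((commute_expTail ?_ 1).smul_left t).eq
        exact (commute_expTail (((Commute.refl A).neg_left.smul_left t).smul_right t) 0).symm
      rw [pow_one, ← h2, h1, h3])
    (by simp) 1
  simpa using h

end DerivExpTail

end Bidynamical
end

/-! ### Tails of ad y in a quadratic Lie algebra -/

open Set
open scoped Topology Nat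

noncomputable section

namespace Bidynamical

variable {𝕜 : Type*} [RCLike 𝕜]
variable {E : Type*} [NormedAddCommGroup E] [NormedSpace 𝕜 E]
variable {F : Type*} [NormedAddCommGroup F] [NormedSpace 𝕜 F]

theorem hasDerivAt_bilinear {F' : Type*} [NormedAddCommGroup F'] [NormedSpace 𝕜 F']
    (b : E →L[𝕜] F →L[𝕜] F') {u : 𝕜 → E} {v : 𝕜 → F} {u' : E}
    {v' : F} {t : 𝕜} (hu : HasDerivAt u u' t) (hv : HasDerivAt v v' t) :
    HasDerivAt (fun t => b (u t) (v t)) (b u' (v t) + b (u t) v') t :=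
  (b.hasFDerivAt.comp_hasDerivAt t hu).clm_apply hv

theorem hasDerivAt_apply {f : 𝕜 → (E →L[𝕜] F)} {f' : E →L[𝕜] F} {t : 𝕜} (hf : HasDerivAt f f' t)
    (x : E) : HasDerivAt (fun t => f t x) (f' x) t := by
  simpa using hf.clm_apply (hasDerivAt_const t x)

theorem smul_expTail_one_apply [CompleteSpace E] (A : E →L[𝕜] E) (t : 𝕜) (x : E) :
    A ((t • expTail 𝕜 1 (t • A)) x) = expTail 𝕜 0 (t • A) x - x :=
  DFunLike.congr_fun (smul_expTail_one_mul (𝕜 := 𝕜) A t) x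

/-- A Lie bracket `ad` together with an invariant symmetric bilinear form `β`. -/
structure IsQuadraticLie (ad : E →L[𝕜] E →L[𝕜] E) (β : E →L[𝕜] E →L[𝕜] 𝕜) : Prop where
  skew : ∀ x y, ad x y = -ad y x
  jacobi : ∀ x y z, ad x (ad y z) = ad (ad x y) z + ad y (ad x z)
  symm : ∀ x y, β x y = β y x
  inv : ∀ x y z, β (ad x y) z = β x (ad y z)

namespace IsQuadraticLie

variable {ad : E →L[𝕜] E →L[𝕜] E} {β : E →L[𝕜] E →L[𝕜] 𝕜}

theorem ad_ad (h : IsQuadraticLie ad β) (x y : E) : ad (ad x y) = ad x * ad y - ad y * ad x := by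
  ext z
  simp [h.jacobi x y z]

theorem inv' (h : IsQuadraticLie ad β) (x y z : E) : β (ad x y) z = -β y (ad x z) := by
  rw [h.skew, map_neg, neg_apply, h.inv]

theorem rotate (h : IsQuadraticLie ad β) (x y z : E) : β (ad x y) z = β (ad y z) x := by
  rw [h.inv, h.symm]

variable [CompleteSpace E]

theorem adjoint_expTail (h : IsQuadraticLie ad β) (k : ℕ) (y u v : E) :
    β (expTail 𝕜 k (ad y) u) v = β u (expTail 𝕜 k (-ad y) v) :=
  expTail_adjoint β _ _ (fun u v => by rw [h.inv']; simp) k u v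

/-- The classical derivative of the exponential, in the adjoint representation. The right side
solves Duhamel's equation because [ad y, ad b] = ad [y, b], and [y, b] = e^{t ad y} a - a for b = t
E_1(t ad y) a. -/
theorem smul_dExpTail_zero (h : IsQuadraticLie ad β) (y a : E) (t : 𝕜) :
    t • dExpTail 𝕜 0 (t • ad y) (ad a)
      = ad ((t • expTail 𝕜 1 (t • ad y)) a) * expTail 𝕜 0 (t • ad y) := by
  refine dExpTail_zero_eq (Z := fun t => ad ((t • expTail 𝕜 1 (t • ad y)) a)
    * expTail 𝕜 0 (t • ad y)) (fun t => ?_) (by simp) t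
  have h1 := hasDerivAt_apply (hasDerivAt_smul_expTail_one (ad y) t) a
  have h2 := ad.hasFDerivAt.comp_hasDerivAt t h1
  refine (h2.mul (hasDerivAt_expTail_zero (ad y) t)).congr_deriv ?_
  have h3 := h.ad_ad y ((t • expTail 𝕜 1 (t • ad y)) a)
  rw [smul_expTail_one_apply, map_sub] at h3
  have h5 : ad (expTail 𝕜 0 (t • ad y) a) = ad a
      + (ad y * ad ((t • expTail 𝕜 1 (t • ad y)) a) - ad ((t • expTail 𝕜 1 (t • ad y)) a) * ad y) := by
    rw [← h3]; abel
  simp only [Function.comp_apply]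
  rw [h5]
  noncomm_ring

theorem dExpTail_zero_apply (h : IsQuadraticLie ad β) (y a x : E) :
    dExpTail 𝕜 0 (ad y) (ad a) x = ad (expTail 𝕜 1 (ad y) a) (expTail 𝕜 0 (ad y) x) := by
  have := DFunLike.congr_fun (h.smul_dExpTail_zero y a 1) x
  simpa using this

end IsQuadraticLie

section

variable {𝔸 : Type*} [NormedRing 𝔸] [NormedAlgebra 𝕜 𝔸] [CompleteSpace 𝔸]

/-- Leibniz rule applied to A E_{k+1}(A) = E_k(A) - 1/k!. -/
theorem mul_dExpTail_succ (k : ℕ) (A C : 𝔸) :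
    A * dExpTail 𝕜 (k + 1) A C + C * expTail 𝕜 (k + 1) A = dExpTail 𝕜 k A C := by
  have h1 := (hasFDerivAt_id (𝕜 := 𝕜) A).mul'
    (analyticAt_expTail 𝕜 𝔸 (k + 1) A).differentiableAt.hasFDerivAt
  have h2 : HasFDerivAt (fun B : 𝔸 => B * expTail 𝕜 (k + 1) B) (fderiv 𝕜 (expTail 𝕜 k) A) A := by
    have h : HasFDerivAt (fun B : 𝔸 => expTail 𝕜 k B - ((k ! : ℕ) : 𝕜)⁻¹ • (1 : 𝔸))
        (fderiv 𝕜 (expTail 𝕜 k) A) A :=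
      ((analyticAt_expTail 𝕜 𝔸 k A).differentiableAt.hasFDerivAt).sub_const _
    simp_rw [mul_expTail_succ]
    exact h
  have h3 := DFunLike.congr_fun (h1.unique h2) C
  simpa [dExpTail] using h3

theorem mul_smul_dExpTail_one (A C : 𝔸) (t : 𝕜) :
    A * (t ^ 2 • dExpTail 𝕜 1 (t • A) C)
      = t • dExpTail 𝕜 0 (t • A) C - C * (t • expTail 𝕜 1 (t • A)) := by
  rw [← mul_dExpTail_succ 0 (t • A) C, smul_add, mul_smul_comm, mul_smul_comm, add_sub_cancel_right,
    pow_two, mul_smul, smul_mul_assoc]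

end

namespace IsQuadraticLie

variable {ad : E →L[𝕜] E →L[𝕜] E} {β : E →L[𝕜] E →L[𝕜] 𝕜} [CompleteSpace E]

/-- Invariance moves ad y to the first argument, where the Leibniz relation reduces the derivative
of E_1 to the known derivative of the exponential. -/
theorem pairing_dExpTail_one (h : IsQuadraticLie ad β) (y a b x : E) (t : 𝕜) :
    β ((t ^ 2 • dExpTail 𝕜 1 (t • ad y) (ad a)) b) (ad y x)
      = β (ad a ((t • expTail 𝕜 1 (t • ad y)) b)) x
        - β (ad ((t • expTail 𝕜 1 (t • ad y)) a) (expTail 𝕜 0 (t • ad y) b)) x := by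
  have h1 := DFunLike.congr_fun (mul_smul_dExpTail_one (𝕜 := 𝕜) (ad y) (ad a) t) b
  rw [h.smul_dExpTail_zero] at h1
  simp only [mul_apply_eq_comp, sub_apply] at h1
  have h2 := h.inv' y ((t ^ 2 • dExpTail 𝕜 1 (t • ad y) (ad a)) b) x
  rw [h1, map_sub, sub_apply] at h2
  linear_combination h2

/-- In the t-derivative of the left side, `pairing_dExpTail_one` cancels the contribution of the
derivative of E_1. What remains is β([a, t E_1 b], e^{t ad y} x), the derivative of the right side
after a cyclic rotation. -/
theorem pairing_dExpTail_one_expTail_zero (h : IsQuadraticLie ad β) (y a b x : E) :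
    β (dExpTail 𝕜 1 (ad y) (ad a) b) (expTail 𝕜 0 (ad y) x)
      = β (dExpTail 𝕜 1 (ad y) (ad b) x) a := by
  have hE := fun t : 𝕜 => hasDerivAt_expTail_zero (ad y) t
  have hD : ∀ a x : E, ∀ t : 𝕜, HasDerivAt
      (fun t : 𝕜 => (t ^ 2 • dExpTail 𝕜 1 (t • ad y) (ad a)) x)
      (ad ((t • expTail 𝕜 1 (t • ad y)) a) (expTail 𝕜 0 (t • ad y) x)) t := by
    intro a x t
    have h1 := hasDerivAt_apply (hasDerivAt_dExpTail_succ 0 (ad y) (ad a) t) x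
    rw [zero_add, pow_one, h.smul_dExpTail_zero] at h1
    exact h1
  have key := eq_of_hasDerivAt_eq
    (f := fun t : 𝕜 => β ((t ^ 2 • dExpTail 𝕜 1 (t • ad y) (ad a)) b) (expTail 𝕜 0 (t • ad y) x))
    (g := fun t : 𝕜 => β ((t ^ 2 • dExpTail 𝕜 1 (t • ad y) (ad b)) x) a)
    (fun t => hasDerivAt_bilinear β (hD a b t) (hasDerivAt_apply (hE t) x))
    (fun t => by
      refine (hasDerivAt_bilinear β (hD b x t) (hasDerivAt_const t a)).congr_deriv ?_
      rw [mul_apply_eq_comp, h.pairing_dExpTail_one, map_zero, add_zero]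
      rw [h.rotate a]
      ring) (by simp) 1
  simpa using key

/-- Both sides vanish at t = 0 after scaling. Each bracketed term on the left has derivative β([a,
f_b], f_c) with f = t E_1(t ad y), and the cyclic sum of these is the derivative of β([f_a, f_b],
f_c). -/
theorem cyclic_dExpTail (h : IsQuadraticLie ad β) (y a b c : E) :
    (β (dExpTail 𝕜 1 (ad y) (ad a) b) (expTail 𝕜 1 (ad y) c) - β (dExpTail 𝕜 2 (ad y) (ad a) b) c)
    + (β (dExpTail 𝕜 1 (ad y) (ad b) c) (expTail 𝕜 1 (ad y) a)
      - β (dExpTail 𝕜 2 (ad y) (ad b) c) a)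
    + (β (dExpTail 𝕜 1 (ad y) (ad c) a) (expTail 𝕜 1 (ad y) b)
      - β (dExpTail 𝕜 2 (ad y) (ad c) a) b)
    = β (ad (expTail 𝕜 1 (ad y) a) (expTail 𝕜 1 (ad y) b)) (expTail 𝕜 1 (ad y) c) := by
  have hF := fun (x : E) (t : 𝕜) => hasDerivAt_apply (hasDerivAt_smul_expTail_one (ad y) t) x
  have hD : ∀ a x : E, ∀ t : 𝕜, HasDerivAt
      (fun t : 𝕜 => (t ^ 2 • dExpTail 𝕜 1 (t • ad y) (ad a)) x)
      (ad ((t • expTail 𝕜 1 (t • ad y)) a) (expTail 𝕜 0 (t • ad y) x)) t := by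
    intro a x t
    have h1 := hasDerivAt_apply (hasDerivAt_dExpTail_succ 0 (ad y) (ad a) t) x
    rw [zero_add, pow_one, h.smul_dExpTail_zero] at h1
    exact h1
  have hD2 : ∀ a x : E, ∀ t : 𝕜, HasDerivAt
      (fun t : 𝕜 => (t ^ 3 • dExpTail 𝕜 2 (t • ad y) (ad a)) x)
      ((t ^ 2 • dExpTail 𝕜 1 (t • ad y) (ad a)) x) t :=
    fun a x t => hasDerivAt_apply (hasDerivAt_dExpTail_succ 1 (ad y) (ad a) t) x
  have hg : ∀ a b c : E, ∀ t : 𝕜, HasDerivAt (fun t : 𝕜 =>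
      β ((t ^ 2 • dExpTail 𝕜 1 (t • ad y) (ad a)) b) ((t • expTail 𝕜 1 (t • ad y)) c)
        - β ((t ^ 3 • dExpTail 𝕜 2 (t • ad y) (ad a)) b) c)
      (β (ad a ((t • expTail 𝕜 1 (t • ad y)) b)) ((t • expTail 𝕜 1 (t • ad y)) c)) t := by
    intro a b c t
    refine ((hasDerivAt_bilinear β (hD a b t) (hF c t)).fun_sub
      (hasDerivAt_bilinear β (hD2 a b t) (hasDerivAt_const t c))).congr_deriv ?_
    have h2 := h.pairing_dExpTail_one y a b ((t • expTail 𝕜 1 (t • ad y)) c) t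
    rw [smul_expTail_one_apply, map_sub] at h2
    rw [map_zero, add_zero]
    linear_combination h2
  have key := eq_of_hasDerivAt_eq (fun t => ((hg a b c t).fun_add (hg b c a t)).fun_add (hg c a b t))
    (g := fun t : 𝕜 => β (ad ((t • expTail 𝕜 1 (t • ad y)) a) ((t • expTail 𝕜 1 (t • ad y)) b))
      ((t • expTail 𝕜 1 (t • ad y)) c)) (fun t => by
      refine (hasDerivAt_bilinear β (hasDerivAt_bilinear ad (hF a t) (hF b t)) (hF c t)).congr_deriv
        ?_
      have h1 : ∀ x : E, expTail 𝕜 0 (t • ad y) x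
          = x + ad y ((t • expTail 𝕜 1 (t • ad y)) x) := by
        intro x
        rw [smul_expTail_one_apply]; abel
      rw [h1, h1, h1]
      generalize (t • expTail 𝕜 1 (t • ad y)) a = fa
      generalize (t • expTail 𝕜 1 (t • ad y)) b = fb
      generalize (t • expTail 𝕜 1 (t • ad y)) c = fc
      -- The terms containing y add up to the action of ad y on the invariant trilinear form
      -- β([·,·],·), hence to 0.
      have h2 := h.inv' y (ad fa fb) fc
      rw [h.jacobi, map_add, add_apply] at h2
      simp only [map_add, add_apply]
      rw [h.rotate b fc fa, h.rotate fc fa b, h.rotate c fa fb]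
      linear_combination h2) (by simp) 1
  simpa using key

theorem pairing_ad_expTail_zero (h : IsQuadraticLie ad β) (y x₁ x₂ x₃ : E) :
    β (ad (expTail 𝕜 0 (ad y) x₁) (expTail 𝕜 0 (ad y) x₂)) (expTail 𝕜 0 (ad y) x₃)
      = β (ad x₁ x₂) x₃ := by
  have hE := fun (x : E) (t : 𝕜) => hasDerivAt_apply (hasDerivAt_expTail_zero (ad y) t) x
  have key := eq_of_hasDerivAt_zero (f := fun t : 𝕜 => β (ad (expTail 𝕜 0 (t • ad y) x₁)
    (expTail 𝕜 0 (t • ad y) x₂)) (expTail 𝕜 0 (t • ad y) x₃)) (fun t => by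
      refine (hasDerivAt_bilinear β (hasDerivAt_bilinear ad (hE x₁ t) (hE x₂ t))
        (hE x₃ t)).congr_deriv ?_
      simp only [mul_apply_eq_comp]
      rw [← h.jacobi, h.inv']
      ring) 1
  simpa [expTail_zero_right] using key

/-- The derivatives of `e^A x + ((e^A - 1) / A) a` and of its primitive in the directions `ad aᵢ`
satisfy a Maurer–Cartan type identity. -/
theorem cyclic_derivative (h : IsQuadraticLie ad β) (y x₁ x₂ x₃ a₁ a₂ a₃ : E)
    (hx : β (ad x₁ x₂) x₃ = 0) :
    (β (dExpTail 𝕜 0 (ad y) (ad a₁) x₂ + dExpTail 𝕜 1 (ad y) (ad a₁) a₂)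
        (expTail 𝕜 0 (ad y) x₃ + expTail 𝕜 1 (ad y) a₃)
      - β (dExpTail 𝕜 1 (ad y) (ad a₁) x₂ + dExpTail 𝕜 2 (ad y) (ad a₁) a₂) a₃)
    + (β (dExpTail 𝕜 0 (ad y) (ad a₂) x₃ + dExpTail 𝕜 1 (ad y) (ad a₂) a₃)
        (expTail 𝕜 0 (ad y) x₁ + expTail 𝕜 1 (ad y) a₁)
      - β (dExpTail 𝕜 1 (ad y) (ad a₂) x₃ + dExpTail 𝕜 2 (ad y) (ad a₂) a₃) a₁)
    + (β (dExpTail 𝕜 0 (ad y) (ad a₃) x₁ + dExpTail 𝕜 1 (ad y) (ad a₃) a₁)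
        (expTail 𝕜 0 (ad y) x₂ + expTail 𝕜 1 (ad y) a₂)
      - β (dExpTail 𝕜 1 (ad y) (ad a₃) x₁ + dExpTail 𝕜 2 (ad y) (ad a₃) a₁) a₂)
    = β (ad (expTail 𝕜 0 (ad y) x₁ + expTail 𝕜 1 (ad y) a₁)
        (expTail 𝕜 0 (ad y) x₂ + expTail 𝕜 1 (ad y) a₂))
        (expTail 𝕜 0 (ad y) x₃ + expTail 𝕜 1 (ad y) a₃) := by
  -- Expansion by trilinearity. The part free of the xᵢ is `cyclic_dExpTail`. The derivatives of E_1
  -- paired with some e^A xᵢ cancel cyclically by `h1`, `h2`, `h3`. The part cubic in the xᵢ is 0 by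
  -- `hx`, since e^A preserves the trilinear form.
  have hc := h.cyclic_dExpTail y a₁ a₂ a₃
  have h1 := h.pairing_dExpTail_one_expTail_zero y a₁ a₂ x₃
  have h2 := h.pairing_dExpTail_one_expTail_zero y a₂ a₃ x₁
  have h3 := h.pairing_dExpTail_one_expTail_zero y a₃ a₁ x₂
  have hxe := h.pairing_ad_expTail_zero y x₁ x₂ x₃
  rw [hx] at hxe
  simp only [h.dExpTail_zero_apply, map_add, add_apply]
  generalize expTail 𝕜 1 (ad y) a₁ = p₁ at *
  generalize expTail 𝕜 1 (ad y) a₂ = p₂ at *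
  generalize expTail 𝕜 1 (ad y) a₃ = p₃ at *
  generalize expTail 𝕜 0 (ad y) x₁ = e₁ at *
  generalize expTail 𝕜 0 (ad y) x₂ = e₂ at *
  generalize expTail 𝕜 0 (ad y) x₃ = e₃ at *
  have r1 := h.rotate e₁ e₂ p₃
  have r2 := h.rotate e₂ p₃ e₁
  have r3 := h.rotate e₁ p₂ e₃
  have r4 := h.rotate p₁ p₂ e₃
  have r5 := h.rotate e₁ p₂ p₃
  have r6 := h.rotate p₂ p₃ e₁
  linear_combination hc + h1 + h2 + h3 - hxe - r1 - r2 - r3 - r4 - r5 - r6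

/-- With A = ad y, the operator e^A is an isometry and the adjoint of E_1(A) is E_1(-A) = e^{-A}
E_1(A). The quadratic term in the aᵢ is split by E_1(A) E_1(-A) = E_2(A) + E_2(-A). -/
theorem isotropic (h : IsQuadraticLie ad β) (y x₁ x₂ a₁ a₂ : E) (hx : β x₁ x₂ = 0) :
    β (expTail 𝕜 0 (ad y) x₁ + expTail 𝕜 1 (ad y) a₁) (expTail 𝕜 0 (ad y) x₂ + expTail 𝕜 1 (ad y) a₂)
      = β a₁ (expTail 𝕜 1 (ad y) x₂ + expTail 𝕜 2 (ad y) a₂)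
        + β (expTail 𝕜 1 (ad y) x₁ + expTail 𝕜 2 (ad y) a₁) a₂ := by
  have e1 : ∀ u v, β (expTail 𝕜 0 (ad y) u) (expTail 𝕜 0 (ad y) v) = β u v := by
    intro u v
    rw [h.adjoint_expTail, ← mul_apply_eq_comp, expTail_neg_mul]
    rfl
  have e2 : ∀ u v, β (expTail 𝕜 0 (ad y) u) (expTail 𝕜 1 (ad y) v)
      = β (expTail 𝕜 1 (ad y) u) v := by
    intro u v
    rw [h.adjoint_expTail, h.adjoint_expTail, ← mul_apply_eq_comp, ← expTail_one_neg]
  have e3 : ∀ u v, β (expTail 𝕜 1 (ad y) u) (expTail 𝕜 1 (ad y) v)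
      = β u (expTail 𝕜 2 (ad y) v) + β (expTail 𝕜 2 (ad y) u) v := by
    intro u v
    have h1 := expTail_one_mul_neg (𝕜 := 𝕜) (-ad y)
    rw [neg_neg] at h1
    rw [h.adjoint_expTail, h.adjoint_expTail, ← mul_apply_eq_comp, h1, add_apply, map_add, add_comm]
  have e4 := e2 x₂ a₁
  rw [h.symm, h.symm _ a₁] at e4
  simp only [map_add, add_apply]
  rw [e1, e2, e3, hx, e4]
  ring

end IsQuadraticLie

end Bidynamical
end

/-! ### The double of a Lie quasi-bialgebra as a quadratic Lie algebra -/

open Set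
open scoped Topology Nat

noncomputable section

namespace Bidynamical

variable {𝕜 : Type*} [RCLike 𝕜]
variable {V : Type*} [NormedAddCommGroup V] [NormedSpace 𝕜 V] [FiniteDimensional 𝕜 V]

theorem eq_of_forall_dual {x y : V} (h : ∀ ξ : StrongDual 𝕜 V, ξ x = ξ y) : x = y :=
  SeparatingDual.eq_iff_forall_dual_eq.2 h

/-- A bilinear map on finite-dimensional spaces as a continuous bilinear map. -/
def toBilinCLM {E F W : Type*} [NormedAddCommGroup E] [NormedSpace 𝕜 E] [FiniteDimensional 𝕜 E]
    [NormedAddCommGroup F] [NormedSpace 𝕜 F] [FiniteDimensional 𝕜 F]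
    [NormedAddCommGroup W] [NormedSpace 𝕜 W] (b : E →ₗ[𝕜] F →ₗ[𝕜] W) : E →L[𝕜] F →L[𝕜] W :=
  LinearMap.toContinuousLinearMap
    ((LinearMap.toContinuousLinearMap : (F →ₗ[𝕜] W) ≃ₗ[𝕜] (F →L[𝕜] W)).toLinearMap ∘ₗ b)

variable (𝕜 V) in
/-- The canonical symmetric bilinear form of `V ⊕ V*`. -/
def dForm : (V × StrongDual 𝕜 V) →L[𝕜] (V × StrongDual 𝕜 V) →L[𝕜] 𝕜 :=
  toBilinCLM (LinearMap.mk₂ 𝕜 (fun X Y : V × StrongDual 𝕜 V => X.2 Y.1 + Y.2 X.1)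
        (by intro X X' Y; simp; ring) (by intro c X Y; simp; ring)
        (by intro X Y Y'; simp; ring) (by intro c X Y; simp; ring))

@[simp] theorem dForm_apply (X Y : V × StrongDual 𝕜 V) : dForm 𝕜 V X Y = X.2 Y.1 + Y.2 X.1 := rfl

theorem eq_of_forall_dForm {X Y : V × StrongDual 𝕜 V}
    (h : ∀ W, dForm 𝕜 V X W = dForm 𝕜 V Y W) : X = Y := by
  refine Prod.ext (eq_of_forall_dual (𝕜 := 𝕜) fun ξ => ?_) (ContinuousLinearMap.ext fun x => ?_)
  · simpa using h (0, ξ)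
  · simpa using h (x, 0)

namespace LieQuasiData

/-- The bracket of the double as a continuous bilinear map. -/
def dAd (G : LieQuasiData 𝕜 V) :
    (V × StrongDual 𝕜 V) →L[𝕜] (V × StrongDual 𝕜 V) →L[𝕜] (V × StrongDual 𝕜 V) :=
  toBilinCLM G.doubleBracket

theorem double_ad (G : LieQuasiData 𝕜 V) (X : V × StrongDual 𝕜 V) : G.double.ad X = G.dAd X := rfl

theorem dAd_fst (G : LieQuasiData 𝕜 V) (X Y : V × StrongDual 𝕜 V) :
    (G.dAd X Y).1 = G.bracket X.1 Y.1 + G.cobracket X.1 Y.2 - G.cobracket Y.1 X.2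
      + G.assoc X.2 Y.2 := rfl

theorem dAd_snd_apply (G : LieQuasiData 𝕜 V) (X Y : V × StrongDual 𝕜 V) (w : V) :
    (G.dAd X Y).2 w = -Y.2 (G.bracket X.1 w) + X.2 (G.bracket Y.1 w)
      - X.2 (G.cobracket w Y.2) := rfl

theorem bracket_skew {G : LieQuasiData 𝕜 V} (h : ∀ x, G.bracket x x = 0) (x y : V) :
    G.bracket x y = -G.bracket y x := by
  have h1 := h (x + y)
  simp only [map_add, LinearMap.add_apply, h] at h1
  rw [zero_add, add_zero] at h1
  exact eq_neg_of_add_eq_zero_right h1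

theorem IsLieQuasiBialgebra.dAd_skew {G : LieQuasiData 𝕜 V} (h : G.IsLieQuasiBialgebra)
    (X Y : V × StrongDual 𝕜 V) : G.dAd X Y = -G.dAd Y X := by
  refine Prod.ext (eq_of_forall_dual (𝕜 := 𝕜) fun θ => ?_) (ContinuousLinearMap.ext fun w => ?_)
  · simp only [dAd_fst, Prod.fst_neg]
    rw [bracket_skew h.bracket_self, h.assoc_skew Y.2]
    simp
    ring
  · simp only [dAd_snd_apply, Prod.snd_neg, neg_apply]
    rw [h.cobracket_skew]
    ring

theorem IsLieQuasiBialgebra.dAd_inv {G : LieQuasiData 𝕜 V} (h : G.IsLieQuasiBialgebra)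
    (X Y Z : V × StrongDual 𝕜 V) :
    dForm 𝕜 V (G.dAd X Y) Z = dForm 𝕜 V X (G.dAd Y Z) := by
  have hb := bracket_skew h.bracket_self
  simp only [dForm_apply, dAd_fst, dAd_snd_apply, map_add, map_sub]
  rw [hb Y.1 X.1, hb Z.1 X.1, h.cobracket_skew X.1 Y.2 Z.2, h.cobracket_skew Y.1 X.2 Z.2,
    ← h.assoc_cyclic X.2 Y.2 Z.2, map_neg, map_neg]
  ring

theorem dForm_comm (X Y : V × StrongDual 𝕜 V) : dForm 𝕜 V X Y = dForm 𝕜 V Y X := by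
  simp [add_comm]

/-- The Jacobiator of the double paired with a fourth element, rewritten by invariance. -/
def jacobiForm (G : LieQuasiData 𝕜 V) (X Y Z W : V × StrongDual 𝕜 V) : 𝕜 :=
  dForm 𝕜 V (G.dAd Y Z) (G.dAd X W) + dForm 𝕜 V (G.dAd Z X) (G.dAd Y W)
    + dForm 𝕜 V (G.dAd X Y) (G.dAd Z W)

namespace IsLieQuasiBialgebra

variable {G : LieQuasiData 𝕜 V} (h : G.IsLieQuasiBialgebra)
include h

theorem jacobiForm_swap12 (X Y Z W : V × StrongDual 𝕜 V) :
    G.jacobiForm X Y Z W = -G.jacobiForm Y X Z W := by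
  unfold jacobiForm
  rw [h.dAd_skew Y Z, h.dAd_skew Z X, h.dAd_skew X Y]
  simp only [map_neg, neg_apply]
  ring

theorem jacobiForm_swap23 (X Y Z W : V × StrongDual 𝕜 V) :
    G.jacobiForm X Y Z W = -G.jacobiForm X Z Y W := by
  unfold jacobiForm
  rw [h.dAd_skew Y Z, h.dAd_skew Z X, h.dAd_skew X Y]
  simp only [map_neg, neg_apply]
  ring

theorem jacobiForm_swap34 (X Y Z W : V × StrongDual 𝕜 V) :
    G.jacobiForm X Y Z W = -G.jacobiForm X Y W Z := by
  unfold jacobiForm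
  rw [h.dAd_skew W Z, h.dAd_skew Z X, h.dAd_skew W X, dForm_comm (G.dAd Y Z),
    dForm_comm (-G.dAd X Z)]
  simp only [map_neg, neg_apply]
  ring

theorem jacobiForm_inl_inl_inl_inl (x y z w : V) :
    G.jacobiForm (x, 0) (y, 0) (z, 0) (w, 0) = 0 := by
  unfold jacobiForm
  simp [dAd_fst, dAd_snd_apply]

theorem jacobiForm_inl_inl_inl_inr (x y z : V) (θ : StrongDual 𝕜 V) :
    G.jacobiForm (x, 0) (y, 0) (z, 0) (0, θ) = 0 := by
  unfold jacobiForm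
  have h1 := congrArg θ (h.jacobi x y z)
  simp [dAd_fst, dAd_snd_apply] at h1 ⊢
  linear_combination -h1

theorem jacobiForm_inl_inl_inr_inr (x y : V) (ζ θ : StrongDual 𝕜 V) :
    G.jacobiForm (x, 0) (y, 0) (0, ζ) (0, θ) = 0 := by
  unfold jacobiForm
  have h1 := congrArg θ (h.cobracket_cocycle x y ζ)
  have h2 := h.cobracket_skew y (G.adT x ζ) θ
  have h3 := h.cobracket_skew x (G.adT y ζ) θ
  have h4 := h.cobracket_skew (G.bracket x y) ζ θ
  simp [dAd_fst, dAd_snd_apply] at h1 h2 h3 ⊢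
  linear_combination h1 - h4 + h2 - h3

theorem jacobiForm_inl_inr_inr_inr (x : V) (η ζ θ : StrongDual 𝕜 V) :
    G.jacobiForm (x, 0) (0, η) (0, ζ) (0, θ) = 0 := by
  unfold jacobiForm
  have h1 := h.ad_assoc x η ζ θ
  have h2 := h.assoc_cyclic (G.adT x η) ζ θ
  have h3 := h.assoc_cyclic (G.adT x ζ) η θ
  rw [h.assoc_skew η] at h3
  have h5 := h.cobracket_skew (G.cobracket x η) ζ θ
  have h6 := h.cobracket_skew (G.cobracket x θ) η ζ
  simp [dAd_fst, dAd_snd_apply] at h1 h2 h3 ⊢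
  linear_combination -h1 - h2 + h3 - h5 - h6

theorem jacobiForm_inr_inr_inr_inr (ξ η ζ θ : StrongDual 𝕜 V) :
    G.jacobiForm (0, ξ) (0, η) (0, ζ) (0, θ) = 0 := by
  unfold jacobiForm
  have h1 := h.pentagon ξ η ζ θ
  simp [dAd_fst, dAd_snd_apply] at h1 ⊢
  linear_combination -h1

/-- The form changes sign under adjacent transpositions, so only the number of arguments in g*
matters. From zero to four of them, vanishing is automatic, the Jacobi identity, the cocycle
condition, the formula for ad_x φ, and the condition in ⋀⁴g. -/
theorem jacobiForm_eq_zero (X Y Z W : V × StrongDual 𝕜 V) : G.jacobiForm X Y Z W = 0 := by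
  have hX : ∀ X : V × StrongDual 𝕜 V, X = (X.1, 0) + (0, X.2) := fun X => by simp
  have a1 : ∀ X X' Y Z W, G.jacobiForm (X + X') Y Z W
      = G.jacobiForm X Y Z W + G.jacobiForm X' Y Z W := by
    intro X X' Y Z W
    simp only [jacobiForm, map_add, add_apply]
    ring
  have a2 : ∀ X Y Y' Z W, G.jacobiForm X (Y + Y') Z W
      = G.jacobiForm X Y Z W + G.jacobiForm X Y' Z W := by
    intro X Y Y' Z W
    rw [h.jacobiForm_swap12, a1, h.jacobiForm_swap12 X Y, h.jacobiForm_swap12 X Y']; ring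
  have a3 : ∀ X Y Z Z' W, G.jacobiForm X Y (Z + Z') W
      = G.jacobiForm X Y Z W + G.jacobiForm X Y Z' W := by
    intro X Y Z Z' W
    rw [h.jacobiForm_swap23, a2, h.jacobiForm_swap23 X Y Z, h.jacobiForm_swap23 X Y Z']; ring
  have a4 : ∀ X Y Z W W', G.jacobiForm X Y Z (W + W')
      = G.jacobiForm X Y Z W + G.jacobiForm X Y Z W' := by
    intro X Y Z W W'
    rw [h.jacobiForm_swap34, a3, h.jacobiForm_swap34 X Y Z, h.jacobiForm_swap34 X Y Z W']; ring
  have f3 : ∀ (x y z : V) (θ : StrongDual 𝕜 V),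
      G.jacobiForm (x, 0) (y, 0) (0, θ) (z, 0) = 0 := by
    intro x y z θ
    rw [h.jacobiForm_swap34, h.jacobiForm_inl_inl_inl_inr, neg_zero]
  have f3' : ∀ (x y z : V) (θ : StrongDual 𝕜 V),
      G.jacobiForm (x, 0) (0, θ) (y, 0) (z, 0) = 0 := by
    intro x y z θ
    rw [h.jacobiForm_swap23, f3, neg_zero]
  have f3'' : ∀ (x y z : V) (θ : StrongDual 𝕜 V),
      G.jacobiForm (0, θ) (x, 0) (y, 0) (z, 0) = 0 := by
    intro x y z θ
    rw [h.jacobiForm_swap12, f3', neg_zero]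
  have g1 : ∀ (x y : V) (ζ θ : StrongDual 𝕜 V),
      G.jacobiForm (x, 0) (0, ζ) (y, 0) (0, θ) = 0 := by
    intro x y ζ θ
    rw [h.jacobiForm_swap23, h.jacobiForm_inl_inl_inr_inr, neg_zero]
  have g2 : ∀ (x y : V) (ζ θ : StrongDual 𝕜 V),
      G.jacobiForm (0, ζ) (x, 0) (y, 0) (0, θ) = 0 := by
    intro x y ζ θ
    rw [h.jacobiForm_swap12, g1, neg_zero]
  have g3 : ∀ (x y : V) (ζ θ : StrongDual 𝕜 V),
      G.jacobiForm (x, 0) (0, ζ) (0, θ) (y, 0) = 0 := by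
    intro x y ζ θ
    rw [h.jacobiForm_swap34, g1, neg_zero]
  have g4 : ∀ (x y : V) (ζ θ : StrongDual 𝕜 V),
      G.jacobiForm (0, ζ) (x, 0) (0, θ) (y, 0) = 0 := by
    intro x y ζ θ
    rw [h.jacobiForm_swap12, g3, neg_zero]
  have g5 : ∀ (x y : V) (ζ θ : StrongDual 𝕜 V),
      G.jacobiForm (0, ζ) (0, θ) (x, 0) (y, 0) = 0 := by
    intro x y ζ θ
    rw [h.jacobiForm_swap23, g4, neg_zero]
  have k1 : ∀ (x : V) (η ζ θ : StrongDual 𝕜 V),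
      G.jacobiForm (0, η) (x, 0) (0, ζ) (0, θ) = 0 := by
    intro x η ζ θ
    rw [h.jacobiForm_swap12, h.jacobiForm_inl_inr_inr_inr, neg_zero]
  have k2 : ∀ (x : V) (η ζ θ : StrongDual 𝕜 V),
      G.jacobiForm (0, η) (0, ζ) (x, 0) (0, θ) = 0 := by
    intro x η ζ θ
    rw [h.jacobiForm_swap23, k1, neg_zero]
  have k3 : ∀ (x : V) (η ζ θ : StrongDual 𝕜 V),
      G.jacobiForm (0, η) (0, ζ) (0, θ) (x, 0) = 0 := by
    intro x η ζ θ
    rw [h.jacobiForm_swap34, k2, neg_zero]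
  rw [hX X, hX Y, hX Z, hX W]
  simp only [a1, a2, a3, a4, h.jacobiForm_inl_inl_inl_inl, h.jacobiForm_inl_inl_inl_inr,
    h.jacobiForm_inl_inl_inr_inr, h.jacobiForm_inl_inr_inr_inr, h.jacobiForm_inr_inr_inr_inr,
    f3, f3', f3'', g1, g2, g3, g4, g5, k1, k2, k3, add_zero]

/-- The double of a Lie quasi-bialgebra is a quadratic Lie algebra. -/
theorem isQuadraticLie : IsQuadraticLie G.dAd (dForm 𝕜 V) := by
  refine ⟨h.dAd_skew, fun X Y Z => eq_of_forall_dForm fun W => ?_, dForm_comm, h.dAd_inv⟩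
  have h1 := h.jacobiForm_eq_zero X Y Z W
  unfold jacobiForm at h1
  have hinv' : ∀ X Y Z, dForm 𝕜 V (G.dAd X Y) Z = -dForm 𝕜 V Y (G.dAd X Z) := by
    intro X Y Z
    rw [h.dAd_skew, map_neg, neg_apply, h.dAd_inv]
  have h2 := h.dAd_skew Z X
  rw [map_add, add_apply, hinv' X (G.dAd Y Z), hinv' Y (G.dAd X Z), h.dAd_inv (G.dAd X Y)]
  rw [h2, map_neg, neg_apply] at h1
  linear_combination -h1

end IsLieQuasiBialgebra

/-- A Lie quasi-bialgebra is recovered from its double: the axioms hold when the double is a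
quadratic Lie algebra. -/
theorem isLieQuasiBialgebra_of_isQuadraticLie {G : LieQuasiData 𝕜 V}
    (h : IsQuadraticLie G.dAd (dForm 𝕜 V)) : G.IsLieQuasiBialgebra := by
  -- The axioms other than the symmetries are the components of this identity, sorted by the number
  -- of arguments in g*.
  have jac : ∀ X Y Z W, G.jacobiForm X Y Z W = 0 := by
    intro X Y Z W
    unfold jacobiForm
    have h1 := congrArg (fun U => dForm 𝕜 V U W) (h.jacobi X Y Z)
    have h2 := h.skew Z X
    simp only [map_add, add_apply] at h1
    rw [h.inv' X (G.dAd Y Z), h.inv' Y (G.dAd X Z), h.inv (G.dAd X Y)] at h1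
    rw [h2, map_neg, neg_apply]
    linear_combination -h1
  have hb : ∀ x, G.bracket x x = 0 := by
    intro x
    have h1 : G.bracket x x = -G.bracket x x := by
      have := congrArg Prod.fst (h.skew (x, 0) (x, 0))
      simpa [dAd_fst] using this
    have h2 : (2 : 𝕜) • G.bracket x x = 0 := by
      rw [two_smul]
      nth_rewrite 1 [h1]
      exact neg_add_cancel _
    exact (smul_eq_zero.1 h2).resolve_left two_ne_zero
  have hc : ∀ (x : V) (ξ η : StrongDual 𝕜 V), η (G.cobracket x ξ) = -ξ (G.cobracket x η) := by
    intro x ξ η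
    have h1 := h.inv' (x, 0) (0, ξ) (0, η)
    simpa [dAd_fst, dAd_snd_apply] using h1
  have hφ : ∀ ξ η, G.assoc η ξ = -G.assoc ξ η := by
    intro ξ η
    have := congrArg Prod.fst (h.skew (0, η) (0, ξ))
    simpa [dAd_fst] using this
  have hφ' : ∀ ξ η ζ : StrongDual 𝕜 V, ξ (G.assoc η ζ) = ζ (G.assoc ξ η) := by
    intro ξ η ζ
    have := h.inv (0, ξ) (0, η) (0, ζ)
    simpa [dAd_fst, dAd_snd_apply] using this.symm
  refine ⟨hb, fun x y z => eq_of_forall_dual (𝕜 := 𝕜) fun θ => ?_, hc,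
    fun x y ξ => eq_of_forall_dual (𝕜 := 𝕜) fun θ => ?_, hφ, hφ', fun x ξ η ζ => ?_,
    fun ξ η ζ θ => ?_⟩
  · have h1 := jac (x, 0) (y, 0) (z, 0) (0, θ)
    unfold jacobiForm at h1
    simp [dAd_fst, dAd_snd_apply] at h1 ⊢
    linear_combination -h1
  · have h1 := jac (x, 0) (y, 0) (0, ξ) (0, θ)
    unfold jacobiForm at h1
    have h2 := hc y (G.adT x ξ) θ
    have h3 := hc x (G.adT y ξ) θ
    have h4 := hc (G.bracket x y) ξ θ
    simp [dAd_fst, dAd_snd_apply] at h1 h2 h3 ⊢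
    linear_combination h1 + h4 - h2 + h3
  · have h1 := jac (x, 0) (0, ξ) (0, η) (0, ζ)
    unfold jacobiForm at h1
    have h2 := hφ' (G.adT x ξ) η ζ
    have h3 := hφ' (G.adT x η) ξ ζ
    rw [hφ ξ] at h3
    have h5 := hc (G.cobracket x ξ) η ζ
    have h6 := hc (G.cobracket x ζ) ξ η
    simp [dAd_fst, dAd_snd_apply] at h1 h2 h3 ⊢
    linear_combination -h1 - h2 + h3 - h5 - h6
  · have h1 := jac (0, ξ) (0, η) (0, ζ) (0, θ)
    unfold jacobiForm at h1
    simp [dAd_fst, dAd_snd_apply] at h1 ⊢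
    linear_combination -h1

end LieQuasiData

end Bidynamical
end

/-! ### The frame: an entire family of operators of the double -/

open Set
open scoped Topology Nat

noncomputable section

namespace Bidynamical

variable {𝕜 : Type*} [RCLike 𝕜]
variable {L : Type*} [NormedAddCommGroup L] [NormedSpace 𝕜 L]
variable {V : Type*} [NormedAddCommGroup V] [NormedSpace 𝕜 V]

theorem analyticAt_clm_comp {W E₁ E₂ E₃ : Type*} [NormedAddCommGroup W] [NormedSpace 𝕜 W]
    [NormedAddCommGroup E₁] [NormedSpace 𝕜 E₁] [NormedAddCommGroup E₂] [NormedSpace 𝕜 E₂]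
    [NormedAddCommGroup E₃] [NormedSpace 𝕜 E₃] {f : W → (E₂ →L[𝕜] E₃)} {g : W → (E₁ →L[𝕜] E₂)}
    {w : W} (hf : AnalyticAt 𝕜 f w) (hg : AnalyticAt 𝕜 g w) :
    AnalyticAt 𝕜 (fun w => f w ∘L g w) w :=
  AnalyticAt.fun_comp (g := fun z : (E₂ →L[𝕜] E₃) × (E₁ →L[𝕜] E₂) => z.1 ∘L z.2)
    (f := fun w => (f w, g w))
    ((ContinuousLinearMap.compL 𝕜 E₁ E₂ E₃).analyticAt_bilinear (f w, g w)) (hf.prod hg)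

theorem analyticAt_clm_apply {W E₁ E₂ : Type*} [NormedAddCommGroup W] [NormedSpace 𝕜 W]
    [NormedAddCommGroup E₁] [NormedSpace 𝕜 E₁] [NormedAddCommGroup E₂] [NormedSpace 𝕜 E₂]
    {f : W → (E₁ →L[𝕜] E₂)} {g : W → E₁}
    {w : W} (hf : AnalyticAt 𝕜 f w) (hg : AnalyticAt 𝕜 g w) :
    AnalyticAt 𝕜 (fun w => f w (g w)) w :=
  AnalyticAt.fun_comp (g := fun z : (E₁ →L[𝕜] E₂) × E₁ => z.1 z.2) (f := fun w => (f w, g w))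
    ((ContinuousLinearMap.id 𝕜 (E₁ →L[𝕜] E₂)).analyticAt_bilinear (f w, g w)) (hf.prod hg)


theorem IsQuadraticLie.ad_self {D : Type*} [NormedAddCommGroup D] [NormedSpace 𝕜 D]
    {ad : D →L[𝕜] D →L[𝕜] D} {β : D →L[𝕜] D →L[𝕜] 𝕜} (h : IsQuadraticLie ad β) (x : D) :
    ad x x = 0 := by
  have h1 : (2 : 𝕜) • ad x x = 0 := by
    rw [two_smul]
    nth_rewrite 1 [h.skew]
    exact neg_add_cancel _
  exact (smul_eq_zero.1 h1).resolve_left two_ne_zero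

section

variable {W D : Type*} [NormedAddCommGroup W] [NormedSpace 𝕜 W] [NormedAddCommGroup D]
  [NormedSpace 𝕜 D] {P Q : D →L[𝕜] D} {f g : W → (D →L[𝕜] D)} {q : W}

theorem fderiv_comp_add_comp_apply (hf : DifferentiableAt 𝕜 f q) (hg : DifferentiableAt 𝕜 g q)
    (α : W) (u : D) : fderiv 𝕜 (fun q => f q ∘L P + g q ∘L Q) q α u
      = fderiv 𝕜 f q α (P u) + fderiv 𝕜 g q α (Q u) := by
  have h : fderiv 𝕜 (fun q => f q ∘L P + g q ∘L Q) q = _ :=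
    ((hf.hasFDerivAt.clm_comp (hasFDerivAt_const P q)).add
      (hg.hasFDerivAt.clm_comp (hasFDerivAt_const Q q))).fderiv
  rw [h]
  simp

theorem fderiv_sub_comp_apply (hf : DifferentiableAt 𝕜 f q) (hg : DifferentiableAt 𝕜 g q)
    (α : W) (u : D) : fderiv 𝕜 (fun q => f q - P ∘L g q) q α u
      = fderiv 𝕜 f q α u - P (fderiv 𝕜 g q α u) := by
  have h : fderiv 𝕜 (fun q => f q - P ∘L g q) q = _ :=
    (hf.hasFDerivAt.sub ((hasFDerivAt_const P q).clm_comp hg.hasFDerivAt)).fderiv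
  rw [h]
  simp

end

section Family

variable {W D : Type*} [NormedAddCommGroup W] [NormedSpace 𝕜 W] [NormedAddCommGroup D]
  [NormedSpace 𝕜 D] [CompleteSpace D] (B : W →L[𝕜] (D →L[𝕜] D))

theorem analyticAt_expTail_family (k : ℕ) (q : W) :
    AnalyticAt 𝕜 (fun q => expTail 𝕜 k (B q)) q :=
  AnalyticAt.fun_comp (g := expTail 𝕜 k) (f := B) (analyticAt_expTail 𝕜 _ k _) (B.analyticAt q)

theorem hasFDerivAt_expTail_family (k : ℕ) (q : W) :
    HasFDerivAt (fun q => expTail 𝕜 k (B q)) (fderiv 𝕜 (expTail 𝕜 k) (B q) ∘L B) q :=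
  HasFDerivAt.comp (g := expTail 𝕜 k) (f := B) q
    (analyticAt_expTail 𝕜 _ k _).differentiableAt.hasFDerivAt B.hasFDerivAt

end Family

namespace Splitting

/-- The projection of the double on `l` along `m ⊕ g*`. -/
def pL (S : Splitting 𝕜 L V) : (V × StrongDual 𝕜 V) →L[𝕜] (V × StrongDual 𝕜 V) :=
  (S.i ∘L S.p).prodMap 0

/-- The projection of the double on `m^⊥` along `g ⊕ l^⊥`. -/
def pM (S : Splitting 𝕜 L V) : (V × StrongDual 𝕜 V) →L[𝕜] (V × StrongDual 𝕜 V) :=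
  ContinuousLinearMap.prodMap 0 (S.s ∘L tr S.i)

theorem pL_apply (S : Splitting 𝕜 L V) (u : V × StrongDual 𝕜 V) :
    S.pL u = (S.i (S.p u.1), 0) := rfl

theorem pM_apply (S : Splitting 𝕜 L V) (u : V × StrongDual 𝕜 V) :
    S.pM u = (0, S.s (tr S.i u.2)) := rfl

@[simp] theorem s_apply (S : Splitting 𝕜 L V) (α : StrongDual 𝕜 L) (x : V) :
    S.s α x = α (S.p x) := rfl

@[simp] theorem tr_i_s (S : Splitting 𝕜 L V) (α : StrongDual 𝕜 L) : tr S.i (S.s α) = α := by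
  ext z; simp [S.p_i]

@[simp] theorem pL_pL (S : Splitting 𝕜 L V) (u : V × StrongDual 𝕜 V) : S.pL (S.pL u) = S.pL u := by
  simp [pL_apply, S.p_i]

@[simp] theorem pM_pM (S : Splitting 𝕜 L V) (u : V × StrongDual 𝕜 V) : S.pM (S.pM u) = S.pM u := by
  simp [pM_apply]

@[simp] theorem pM_pL (S : Splitting 𝕜 L V) (u : V × StrongDual 𝕜 V) : S.pM (S.pL u) = 0 := by
  simp [pM_apply, pL_apply]

end Splitting

variable [FiniteDimensional 𝕜 V]

theorem Splitting.dForm_pL (S : Splitting 𝕜 L V) (u v : V × StrongDual 𝕜 V) :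
    dForm 𝕜 V (S.pL u) v = dForm 𝕜 V u (S.pM v) := by
  simp [pM_apply, pL_apply]

theorem Splitting.dForm_pM (S : Splitting 𝕜 L V) (u v : V × StrongDual 𝕜 V) :
    dForm 𝕜 V (S.pM u) v = dForm 𝕜 V u (S.pL v) := by
  simp [pM_apply, pL_apply]

theorem Splitting.dForm_pL_pL (S : Splitting 𝕜 L V) (u v : V × StrongDual 𝕜 V) :
    dForm 𝕜 V (S.pL u) (S.pL v) = 0 := by
  simp [pL_apply]

namespace LieQuasiData

/-- The operator `ad_{s q}` of the double, for `q ∈ l*`. -/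
def adS (G : LieQuasiData 𝕜 V) (S : Splitting 𝕜 L V) :
    StrongDual 𝕜 L →L[𝕜] ((V × StrongDual 𝕜 V) →L[𝕜] (V × StrongDual 𝕜 V)) :=
  G.dAd ∘L ContinuousLinearMap.inr 𝕜 V (StrongDual 𝕜 V) ∘L S.s

theorem adS_apply (G : LieQuasiData 𝕜 V) (S : Splitting 𝕜 L V) (q : StrongDual 𝕜 L) :
    G.adS S q = G.dAd (0, S.s q) := rfl

/-- The operator `∑ (ad_{s q})ⁿ / (n + k)!` of the double. -/
def tailS (G : LieQuasiData 𝕜 V) (S : Splitting 𝕜 L V) (k : ℕ) (q : StrongDual 𝕜 L) :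
    (V × StrongDual 𝕜 V) →L[𝕜] (V × StrongDual 𝕜 V) := expTail 𝕜 k (G.adS S q)

/-- The derivative of `tailS k` at `q` in the direction `α`. -/
def dTailS (G : LieQuasiData 𝕜 V) (S : Splitting 𝕜 L V) (k : ℕ) (q α : StrongDual 𝕜 L) :
    (V × StrongDual 𝕜 V) →L[𝕜] (V × StrongDual 𝕜 V) := dExpTail 𝕜 k (G.adS S q) (G.adS S α)

/-- The part `e^A (1 - p_{m^⊥}) + ((e^A - 1) / A) p_{m^⊥}`, `A = ad_{s q}`, of the frame, and, for
larger `k`, its analogue with power series shifted by `k`. -/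
def frameTail (G : LieQuasiData 𝕜 V) (S : Splitting 𝕜 L V) (k : ℕ) (q : StrongDual 𝕜 L) :
    (V × StrongDual 𝕜 V) →L[𝕜] (V × StrongDual 𝕜 V) :=
  G.tailS S k q ∘L (ContinuousLinearMap.id 𝕜 _ - S.pM) + G.tailS S (k + 1) q ∘L S.pM

/-- An entire family of operators of the double such that the graph of the canonical `ℓ`-matrix at
`q` is the image of `g*`. -/
def frame (G : LieQuasiData 𝕜 V) (S : Splitting 𝕜 L V) (q : StrongDual 𝕜 L) :
    (V × StrongDual 𝕜 V) →L[𝕜] (V × StrongDual 𝕜 V) :=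
  G.frameTail S 0 q - S.pL ∘L G.frameTail S 1 q

theorem frameTail_apply (G : LieQuasiData 𝕜 V) (S : Splitting 𝕜 L V) (k : ℕ)
    (q : StrongDual 𝕜 L) (u : V × StrongDual 𝕜 V) :
    G.frameTail S k q u = G.tailS S k q (u - S.pM u) + G.tailS S (k + 1) q (S.pM u) := rfl

theorem frame_apply (G : LieQuasiData 𝕜 V) (S : Splitting 𝕜 L V)
    (q : StrongDual 𝕜 L) (u : V × StrongDual 𝕜 V) :
    G.frame S q u = G.frameTail S 0 q u - S.pL (G.frameTail S 1 q u) := rfl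

theorem adS_tailS_succ (G : LieQuasiData 𝕜 V) (S : Splitting 𝕜 L V) (k : ℕ)
    (q : StrongDual 𝕜 L) (u : V × StrongDual 𝕜 V) :
    G.adS S q (G.tailS S (k + 1) q u) = G.tailS S k q u - ((k ! : ℕ) : 𝕜)⁻¹ • u := by
  have := FiniteDimensional.complete 𝕜 (V × StrongDual 𝕜 V)
  exact DFunLike.congr_fun (mul_expTail_succ (𝕜 := 𝕜) k (G.adS S q)) u

theorem tailS_succ_adS (G : LieQuasiData 𝕜 V) (S : Splitting 𝕜 L V) (k : ℕ)
    (q : StrongDual 𝕜 L) (u : V × StrongDual 𝕜 V) :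
    G.tailS S (k + 1) q (G.adS S q u) = G.tailS S k q u - ((k ! : ℕ) : 𝕜)⁻¹ • u := by
  have := FiniteDimensional.complete 𝕜 (V × StrongDual 𝕜 V)
  exact DFunLike.congr_fun (expTail_succ_mul (𝕜 := 𝕜) k (G.adS S q)) u

theorem tailS_zero (G : LieQuasiData 𝕜 V) (S : Splitting 𝕜 L V) (k : ℕ)
    (u : V × StrongDual 𝕜 V) : G.tailS S k 0 u = ((k ! : ℕ) : 𝕜)⁻¹ • u := by
  have := FiniteDimensional.complete 𝕜 (V × StrongDual 𝕜 V)
  unfold tailS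
  rw [map_zero, expTail_zero_right]
  rfl

theorem analyticAt_tailS (G : LieQuasiData 𝕜 V) (S : Splitting 𝕜 L V) (k : ℕ)
    (q : StrongDual 𝕜 L) : AnalyticAt 𝕜 (G.tailS S k) q := by
  have := FiniteDimensional.complete 𝕜 (V × StrongDual 𝕜 V)
  exact analyticAt_expTail_family (G.adS S) k q

theorem fderiv_tailS (G : LieQuasiData 𝕜 V) (S : Splitting 𝕜 L V) (k : ℕ)
    (q α : StrongDual 𝕜 L) : fderiv 𝕜 (G.tailS S k) q α = G.dTailS S k q α := by
  have := FiniteDimensional.complete 𝕜 (V × StrongDual 𝕜 V)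
  have h : fderiv 𝕜 (G.tailS S k) q = _ := (hasFDerivAt_expTail_family (G.adS S) k q).fderiv
  rw [h]
  rfl

theorem analyticAt_frameTail (G : LieQuasiData 𝕜 V) (S : Splitting 𝕜 L V) (k : ℕ)
    (q : StrongDual 𝕜 L) : AnalyticAt 𝕜 (G.frameTail S k) q :=
  (analyticAt_clm_comp (G.analyticAt_tailS S k q) analyticAt_const).add
    (analyticAt_clm_comp (G.analyticAt_tailS S (k + 1) q) analyticAt_const)

theorem analyticAt_frame (G : LieQuasiData 𝕜 V) (S : Splitting 𝕜 L V)
    (q : StrongDual 𝕜 L) : AnalyticAt 𝕜 (G.frame S) q :=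
  (G.analyticAt_frameTail S 0 q).sub
    (analyticAt_clm_comp analyticAt_const (G.analyticAt_frameTail S 1 q))

theorem fderiv_frameTail_apply (G : LieQuasiData 𝕜 V) (S : Splitting 𝕜 L V) (k : ℕ)
    (q α : StrongDual 𝕜 L) (u : V × StrongDual 𝕜 V) :
    fderiv 𝕜 (G.frameTail S k) q α u
      = G.dTailS S k q α (u - S.pM u) + G.dTailS S (k + 1) q α (S.pM u) := by
  rw [← fderiv_tailS, ← fderiv_tailS]
  exact fderiv_comp_add_comp_apply (G.analyticAt_tailS S k q).differentiableAt
    (G.analyticAt_tailS S (k + 1) q).differentiableAt α u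

theorem fderiv_frame_apply (G : LieQuasiData 𝕜 V) (S : Splitting 𝕜 L V)
    (q α : StrongDual 𝕜 L) (u : V × StrongDual 𝕜 V) :
    fderiv 𝕜 (G.frame S) q α u
      = fderiv 𝕜 (G.frameTail S 0) q α u - S.pL (fderiv 𝕜 (G.frameTail S 1) q α u) := by
  exact fderiv_sub_comp_apply (G.analyticAt_frameTail S 0 q).differentiableAt
    (G.analyticAt_frameTail S 1 q).differentiableAt α u

theorem frame_zero_inr (G : LieQuasiData 𝕜 V) (S : Splitting 𝕜 L V) (η : StrongDual 𝕜 V) :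
    G.frame S 0 (0, η) = (0, η) := by
  rw [frame_apply, frameTail_apply, frameTail_apply, tailS_zero, tailS_zero, tailS_zero, tailS_zero]
  simp [Splitting.pL_apply, Splitting.pM_apply]

namespace IsBidynamical

variable {G : LieQuasiData 𝕜 V} {S : Splitting 𝕜 L V} (h : G.IsBidynamical S)
include h

theorem isQuadraticLie : IsQuadraticLie G.dAd (dForm 𝕜 V) :=
  h.isLieQuasiBialgebra.isQuadraticLie

theorem p_bracket (z : L) (x : V) :
    S.p (G.bracket (S.i z) x) = S.p (G.bracket (S.i z) (S.i (S.p x))) := by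
  have h1 := h.reductive z (x - S.i (S.p x)) (by simp [S.p_i])
  rw [map_sub, map_sub, sub_eq_zero] at h1
  exact h1

theorem i_p_bracket (z w : L) :
    S.i (S.p (G.bracket (S.i z) (S.i w))) = G.bracket (S.i z) (S.i w) := by
  obtain ⟨v, hv⟩ := h.subalgebra z w
  rw [← hv, S.p_i]

theorem bracket_skew (x y : V) : G.bracket x y = -G.bracket y x :=
  LieQuasiData.bracket_skew h.isLieQuasiBialgebra.bracket_self x y

/-- `p_{m^⊥} ad_{s q} = ad_{s q} p_l`. -/
theorem pM_adS (q : StrongDual 𝕜 L) (u : V × StrongDual 𝕜 V) :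
    S.pM (G.adS S q u) = G.adS S q (S.pL u) := by
  refine Prod.ext ?_ (ContinuousLinearMap.ext fun w => ?_)
  · simp [Splitting.pM_apply, Splitting.pL_apply, adS_apply, dAd_fst, h.cobracket_l]
  · simp only [Splitting.pM_apply, Splitting.pL_apply, adS_apply, dAd_snd_apply,
      Splitting.s_apply, tr_apply]
    rw [h.bracket_skew u.1, map_neg, map_neg, h.p_bracket _ u.1, h.cobracket_l, h.p_bracket _ w,
      h.bracket_skew (S.i (S.p w))]
    simp

theorem dAd_inl_i_inr (z : L) (η : StrongDual 𝕜 V) :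
    G.dAd (S.i z, 0) (0, η) = (0, -G.adT (S.i z) η) := by
  refine Prod.ext ?_ (ContinuousLinearMap.ext fun w => ?_)
  · simp [dAd_fst, h.cobracket_l]
  · simp [dAd_snd_apply]

theorem dAd_inl_i_inl (z : L) (x : V) :
    G.dAd (S.i z, 0) (x, 0) = (G.bracket (S.i z) x, 0) := by
  refine Prod.ext ?_ (ContinuousLinearMap.ext fun w => ?_)
  · simp [dAd_fst]
  · simp [dAd_snd_apply]

theorem dAd_inl_i (z : L) (u : V × StrongDual 𝕜 V) :
    G.dAd (S.i z, 0) u = (G.bracket (S.i z) u.1, -G.adT (S.i z) u.2) := by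
  have h1 : u = (u.1, 0) + (0, u.2) := by simp
  rw [h1, map_add, h.dAd_inl_i_inl, h.dAd_inl_i_inr]
  simp

/-- The component of [sq, z] in g vanishes because ϖ does on l, and the component in g* vanishes on
m because m is l-stable. So A maps l to m^⊥ by the coadjoint action of l on q. -/
theorem adS_inl_i (q : StrongDual 𝕜 L) (z : L) :
    G.adS S q (S.i z, 0) = (0, S.s (G.adTL S z q)) := by
  rw [adS_apply, h.isQuadraticLie.skew, h.dAd_inl_i_inr]
  refine Prod.ext (by simp) (ContinuousLinearMap.ext fun w => ?_)
  simp [adTL, h.p_bracket z w]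

/-- Reductivity: both summands of g = l ⊕ m are l-stable, so the projection on l commutes with ad_z.
-/
theorem pL_dAd_inl_i (z : L) (u : V × StrongDual 𝕜 V) :
    S.pL (G.dAd (S.i z, 0) u) = G.dAd (S.i z, 0) (S.pL u) := by
  rw [h.dAd_inl_i, h.dAd_inl_i, Splitting.pL_apply, Splitting.pL_apply]
  simp only [map_zero, neg_zero]
  rw [h.p_bracket, h.i_p_bracket]

theorem pM_dAd_inl_i (z : L) (u : V × StrongDual 𝕜 V) :
    S.pM (G.dAd (S.i z, 0) u) = G.dAd (S.i z, 0) (S.pM u) := by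
  rw [h.dAd_inl_i, h.dAd_inl_i, Splitting.pM_apply, Splitting.pM_apply]
  simp only [map_zero]
  refine Prod.ext rfl (ContinuousLinearMap.ext fun w => ?_)
  simp only [Splitting.s_apply, tr_apply, neg_apply, adT_apply]
  rw [h.p_bracket z w, h.i_p_bracket]

theorem adS_self (q : StrongDual 𝕜 L) : G.adS S q (0, S.s q) = 0 := by
  exact h.isQuadraticLie.ad_self _

/-- The component of the frame in `m^⊥`. -/
theorem pM_frameTail (q : StrongDual 𝕜 L) (u : V × StrongDual 𝕜 V) :
    S.pM (G.frameTail S 0 q u) = S.pM u + G.adS S q (S.pL (G.frameTail S 1 q u)) := by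
  have h1 := G.adS_tailS_succ S 0 q (u - S.pM u)
  have h2 := G.adS_tailS_succ S 1 q (S.pM u)
  -- The series E_0 and E_1 both have constant term 1, so the constant terms of the two pieces
  -- recombine to u.
  have h3 : G.frameTail S 0 q u = u + G.adS S q (G.frameTail S 1 q u) := by
    rw [frameTail_apply, frameTail_apply, map_add, h1, h2]
    simp only [Nat.factorial_zero, Nat.factorial_one, Nat.cast_one, inv_one, one_smul]
    abel
  rw [h3, map_add, h.pM_adS]

theorem pM_frame (q : StrongDual 𝕜 L) (u : V × StrongDual 𝕜 V) :
    S.pM (G.frame S q u) = S.pM u + G.adS S q (S.pL (G.frameTail S 1 q u)) := by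
  rw [frame_apply, map_sub, Splitting.pM_pL, sub_zero, h.pM_frameTail]

end IsBidynamical

end LieQuasiData

end Bidynamical
end

/-! ### Isotropy, equivariance and Maurer-Cartan identity of the frame -/

open Set
open scoped Topology Nat

noncomputable section

namespace Bidynamical

variable {𝕜 : Type*} [RCLike 𝕜]

/-- Trilinear expansion of the invariant 3-form, for bᵢ in a subalgebra on which it vanishes. In
terms with two b's the hypotheses replace uᵢ by aᵢ + [y, bᵢ], and the terms in y sum to zero by
invariance under ad y. -/
theorem IsQuadraticLie.pairing_ad_add {D : Type*} [NormedAddCommGroup D] [NormedSpace 𝕜 D]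
    {ad : D →L[𝕜] D →L[𝕜] D} {β : D →L[𝕜] D →L[𝕜] 𝕜} (h : IsQuadraticLie ad β)
    {y a₁ a₂ a₃ b₁ b₂ b₃ u₁ u₂ u₃ : D} (hb : β (ad b₁ b₂) b₃ = 0)
    (h₁ : β (ad b₂ b₃) u₁ = β (ad b₂ b₃) (a₁ + ad y b₁))
    (h₂ : β (ad b₃ b₁) u₂ = β (ad b₃ b₁) (a₂ + ad y b₂))
    (h₃ : β (ad b₁ b₂) u₃ = β (ad b₁ b₂) (a₃ + ad y b₃)) :
    β (ad (u₁ + b₁) (u₂ + b₂)) (u₃ + b₃) = β (ad u₁ u₂) u₃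
      + (β (ad b₁ u₂) u₃ + β (ad b₂ u₃) u₁ + β (ad b₃ u₁) u₂)
      + (β (ad a₁ b₂) b₃ + β (ad a₂ b₃) b₁ + β (ad a₃ b₁) b₂) := by
  have e1 := h.inv' y (ad b₁ b₂) b₃
  rw [h.jacobi, map_add, add_apply, h.rotate (ad y b₁)] at e1
  rw [h.rotate b₁ (ad y b₂), h.rotate (ad y b₂)] at e1
  simp only [map_add, add_apply] at h₁ h₂ h₃ ⊢
  have r1 := h.rotate u₁ b₂ u₃
  have r2 := h.rotate u₁ u₂ b₃
  have r3 := h.rotate u₁ b₂ b₃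
  have r4 := h.rotate b₁ u₂ b₃
  have s1 := h.rotate a₁ b₂ b₃
  have s2 := h.rotate a₂ b₃ b₁
  have s3 := h.rotate a₃ b₁ b₂
  have r5 := h.rotate b₃ u₁ u₂
  have r6 := h.rotate u₂ b₃ b₁
  linear_combination r1 - r5 + r3 + r4 + r6 + h₁ + h₂ + h₃ + hb - s1 - s2 - s3 + e1

theorem IsQuadraticLie.cyclic_derivative_of_eq {D : Type*} [NormedAddCommGroup D] [NormedSpace 𝕜 D]
    [CompleteSpace D] {ad : D →L[𝕜] D →L[𝕜] D} {β : D →L[𝕜] D →L[𝕜] 𝕜} (h : IsQuadraticLie ad β)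
    {y : D} {x a e : Fin 3 → D} {d : ℕ → Fin 3 → Fin 3 → D} (hx : β (ad (x 0) (x 1)) (x 2) = 0)
    (hd : ∀ k i j, d k i j = dExpTail 𝕜 k (ad y) (ad (a i)) (x j)
      + dExpTail 𝕜 (k + 1) (ad y) (ad (a i)) (a j))
    (he : ∀ i, e i = expTail 𝕜 0 (ad y) (x i) + expTail 𝕜 1 (ad y) (a i)) :
    (β (d 0 0 1) (e 2) - β (d 1 0 1) (a 2)) + (β (d 0 1 2) (e 0) - β (d 1 1 2) (a 0))
      + (β (d 0 2 0) (e 1) - β (d 1 2 0) (a 1)) = β (ad (e 0) (e 1)) (e 2) := by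
  simp only [hd, he]
  exact h.cyclic_derivative y (x 0) (x 1) (x 2) (a 0) (a 1) (a 2) hx

variable {L : Type*} [NormedAddCommGroup L] [NormedSpace 𝕜 L]
variable {V : Type*} [NormedAddCommGroup V] [NormedSpace 𝕜 V] [FiniteDimensional 𝕜 V]

namespace LieQuasiData

theorem adS_fderiv_frameTail (G : LieQuasiData 𝕜 V) (S : Splitting 𝕜 L V)
    (q α : StrongDual 𝕜 L) (u : V × StrongDual 𝕜 V) :
    fderiv 𝕜 (G.frameTail S 0) q α u = G.adS S q (fderiv 𝕜 (G.frameTail S 1) q α u)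
      + G.adS S α (G.frameTail S 1 q u) := by
  have := FiniteDimensional.complete 𝕜 (V × StrongDual 𝕜 V)
  have h1 := fun k v => DFunLike.congr_fun
    (mul_dExpTail_succ (𝕜 := 𝕜) k (G.adS S q) (G.adS S α)) v
  have h2 : ∀ k v, G.dTailS S k q α v = G.adS S q (G.dTailS S (k + 1) q α v)
      + G.adS S α (G.tailS S (k + 1) q v) := fun k v => (h1 k v).symm
  have h3 := h2 0 (u - S.pM u)
  have h4 := h2 1 (S.pM u)
  rw [fderiv_frameTail_apply, fderiv_frameTail_apply, frameTail_apply, h3, h4,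
    map_add (G.adS S q), map_add (G.adS S α)]
  exact add_add_add_comm _ _ _ _

namespace IsBidynamical

variable {G : LieQuasiData 𝕜 V} {S : Splitting 𝕜 L V} (h : G.IsBidynamical S)
include h

theorem pM_fderiv_frameTail (q α : StrongDual 𝕜 L) (u : V × StrongDual 𝕜 V) :
    S.pM (fderiv 𝕜 (G.frameTail S 0) q α u)
      = G.adS S q (S.pL (fderiv 𝕜 (G.frameTail S 1) q α u))
        + G.adS S α (S.pL (G.frameTail S 1 q u)) := by
  rw [adS_fderiv_frameTail, map_add, h.pM_adS, h.pM_adS]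

/-- By `isotropic`, the failure of F_0 to be isotropic is a pairing of the m^⊥ parts with F_1.
Subtracting p_l F_1 compensates it: only the m^⊥ component of F_0 pairs with l, and `pM_frameTail`
gives that component. The terms in ad_{sq} cancel by skewness. -/
theorem frame_isotropic (q : StrongDual 𝕜 L) (η θ : StrongDual 𝕜 V) :
    dForm 𝕜 V (G.frame S q (0, η)) (G.frame S q (0, θ)) = 0 := by
  have := FiniteDimensional.complete 𝕜 (V × StrongDual 𝕜 V)
  have hβ := h.isQuadraticLie
  set u : V × StrongDual 𝕜 V := (0, η) with hu
  set v : V × StrongDual 𝕜 V := (0, θ) with hv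
  have hx : dForm 𝕜 V (u - S.pM u) (v - S.pM v) = 0 := by
    simp [hu, hv, Splitting.pM_apply]
  have h1 : dForm 𝕜 V (G.frameTail S 0 q u) (G.frameTail S 0 q v)
      = dForm 𝕜 V (S.pM u) (G.frameTail S 1 q v) + dForm 𝕜 V (G.frameTail S 1 q u) (S.pM v) :=
    hβ.isotropic (0, S.s q) (u - S.pM u) (v - S.pM v) (S.pM u) (S.pM v) hx
  have h2 : ∀ w w' : V × StrongDual 𝕜 V, dForm 𝕜 V w (S.pL w') = dForm 𝕜 V (S.pM w) (S.pL w') := by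
    intro w w'
    rw [S.dForm_pM, S.pL_pL]
  set e := G.frameTail S 0 q u
  set e' := G.frameTail S 0 q v
  set f := G.frameTail S 1 q u
  set f' := G.frameTail S 1 q v
  have h3 : dForm 𝕜 V (G.adS S q (S.pL f)) (S.pL f')
      = -dForm 𝕜 V (S.pL f) (G.adS S q (S.pL f')) := hβ.inv' _ _ _
  have h4 : dForm 𝕜 V e (S.pL f') = dForm 𝕜 V (S.pM u) f'
      + dForm 𝕜 V (G.adS S q (S.pL f)) (S.pL f') := by
    rw [h2, h.pM_frameTail, map_add, add_apply, ← h2, S.dForm_pM u f', h2 u, S.dForm_pM, S.pL_pL]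
  have h5 : dForm 𝕜 V (S.pL f) e' = dForm 𝕜 V f (S.pM v)
      + dForm 𝕜 V (S.pL f) (G.adS S q (S.pL f')) := by
    rw [S.dForm_pL, h.pM_frameTail, map_add, ← h.pM_adS, ← S.dForm_pL f (G.adS S q f')]
    rw [h.pM_adS, S.dForm_pL, S.dForm_pL, h.pM_adS, ← h.pM_adS, S.pM_pM]
  have h6 := S.dForm_pL_pL f f'
  rw [frame_apply, frame_apply, map_sub, map_sub, sub_apply, sub_apply]
  linear_combination h1 - h4 - h5 + h6 - h3

/-- The derivative of the frame along the coadjoint orbits of `l`. -/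
theorem fderiv_frame_adTL (q : StrongDual 𝕜 L) (z : L) (u : V × StrongDual 𝕜 V) :
    fderiv 𝕜 (G.frame S) q (G.adTL S z q) u
      = G.frame S q (G.dAd (S.i z, 0) u) - G.dAd (S.i z, 0) (G.frame S q u) := by
  have := FiniteDimensional.complete 𝕜 (V × StrongDual 𝕜 V)
  -- Along a coadjoint orbit the operator ad_{sq} varies by a commutator with ad_z, so
  -- `dExpTail_commutator` differentiates every tail.
  have h1 : G.adS S (G.adTL S z q) = G.adS S q * G.dAd (S.i z, 0) - G.dAd (S.i z, 0) * G.adS S q := by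
    rw [adS_apply G S q, ← h.isQuadraticLie.ad_ad, ← adS_apply, h.adS_inl_i, adS_apply]
  have h2 : ∀ k u, G.dTailS S k q (G.adTL S z q) u
      = G.tailS S k q (G.dAd (S.i z, 0) u) - G.dAd (S.i z, 0) (G.tailS S k q u) := by
    intro k u
    have h3 := DFunLike.congr_fun
      (dExpTail_commutator (𝕜 := 𝕜) k (G.adS S q) (G.dAd (S.i z, 0))) u
    rw [← h1] at h3
    exact h3
  have h3 : ∀ k, fderiv 𝕜 (G.frameTail S k) q (G.adTL S z q) u
      = G.frameTail S k q (G.dAd (S.i z, 0) u) - G.dAd (S.i z, 0) (G.frameTail S k q u) := by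
    intro k
    have h4 : G.dAd (S.i z, 0) u - S.pM (G.dAd (S.i z, 0) u) = G.dAd (S.i z, 0) (u - S.pM u) := by
      rw [h.pM_dAd_inl_i, map_sub (G.dAd (S.i z, 0))]
    rw [fderiv_frameTail_apply, frameTail_apply, frameTail_apply, h2, h2, h4, h.pM_dAd_inl_i,
      map_add (G.dAd (S.i z, 0))]
    exact sub_add_sub_comm _ _ _ _
  rw [fderiv_frame_apply, h3, h3, frame_apply, frame_apply, map_sub S.pL, h.pL_dAd_inl_i,
    map_sub (G.dAd (S.i z, 0))]
  exact sub_sub_sub_comm _ _ _ _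

/-- The component in `l*` of the frame. -/
theorem tr_i_frame_snd (q : StrongDual 𝕜 L) (η : StrongDual 𝕜 V) :
    tr S.i (G.frame S q (0, η)).2
      = tr S.i η + G.adTL S (S.p (G.frameTail S 1 q (0, η)).1) q := by
  have h1 := congrArg (fun w => tr S.i w.2) (h.pM_frame q (0, η))
  simp only [Splitting.pL_apply, h.adS_inl_i] at h1
  simpa [Splitting.pM_apply] using h1

theorem pairing_fderiv_frame (q α : StrongDual 𝕜 L) (η θ : StrongDual 𝕜 V) :
    dForm 𝕜 V (fderiv 𝕜 (G.frame S) q α (0, η)) (G.frame S q (0, θ))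
      = dForm 𝕜 V (fderiv 𝕜 (G.frameTail S 0) q α (0, η)) (G.frameTail S 0 q (0, θ))
        - dForm 𝕜 V (fderiv 𝕜 (G.frameTail S 1) q α (0, η)) (S.pM (0, θ))
        - dForm 𝕜 V (G.adS S α (S.pL (G.frameTail S 1 q (0, η))))
            (S.pL (G.frameTail S 1 q (0, θ))) := by
  have hβ := h.isQuadraticLie
  have h2 : ∀ w w' : V × StrongDual 𝕜 V, dForm 𝕜 V w (S.pL w') = dForm 𝕜 V (S.pM w) (S.pL w') := by
    intro w w'
    rw [S.dForm_pM, S.pL_pL]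
  have h3 : ∀ x y, dForm 𝕜 V (G.adS S q x) y = -dForm 𝕜 V x (G.adS S q y) :=
    fun x y => hβ.inv' _ _ _
  have h4 := h.pM_fderiv_frameTail q α (0, η)
  have h5 := h.pM_frame q (0, θ)
  rw [fderiv_frame_apply, map_sub, sub_apply, S.dForm_pL, h5, frame_apply, map_sub, h2, h4, map_add,
    map_add, add_apply, ← h.pM_adS, S.dForm_pM, S.pL_pL, h3]
  generalize dForm 𝕜 V (fderiv 𝕜 (G.frameTail S 1) q α (0, η)) = d
  ring

theorem dForm_dAd_inr_eq_zero {ξ η ζ : StrongDual 𝕜 V} (hξ : tr S.i ξ = 0) (hη : tr S.i η = 0)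
    (hζ : tr S.i ζ = 0) : dForm 𝕜 V (G.dAd (0, ξ) (0, η)) (0, ζ) = 0 := by
  simp [dAd_fst, h.assoc_mod_l ξ η ζ hξ hη hζ]

/-- The direction required by the Yang-Baxter equation is the l*-component of the frame, which is
i*η plus a coadjoint direction. Along the latter `fderiv_frame_adTL` applies, and its summand inside
the image of the frame drops out by isotropy. -/
theorem pairing_fderiv_frame_tr (q : StrongDual 𝕜 L) (η θ θ' : StrongDual 𝕜 V) :
    dForm 𝕜 V (fderiv 𝕜 (G.frame S) q (tr S.i (G.frame S q (0, η)).2) (0, θ))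
        (G.frame S q (0, θ'))
      = dForm 𝕜 V (fderiv 𝕜 (G.frameTail S 0) q (tr S.i η) (0, θ)) (G.frameTail S 0 q (0, θ'))
        - dForm 𝕜 V (fderiv 𝕜 (G.frameTail S 1) q (tr S.i η) (0, θ)) (S.pM (0, θ'))
        - dForm 𝕜 V (G.dAd (S.pM (0, η)) (S.pL (G.frameTail S 1 q (0, θ))))
            (S.pL (G.frameTail S 1 q (0, θ')))
        - dForm 𝕜 V (G.dAd (S.pL (G.frameTail S 1 q (0, η))) (G.frame S q (0, θ)))
            (G.frame S q (0, θ')) := by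
  have e1 : (S.i (S.p (G.frameTail S 1 q (0, η)).1), (0 : StrongDual 𝕜 V))
    = S.pL (G.frameTail S 1 q (0, η)) := rfl
  have e2 : G.adS S (tr S.i η) = G.dAd (S.pM (0, η)) := rfl
  rw [h.tr_i_frame_snd q η, map_add, add_apply, map_add, add_apply, h.pairing_fderiv_frame,
    h.fderiv_frame_adTL, h.dAd_inl_i_inr, map_sub (dForm 𝕜 V), sub_apply, h.frame_isotropic,
    zero_sub, e1, e2, ← sub_eq_add_neg]

/-- The general `cyclic_derivative`, with xᵢ and aᵢ the components of ηᵢ in l^⊥ and m^⊥. Its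
hypothesis on the xᵢ is the vanishing of φ on l^⊥. -/
theorem cyclic_fderiv_frameTail (q : StrongDual 𝕜 L) (η₁ η₂ η₃ : StrongDual 𝕜 V) :
    (dForm 𝕜 V (fderiv 𝕜 (G.frameTail S 0) q (tr S.i η₁) (0, η₂)) (G.frameTail S 0 q (0, η₃))
        - dForm 𝕜 V (fderiv 𝕜 (G.frameTail S 1) q (tr S.i η₁) (0, η₂)) (S.pM (0, η₃)))
    + (dForm 𝕜 V (fderiv 𝕜 (G.frameTail S 0) q (tr S.i η₂) (0, η₃)) (G.frameTail S 0 q (0, η₁))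
        - dForm 𝕜 V (fderiv 𝕜 (G.frameTail S 1) q (tr S.i η₂) (0, η₃)) (S.pM (0, η₁)))
    + (dForm 𝕜 V (fderiv 𝕜 (G.frameTail S 0) q (tr S.i η₃) (0, η₁)) (G.frameTail S 0 q (0, η₂))
        - dForm 𝕜 V (fderiv 𝕜 (G.frameTail S 1) q (tr S.i η₃) (0, η₁)) (S.pM (0, η₂)))
    = dForm 𝕜 V (G.dAd (G.frameTail S 0 q (0, η₁)) (G.frameTail S 0 q (0, η₂)))
        (G.frameTail S 0 q (0, η₃)) := by
  have := FiniteDimensional.complete 𝕜 (V × StrongDual 𝕜 V)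
  have hx : ∀ η : StrongDual 𝕜 V, ((0, η) : V × StrongDual 𝕜 V) - S.pM (0, η)
      = (0, η - S.s (tr S.i η)) := by
    intro η
    simp [Splitting.pM_apply]
  have hx0 : ∀ η : StrongDual 𝕜 V, tr S.i (η - S.s (tr S.i η)) = 0 := by
    intro η
    rw [map_sub, Splitting.tr_i_s, sub_self]
  let η : Fin 3 → StrongDual 𝕜 V := ![η₁, η₂, η₃]
  refine h.isQuadraticLie.cyclic_derivative_of_eq (y := (0, S.s q))
    (x := fun i => (0, η i) - S.pM (0, η i)) (a := fun i => S.pM (0, η i))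
    (e := fun i => G.frameTail S 0 q (0, η i))
    (d := fun k i j => fderiv 𝕜 (G.frameTail S k) q (tr S.i (η i)) (0, η j)) ?_ ?_ ?_
  · simp only [hx]
    exact h.dForm_dAd_inr_eq_zero (hx0 _) (hx0 _) (hx0 _)
  · intro k i j
    exact G.fderiv_frameTail_apply S k q (tr S.i (η i)) (0, η j)
  · intro i
    exact G.frameTail_apply S 0 q (0, η i)

/-- As [l, l] lies in l, only the m^⊥ component of the frame contributes. -/
theorem dForm_dAd_pL_frame (q : StrongDual 𝕜 L) (u v : V × StrongDual 𝕜 V) (η : StrongDual 𝕜 V) :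
    dForm 𝕜 V (G.dAd (S.pL u) (S.pL v)) (G.frame S q (0, η))
      = dForm 𝕜 V (G.dAd (S.pL u) (S.pL v))
        (S.pM (0, η) + G.dAd (0, S.s q) (S.pL (G.frameTail S 1 q (0, η)))) := by
  have e1 : G.dAd (S.pL u) (S.pL v) = S.pL (G.dAd (S.pL u) (S.pL v)) := by
    have e2 := h.pL_dAd_inl_i (S.p u.1) (S.pL v)
    rw [S.pL_pL] at e2
    exact e2.symm
  rw [← adS_apply, ← h.pM_frame, ← S.dForm_pL, ← e1]

theorem dForm_dAd_pL_pL_pL (u v w : V × StrongDual 𝕜 V) :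
    dForm 𝕜 V (G.dAd (S.pL u) (S.pL v)) (S.pL w) = 0 := by
  have e2 := h.pL_dAd_inl_i (S.p u.1) (S.pL v)
  rw [S.pL_pL] at e2
  rw [Splitting.pL_apply S u, ← e2, S.dForm_pL_pL]

theorem dForm_dAd_frameTail (q : StrongDual 𝕜 L) (u₁ u₂ u₃ b₁ b₂ b₃ : V × StrongDual 𝕜 V)
    (η₁ η₂ η₃ : StrongDual 𝕜 V) (hu₁ : u₁ = G.frame S q (0, η₁)) (hu₂ : u₂ = G.frame S q (0, η₂))
    (hu₃ : u₃ = G.frame S q (0, η₃)) (hb₁ : b₁ = S.pL (G.frameTail S 1 q (0, η₁)))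
    (hb₂ : b₂ = S.pL (G.frameTail S 1 q (0, η₂))) (hb₃ : b₃ = S.pL (G.frameTail S 1 q (0, η₃))) :
    dForm 𝕜 V (G.dAd (G.frameTail S 0 q (0, η₁)) (G.frameTail S 0 q (0, η₂)))
        (G.frameTail S 0 q (0, η₃))
      = dForm 𝕜 V (G.dAd u₁ u₂) u₃
        + (dForm 𝕜 V (G.dAd b₁ u₂) u₃ + dForm 𝕜 V (G.dAd b₂ u₃) u₁ + dForm 𝕜 V (G.dAd b₃ u₁) u₂)
        + (dForm 𝕜 V (G.dAd (S.pM (0, η₁)) b₂) b₃ + dForm 𝕜 V (G.dAd (S.pM (0, η₂)) b₃) b₁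
          + dForm 𝕜 V (G.dAd (S.pM (0, η₃)) b₁) b₂) := by
  have hE : ∀ η, G.frameTail S 0 q (0, η)
      = G.frame S q (0, η) + S.pL (G.frameTail S 1 q (0, η)) := by
    intro η
    rw [frame_apply, sub_add_cancel]
  rw [hE, hE, hE, ← hu₁, ← hu₂, ← hu₃, ← hb₁, ← hb₂, ← hb₃]
  refine h.isQuadraticLie.pairing_ad_add (y := (0, S.s q)) ?_ ?_ ?_ ?_
  · rw [hb₁, hb₂, hb₃, h.dForm_dAd_pL_pL_pL]
  · rw [hb₁, hb₂, hb₃, hu₁, h.dForm_dAd_pL_frame]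
  · rw [hb₁, hb₂, hb₃, hu₂, h.dForm_dAd_pL_frame]
  · rw [hb₁, hb₂, hb₃, hu₃, h.dForm_dAd_pL_frame]

/-- The frame satisfies a Maurer–Cartan type identity. -/
theorem cyclic_fderiv_frame (q : StrongDual 𝕜 L) (η₁ η₂ η₃ : StrongDual 𝕜 V) :
    dForm 𝕜 V (fderiv 𝕜 (G.frame S) q (tr S.i (G.frame S q (0, η₁)).2) (0, η₂))
        (G.frame S q (0, η₃))
    + dForm 𝕜 V (fderiv 𝕜 (G.frame S) q (tr S.i (G.frame S q (0, η₂)).2) (0, η₃))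
        (G.frame S q (0, η₁))
    + dForm 𝕜 V (fderiv 𝕜 (G.frame S) q (tr S.i (G.frame S q (0, η₃)).2) (0, η₁))
        (G.frame S q (0, η₂))
    = dForm 𝕜 V (G.dAd (G.frame S q (0, η₁)) (G.frame S q (0, η₂))) (G.frame S q (0, η₃)) := by
  -- Here e and f are the 3-form on F_0 and on the frame. The terms c (two arguments in l) and d
  -- (one argument in l), by which they differ, are exactly the corrections in the three
  -- derivatives.
  have aux : ∀ x₁ x₂ x₃ y₁ y₂ y₃ c₁ c₂ c₃ d₁ d₂ d₃ e f : 𝕜,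
      (x₁ - y₁) + (x₂ - y₂) + (x₃ - y₃) = e → e = f + (d₁ + d₂ + d₃) + (c₁ + c₂ + c₃) →
      (x₁ - y₁ - c₁ - d₁) + (x₂ - y₂ - c₂ - d₂) + (x₃ - y₃ - c₃ - d₃) = f := by
    intro x₁ x₂ x₃ y₁ y₂ y₃ c₁ c₂ c₃ d₁ d₂ d₃ e f h1 h2
    linear_combination h1 + h2
  rw [h.pairing_fderiv_frame_tr, h.pairing_fderiv_frame_tr, h.pairing_fderiv_frame_tr]
  exact aux _ _ _ _ _ _ _ _ _ _ _ _ _ _ (h.cyclic_fderiv_frameTail q η₁ η₂ η₃)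
    (h.dForm_dAd_frameTail q _ _ _ _ _ _ η₁ η₂ η₃ rfl rfl rfl rfl rfl rfl)

end IsBidynamical

end LieQuasiData
end Bidynamical
end

/-! ### From the frame to the canonical ℓ-matrix: existence -/

open Set
open scoped Topology Nat

noncomputable section

namespace Bidynamical

variable {𝕜 : Type*} [RCLike 𝕜]

theorem eq_zero_of_frequently {W F : Type*} [TopologicalSpace W] [NormedAddCommGroup F]
    {f : W → F} {w : W} {s : Set W} (hf : ContinuousAt f w) (hs : ∃ᶠ w' in 𝓝 w, w' ∈ s)
    (h : ∀ᶠ w' in 𝓝 w, w' ∈ s → f w' = 0) : f w = 0 := by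
  by_contra hne
  have h1 : ∀ᶠ w' in 𝓝 w, f w' ≠ 0 := hf.eventually_ne hne
  exact hs ((h.and h1).mono fun w' hw hw' => hw.2 (hw.1 hw'))

theorem continuousAt_fderiv_apply_apply {W E F : Type*} [NormedAddCommGroup W] [NormedSpace 𝕜 W]
    [NormedAddCommGroup E] [NormedSpace 𝕜 E] [NormedAddCommGroup F] [NormedSpace 𝕜 F]
    [CompleteSpace F] {f : W → (E →L[𝕜] F)} {g : W → W} {w : W}
    (hf : AnalyticAt 𝕜 f w) (hg : ContinuousAt g w) (x : E) :
    ContinuousAt (fun w => fderiv 𝕜 f w (g w) x) w :=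
  (hf.fderiv.continuousAt.clm_apply hg).clm_apply continuousAt_const

variable (𝕜) in
theorem isPreconnected_ball {W : Type*} [NormedAddCommGroup W] [NormedSpace 𝕜 W] (r : ℝ) :
    IsPreconnected (Metric.ball (0 : W) r) := by
  let := NormedSpace.restrictScalars ℝ 𝕜 W
  exact (convex_ball 0 r).isPreconnected

theorem exists_analytic_leftInverse {W F : Type*} [NormedAddCommGroup W] [NormedSpace 𝕜 W]
    [NormedAddCommGroup F] [NormedSpace 𝕜 F] [CompleteSpace F] {f : W → (F →L[𝕜] F)}
    (hf : ∀ w, AnalyticAt 𝕜 f w) (h0 : f 0 = 1) :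
    ∃ r > 0, ∃ g : W → (F →L[𝕜] F), ∀ w ∈ Metric.ball 0 r, AnalyticAt 𝕜 g w
      ∧ g w ∘L f w = ContinuousLinearMap.id 𝕜 F := by
  have h1 : {x : F →L[𝕜] F | IsUnit x} ∈ 𝓝 (f 0) := Units.isOpen.mem_nhds (by simp [h0])
  obtain ⟨r, hr, hball⟩ := Metric.eventually_nhds_iff_ball.1 ((hf 0).continuousAt h1)
  refine ⟨r, hr, fun w => Ring.inverse (f w), fun w hw => ⟨?_, ?_⟩⟩
  · obtain ⟨u, hu⟩ := hball w hw
    refine AnalyticAt.fun_comp (g := Ring.inverse) (f := f) ?_ (hf w)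
    rw [← hu]
    exact analyticAt_inverse u
  · exact Ring.inverse_mul_cancel _ (hball w hw)

/-- An analytic family of endomorphisms on a connected set which is invertible somewhere is
invertible on a dense subset. -/
theorem frequently_isUnit {W F : Type*} [NormedAddCommGroup W] [NormedSpace 𝕜 W]
    [NormedAddCommGroup F] [NormedSpace 𝕜 F] [FiniteDimensional 𝕜 F] {f : W → (F →L[𝕜] F)}
    (hf : ∀ w, AnalyticAt 𝕜 f w) (h0 : f 0 = 1) (w : W) :
    ∃ᶠ w' in 𝓝 w, Function.Surjective (f w') := by
  classical
  let b := Module.finBasis 𝕜 F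
  have hdet : ∀ w, (LinearMap.toMatrix b b (f w : F →ₗ[𝕜] F)).det ≠ 0 →
      Function.Surjective (f w) := by
    intro w hw
    have h1 : IsUnit (LinearMap.det (f w : F →ₗ[𝕜] F)) := by
      rw [← LinearMap.det_toMatrix b]
      exact hw.isUnit
    exact ((Module.End.isUnit_iff _).1 ((LinearMap.isUnit_iff_isUnit_det _).2 h1)).surjective
  have han : AnalyticOnNhd 𝕜 (fun w => (LinearMap.toMatrix b b (f w : F →ₗ[𝕜] F)).det) univ := by
    intro w _
    simp only [Matrix.det_apply]
    refine Finset.analyticAt_fun_sum _ fun σ _ => ?_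
    refine AnalyticAt.const_smul (𝕜 := 𝕜) ?_
    refine Finset.analyticAt_fun_prod _ fun i _ => ?_
    have h2 : AnalyticAt 𝕜 (fun w => coordDual 𝕜 F (σ i) (f w (b i))) w :=
      analyticAt_clm_apply analyticAt_const (analyticAt_clm_apply (hf w) analyticAt_const)
    refine h2.congr (Filter.Eventually.of_forall fun w' => ?_)
    simp [LinearMap.toMatrix_apply, coordDual, b]
  refine Filter.Frequently.mono ?_ hdet
  intro hev
  -- A determinant vanishing near w would vanish on the whole connected space by the identity
  -- theorem, but it is 1 at 0.
  have hz : ∀ᶠ w' in 𝓝 w, (LinearMap.toMatrix b b (f w' : F →ₗ[𝕜] F)).det = 0 :=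
    hev.mono fun w' hw => not_not.1 hw
  let := NormedSpace.restrictScalars ℝ 𝕜 W
  have h3 := han.eqOn_zero_of_preconnected_of_eventuallyEq_zero isPreconnected_univ
    (mem_univ w) hz (mem_univ 0)
  simp [h0] at h3

variable {L : Type*} [NormedAddCommGroup L] [NormedSpace 𝕜 L]
variable {V : Type*} [NormedAddCommGroup V] [NormedSpace 𝕜 V] [FiniteDimensional 𝕜 V]

namespace LieQuasiData

/-- The component of the frame in `g*`. -/
def frameSnd (G : LieQuasiData 𝕜 V) (S : Splitting 𝕜 L V) (q : StrongDual 𝕜 L) :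
    StrongDual 𝕜 V →L[𝕜] StrongDual 𝕜 V :=
  ContinuousLinearMap.snd 𝕜 V (StrongDual 𝕜 V)
    ∘L (G.frame S q ∘L ContinuousLinearMap.inr 𝕜 V (StrongDual 𝕜 V))

/-- The component of the frame in `g`. -/
def frameFst (G : LieQuasiData 𝕜 V) (S : Splitting 𝕜 L V) (q : StrongDual 𝕜 L) :
    StrongDual 𝕜 V →L[𝕜] V :=
  ContinuousLinearMap.fst 𝕜 V (StrongDual 𝕜 V)
    ∘L (G.frame S q ∘L ContinuousLinearMap.inr 𝕜 V (StrongDual 𝕜 V))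

theorem frameSnd_apply (G : LieQuasiData 𝕜 V) (S : Splitting 𝕜 L V) (q : StrongDual 𝕜 L)
    (η : StrongDual 𝕜 V) : G.frameSnd S q η = (G.frame S q (0, η)).2 := rfl

theorem frameFst_apply (G : LieQuasiData 𝕜 V) (S : Splitting 𝕜 L V) (q : StrongDual 𝕜 L)
    (η : StrongDual 𝕜 V) : G.frameFst S q η = (G.frame S q (0, η)).1 := rfl

theorem analyticAt_frameSnd (G : LieQuasiData 𝕜 V) (S : Splitting 𝕜 L V) (q : StrongDual 𝕜 L) :
    AnalyticAt 𝕜 (G.frameSnd S) q :=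
  analyticAt_clm_comp analyticAt_const
    (analyticAt_clm_comp (G.analyticAt_frame S q) analyticAt_const)

theorem analyticAt_frameFst (G : LieQuasiData 𝕜 V) (S : Splitting 𝕜 L V) (q : StrongDual 𝕜 L) :
    AnalyticAt 𝕜 (G.frameFst S) q :=
  analyticAt_clm_comp analyticAt_const
    (analyticAt_clm_comp (G.analyticAt_frame S q) analyticAt_const)

theorem frameSnd_zero (G : LieQuasiData 𝕜 V) (S : Splitting 𝕜 L V) : G.frameSnd S 0 = 1 := by
  refine ContinuousLinearMap.ext fun η => ?_
  rw [frameSnd_apply, frame_zero_inr]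
  rfl

theorem frameFst_zero (G : LieQuasiData 𝕜 V) (S : Splitting 𝕜 L V) : G.frameFst S 0 = 0 := by
  refine ContinuousLinearMap.ext fun η => ?_
  rw [frameFst_apply, frame_zero_inr]
  rfl

theorem frequently_frameSnd_surjective (G : LieQuasiData 𝕜 V) (S : Splitting 𝕜 L V)
    (q : StrongDual 𝕜 L) : ∃ᶠ q' in 𝓝 q, Function.Surjective (G.frameSnd S q') :=
  frequently_isUnit (G.analyticAt_frameSnd S) (G.frameSnd_zero S) q

theorem fderiv_comp_frame_apply {F : Type*} [NormedAddCommGroup F] [NormedSpace 𝕜 F]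
    (G : LieQuasiData 𝕜 V) (S : Splitting 𝕜 L V) (q α : StrongDual 𝕜 L)
    (T : (V × StrongDual 𝕜 V) →L[𝕜] F) (η : StrongDual 𝕜 V) :
    fderiv 𝕜 (fun q => T ∘L (G.frame S q ∘L ContinuousLinearMap.inr 𝕜 V (StrongDual 𝕜 V))) q α η
      = T (fderiv 𝕜 (G.frame S) q α (0, η)) := by
  have hd := (G.analyticAt_frame S q).differentiableAt.hasFDerivAt
  have h2 : fderiv 𝕜 (fun q => T ∘L (G.frame S q ∘L _)) q = _ :=
    ((hasFDerivAt_const T q).clm_comp (hd.clm_comp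
      (hasFDerivAt_const (ContinuousLinearMap.inr 𝕜 V (StrongDual 𝕜 V)) q))).fderiv
  rw [h2]
  simp

theorem fderiv_frame_fst_snd (G : LieQuasiData 𝕜 V) (S : Splitting 𝕜 L V) (q α : StrongDual 𝕜 L)
    (η : StrongDual 𝕜 V) :
    fderiv 𝕜 (G.frame S) q α (0, η)
      = (fderiv 𝕜 (G.frameFst S) q α η, fderiv 𝕜 (G.frameSnd S) q α η) :=
  Prod.ext (G.fderiv_comp_frame_apply S q α (ContinuousLinearMap.fst 𝕜 V (StrongDual 𝕜 V)) η).symm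
    (G.fderiv_comp_frame_apply S q α (ContinuousLinearMap.snd 𝕜 V (StrongDual 𝕜 V)) η).symm

/-- On the graph of T the invariant 3-form of the double collects all terms of the Yang-Baxter
equation without derivative. The equation thus says that the cyclic derivative of ℓ is this 3-form.
-/
theorem dForm_dAd_graph (G : LieQuasiData 𝕜 V) (hG : G.IsLieQuasiBialgebra)
    (T : StrongDual 𝕜 V →L[𝕜] V) (ξ η ζ : StrongDual 𝕜 V) :
    dForm 𝕜 V (G.dAd (T ξ, ξ) (T η, η)) (T ζ, ζ)
      = (ζ (G.bracket (T ξ) (T η)) + ζ (G.cobracket (T ξ) η))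
      + (ξ (G.bracket (T η) (T ζ)) + ξ (G.cobracket (T η) ζ))
      + (η (G.bracket (T ζ) (T ξ)) + η (G.cobracket (T ζ) ξ)) + ζ (G.assoc ξ η) := by
  have h1 := congrArg η (LieQuasiData.bracket_skew hG.bracket_self (T ζ) (T ξ))
  have h2 := hG.cobracket_skew (T η) ζ ξ
  have h3 := hG.cobracket_skew (T ζ) ξ η
  simp only [dForm_apply, dAd_fst, dAd_snd_apply, map_add, map_sub, map_neg] at *
  linear_combination -h1 - h2 - h3

namespace IsBidynamical

variable {G : LieQuasiData 𝕜 V} {S : Splitting 𝕜 L V} (h : G.IsBidynamical S)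
include h

/-- The vector sq lies in m^⊥ and is killed by ad_{sq}, so every tail acts on it as its constant
term and p_l removes F_1. This yields the normalisation `ℓ q (s q) = 0`. -/
theorem frame_s (q : StrongDual 𝕜 L) : G.frame S q (0, S.s q) = (0, S.s q) := by
  have h1 : ∀ k, G.tailS S k q (0, S.s q) = ((k ! : ℕ) : 𝕜)⁻¹ • (0, S.s q) := by
    intro k
    have h2 := G.tailS_succ_adS S k q (0, S.s q)
    rw [h.adS_self, map_zero] at h2
    exact (sub_eq_zero.1 h2.symm)
  have h2 : S.pM (0, S.s q) = (0, S.s q) := by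
    simp [Splitting.pM_apply]
  rw [frame_apply, frameTail_apply, frameTail_apply, h2, sub_self, map_zero, map_zero, h1, h1]
  simp [Splitting.pL_apply]

section Local

variable {ℓ : StrongDual 𝕜 L → (StrongDual 𝕜 V →L[𝕜] V)} {q : StrongDual 𝕜 L}
  (hN : Function.Surjective (G.frameSnd S q))

-- Isotropy of the frame, read on the graph.
include hN in
theorem skew_of_frame (hℓ : ℓ q ∘L G.frameSnd S q = G.frameFst S q) (ξ η : StrongDual 𝕜 V) :
    η (ℓ q ξ) = -ξ (ℓ q η) := by
  obtain ⟨ξ, rfl⟩ := hN ξ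
  obtain ⟨η, rfl⟩ := hN η
  have h1 := h.frame_isotropic q ξ η
  have h2 : ∀ η, (G.frame S q (0, η)).1 = ℓ q (G.frame S q (0, η)).2 :=
    fun η => (DFunLike.congr_fun hℓ η).symm
  rw [dForm_apply, h2, h2] at h1
  rw [frameSnd_apply, frameSnd_apply]
  linear_combination h1

omit h in
theorem fderiv_of_frame (hd : DifferentiableAt 𝕜 ℓ q)
    (hℓ : ∀ᶠ q in 𝓝 q, ℓ q ∘L G.frameSnd S q = G.frameFst S q)
    (α : StrongDual 𝕜 L) (η : StrongDual 𝕜 V) :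
    fderiv 𝕜 ℓ q α (G.frame S q (0, η)).2 = (fderiv 𝕜 (G.frame S) q α (0, η)).1
      - ℓ q (fderiv 𝕜 (G.frame S) q α (0, η)).2 := by
  have h1 : fderiv 𝕜 (fun q => ℓ q ∘L G.frameSnd S q) q = _ :=
    (hd.hasFDerivAt.clm_comp
      (G.analyticAt_frameSnd S q).differentiableAt.hasFDerivAt).fderiv
  have h2 : fderiv 𝕜 (fun q => ℓ q ∘L G.frameSnd S q) q = fderiv 𝕜 (G.frameFst S) q :=
    Filter.EventuallyEq.fderiv_eq hℓ
  rw [h2] at h1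
  rw [fderiv_frame_fst_snd, h1, ← frameSnd_apply]
  simp

include hN in
theorem equivariant_of_frame (hd : DifferentiableAt 𝕜 ℓ q)
    (hℓ : ∀ᶠ q in 𝓝 q, ℓ q ∘L G.frameSnd S q = G.frameFst S q) (z : L) :
    fderiv 𝕜 ℓ q (G.adTL S z q) + G.cobracketL (S.i z)
      + G.ad (S.i z) ∘L ℓ q + ℓ q ∘L G.adT (S.i z) = 0 := by
  refine ContinuousLinearMap.ext fun ξ => ?_
  obtain ⟨η, rfl⟩ := hN ξ
  have h2 : ∀ η, (G.frame S q (0, η)).1 = ℓ q (G.frame S q (0, η)).2 :=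
    fun η => (DFunLike.congr_fun hℓ.self_of_nhds η).symm
  have h1 := fderiv_of_frame hd hℓ (G.adTL S z q) η
  have hc : G.cobracketL (S.i z) = 0 := ContinuousLinearMap.ext fun ξ => by
    simp [cobracketL, h.cobracket_l]
  rw [h.fderiv_frame_adTL, h.dAd_inl_i_inr, h.dAd_inl_i, Prod.fst_sub, Prod.snd_sub, h2, h2,
    map_sub, map_neg (ℓ q)] at h1
  rw [hc, frameSnd_apply]
  simp only [add_apply, ContinuousLinearMap.comp_apply, zero_apply, h1, ad_apply]
  abel

include hN in
theorem yangBaxter_of_frame (hd : DifferentiableAt 𝕜 ℓ q)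
    (hℓ : ∀ᶠ q in 𝓝 q, ℓ q ∘L G.frameSnd S q = G.frameFst S q) (ξ η ζ : StrongDual 𝕜 V) :
    (ζ (fderiv 𝕜 ℓ q (tr S.i ξ) η) - ζ (G.bracket (ℓ q ξ) (ℓ q η)) - ζ (G.cobracket (ℓ q ξ) η))
    + (ξ (fderiv 𝕜 ℓ q (tr S.i η) ζ) - ξ (G.bracket (ℓ q η) (ℓ q ζ))
        - ξ (G.cobracket (ℓ q η) ζ))
    + (η (fderiv 𝕜 ℓ q (tr S.i ζ) ξ) - η (G.bracket (ℓ q ζ) (ℓ q ξ))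
        - η (G.cobracket (ℓ q ζ) ξ))
    = ζ (G.assoc ξ η) := by
  have hs := h.skew_of_frame hN hℓ.self_of_nhds
  obtain ⟨ξ, rfl⟩ := hN ξ
  obtain ⟨η, rfl⟩ := hN η
  obtain ⟨ζ, rfl⟩ := hN ζ
  have h2 : ∀ η, G.frame S q (0, η) = (ℓ q (G.frameSnd S q η), G.frameSnd S q η) :=
    fun η => Prod.ext (DFunLike.congr_fun hℓ.self_of_nhds η).symm rfl
  -- Skewness of `ℓ q` cancels the motion of the frame inside the graph; only the derivative of ℓ
  -- survives the pairing.
  have h3 : ∀ α η ζ, dForm 𝕜 V (fderiv 𝕜 (G.frame S) q α (0, η)) (G.frame S q (0, ζ))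
      = G.frameSnd S q ζ (fderiv 𝕜 ℓ q α (G.frameSnd S q η)) := by
    intro α η ζ
    rw [G.frameSnd_apply S q η, fderiv_of_frame hd hℓ α η, h2 ζ, dForm_apply, map_sub,
      hs (fderiv 𝕜 (G.frame S) q α (0, η)).2]
    ring
  have h4 := h.cyclic_fderiv_frame q ξ η ζ
  rw [h3, h3, h3, h2, h2, h2, G.dForm_dAd_graph h.isLieQuasiBialgebra] at h4
  linear_combination h4

end Local

-- A canonical ℓ-matrix may be analytic at points where `frameSnd` degenerates. The points where it
-- is onto are dense, and continuity reaches the others.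
omit h in
theorem eq_zero_of_surjective {F : Type*} [NormedAddCommGroup F] {U : Set (StrongDual 𝕜 L)}
    (hU : IsOpen U) (f : StrongDual 𝕜 L → F) (q : StrongDual 𝕜 L) (hq : q ∈ U)
    (hf : ContinuousAt f q) (hz : ∀ q ∈ U, Function.Surjective (G.frameSnd S q) → f q = 0) :
    f q = 0 :=
  eq_zero_of_frequently (s := {q | Function.Surjective (G.frameSnd S q)}) hf
    (G.frequently_frameSnd_surjective S q)
    (Filter.Eventually.mono (hU.mem_nhds hq) fun q hq => hz q hq)

section Global

variable {U : Set (StrongDual 𝕜 L)} {ℓ : StrongDual 𝕜 L → (StrongDual 𝕜 V →L[𝕜] V)}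
  (hU : IsOpen U) (ha : AnalyticOnNhd 𝕜 ℓ U)
  (hE : ∀ q ∈ U, ℓ q ∘L G.frameSnd S q = G.frameFst S q)
include hU ha hE

theorem skew_of_frame_on (q : StrongDual 𝕜 L) (hq : q ∈ U) (ξ η : StrongDual 𝕜 V) :
    η (ℓ q ξ) = -ξ (ℓ q η) := by
  have hℓη : ∀ η, ContinuousAt (fun q => ℓ q η) q := fun η =>
    (ha q hq).continuousAt.clm_apply continuousAt_const
  have h1 := eq_zero_of_surjective (G := G) (S := S) hU (fun q => η (ℓ q ξ) + ξ (ℓ q η)) q hq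
    ((η.continuous.continuousAt.comp (hℓη ξ)).add (ξ.continuous.continuousAt.comp (hℓη η))) (by
    intro q hq hN
    rw [h.skew_of_frame hN (hE q hq)]
    ring)
  linear_combination h1

theorem yangBaxter_of_frame_on (q : StrongDual 𝕜 L) (hq : q ∈ U) (ξ η ζ : StrongDual 𝕜 V) :
    (ζ (fderiv 𝕜 ℓ q (tr S.i ξ) η) - ζ (G.bracket (ℓ q ξ) (ℓ q η)) - ζ (G.cobracket (ℓ q ξ) η))
    + (ξ (fderiv 𝕜 ℓ q (tr S.i η) ζ) - ξ (G.bracket (ℓ q η) (ℓ q ζ))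
        - ξ (G.cobracket (ℓ q η) ζ))
    + (η (fderiv 𝕜 ℓ q (tr S.i ζ) ξ) - η (G.bracket (ℓ q ζ) (ℓ q ξ))
        - η (G.cobracket (ℓ q ζ) ξ))
    = ζ (G.assoc ξ η) := by
  have := FiniteDimensional.complete 𝕜 V
  have hℓη : ∀ η, ContinuousAt (fun q => ℓ q η) q := fun η =>
    (ha q hq).continuousAt.clm_apply continuousAt_const
  have hd : ∀ α η, ContinuousAt (fun q => fderiv 𝕜 ℓ q α η) q := fun α η =>
    continuousAt_fderiv_apply_apply (ha q hq) continuousAt_const η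
  have hterm : ∀ ξ η ζ : StrongDual 𝕜 V, ContinuousAt (fun q => ζ (fderiv 𝕜 ℓ q (tr S.i ξ) η)
      - ζ (G.bracket (ℓ q ξ) (ℓ q η)) - ζ (G.cobracket (ℓ q ξ) η)) q := by
    intro ξ η ζ
    have h1 : ContinuousAt (fun q => toBilinCLM G.bracket (ℓ q ξ) (ℓ q η)) q :=
      (continuousAt_const.clm_apply (hℓη ξ)).clm_apply (hℓη η)
    have h2 : ContinuousAt (fun q => toBilinCLM G.cobracket (ℓ q ξ) η) q :=
      (continuousAt_const.clm_apply (hℓη ξ)).clm_apply continuousAt_const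
    exact ((ζ.continuous.continuousAt.comp (hd _ η)).sub
      (ζ.continuous.continuousAt.comp h1)).sub (ζ.continuous.continuousAt.comp h2)
  have h1 := eq_zero_of_surjective (G := G) (S := S) hU _ q hq
    ((((hterm ξ η ζ).add (hterm η ζ ξ)).add (hterm ζ ξ η)).sub
      (continuousAt_const (y := ζ (G.assoc ξ η)))) (by
      intro q hq hN
      exact sub_eq_zero.2 (h.yangBaxter_of_frame hN (ha q hq).differentiableAt
        (Filter.Eventually.mono (hU.mem_nhds hq) hE) ξ η ζ))
  exact sub_eq_zero.1 h1

theorem equivariant_of_frame_on (q : StrongDual 𝕜 L) (hq : q ∈ U) (z : L) :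
    fderiv 𝕜 ℓ q (G.adTL S z q) + G.cobracketL (S.i z)
      + G.ad (S.i z) ∘L ℓ q + ℓ q ∘L G.adT (S.i z) = 0 := by
  have := FiniteDimensional.complete 𝕜 V
  have hadTL : Continuous fun q => G.adTL S z q := by
    unfold adTL
    fun_prop
  refine ContinuousLinearMap.ext fun ξ => ?_
  have h1 : ContinuousAt (fun q => fderiv 𝕜 ℓ q (G.adTL S z q) ξ) q :=
    continuousAt_fderiv_apply_apply (ha q hq) hadTL.continuousAt ξ
  have hℓη : ∀ η, ContinuousAt (fun q => ℓ q η) q := fun η =>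
    (ha q hq).continuousAt.clm_apply continuousAt_const
  have h2 : ContinuousAt (fun q => G.ad (S.i z) (ℓ q ξ)) q :=
    (G.ad (S.i z)).continuous.continuousAt.comp (hℓη ξ)
  exact eq_zero_of_surjective (G := G) (S := S) hU _ q hq
    (((h1.add continuousAt_const).add h2).add (hℓη _)) fun q hq hN =>
      DFunLike.congr_fun (h.equivariant_of_frame hN (ha q hq).differentiableAt
        (Filter.Eventually.mono (hU.mem_nhds hq) hE) z) ξ

end Global

/-- An analytic map is the canonical `ℓ`-matrix if near `0` its graph is the image of the frame. -/
theorem isCanonicalOn_of_frame {U : Set (StrongDual 𝕜 L)}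
    {ℓ : StrongDual 𝕜 L → (StrongDual 𝕜 V →L[𝕜] V)} (hU : IsOpen U) (hU' : IsPreconnected U)
    (h0 : (0 : StrongDual 𝕜 L) ∈ U) (ha : AnalyticOnNhd 𝕜 ℓ U)
    (hℓ : ∀ᶠ q in 𝓝 0, ℓ q ∘L G.frameSnd S q = G.frameFst S q) : G.IsCanonicalOn S U ℓ := by
  -- Both sides are analytic on the connected set U and agree near 0.
  have hE : ∀ q ∈ U, ℓ q ∘L G.frameSnd S q = G.frameFst S q := by
    have h1 : AnalyticOnNhd 𝕜 (fun q => ℓ q ∘L G.frameSnd S q) U := fun q hq =>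
      analyticAt_clm_comp (ha q hq) (G.analyticAt_frameSnd S q)
    exact h1.eqOn_of_preconnected_of_eventuallyEq (fun q _ => G.analyticAt_frameFst S q) hU' h0 hℓ
  refine ⟨hU, hU', h0, ha, ⟨h.skew_of_frame_on hU ha hE, h.yangBaxter_of_frame_on hU ha hE,
    h.equivariant_of_frame_on hU ha hE⟩, ?_, ?_⟩
  · have h1 := hE 0 h0
    rw [frameSnd_zero, frameFst_zero] at h1
    exact h1
  · intro q hq
    have h1 := DFunLike.congr_fun (hE q hq) (S.s q)
    rw [ContinuousLinearMap.comp_apply, frameSnd_apply, frameFst_apply, h.frame_s] at h1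
    exact h1

/-- The canonical `ℓ`-matrix exists near `0`. -/
theorem exists_isCanonicalOn : ∃ U ℓ, G.IsCanonicalOn S U ℓ
    ∧ ∀ᶠ q in 𝓝 0, ℓ q ∘L G.frameSnd S q = G.frameFst S q := by
  have := FiniteDimensional.complete 𝕜 (StrongDual 𝕜 V)
  obtain ⟨r, hr, g, hg⟩ := exists_analytic_leftInverse (G.analyticAt_frameSnd S) (G.frameSnd_zero S)
  have hev : ∀ᶠ q in 𝓝 0, (G.frameFst S q ∘L g q) ∘L G.frameSnd S q = G.frameFst S q := by
    refine Filter.Eventually.mono (Metric.ball_mem_nhds 0 hr) fun q hq => ?_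
    rw [ContinuousLinearMap.comp_assoc, (hg q hq).2, ContinuousLinearMap.comp_id]
  exact ⟨Metric.ball 0 r, fun q => G.frameFst S q ∘L g q,
    h.isCanonicalOn_of_frame Metric.isOpen_ball (isPreconnected_ball 𝕜 r)
      (Metric.mem_ball_self hr)
      (fun q hq => analyticAt_clm_comp (G.analyticAt_frameFst S q) (hg q hq).1) hev, hev⟩

end IsBidynamical

end LieQuasiData
end Bidynamical
end

/-! ### Fuchsian equations and the radial derivative of the frame -/

open Set
open scoped Topology Nat

noncomputable section

namespace Bidynamical

variable {𝕜 : Type*} [RCLike 𝕜]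

/-! ### Uniqueness -/

section Fuchs

variable {E F : Type*} [NormedAddCommGroup E] [NormedSpace 𝕜 E] [NormedAddCommGroup F]
  [NormedSpace 𝕜 F]

/-- Composition with two projections on the left and on the right has eigenvalues 0, 1, 2 in total.
The proof kills PTP', then PT and TP', then T, with nonzero factors n + 2, n + 1, n. -/
theorem eq_zero_of_smul_add_eq_zero {P : F →L[𝕜] F} {P' : E →L[𝕜] E} (hP : P ∘L P = P)
    (hP' : P' ∘L P' = P') {n : ℕ} (hn : n ≠ 0) {T : E →L[𝕜] F}
    (h : (n : 𝕜) • T + P ∘L T + T ∘L P' = 0) : T = 0 := by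
  have hc : ∀ m : ℕ, m ≠ 0 → ∀ x : F, (m : 𝕜) • x = 0 → x = 0 := fun m hm x hx =>
    (smul_eq_zero.1 hx).resolve_left (by exact_mod_cast hm)
  have hPa : ∀ x, P (P x) = P x := fun x => DFunLike.congr_fun hP x
  have hPa' : ∀ x, P' (P' x) = P' x := fun x => DFunLike.congr_fun hP' x
  have h0 : ∀ x, (n : 𝕜) • T x + P (T x) + T (P' x) = 0 := fun x => DFunLike.congr_fun h x
  have h1 : ∀ x, P (T (P' x)) = 0 := by
    intro x
    have h2 := congrArg P (h0 (P' x))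
    rw [map_add, map_add, map_smul, hPa, hPa', map_zero] at h2
    refine hc (n + 2) (by lia) _ ?_
    push_cast
    refine Eq.trans ?_ h2
    module
  have h2 : ∀ x, P (T x) = 0 := by
    intro x
    have h2 := congrArg P (h0 x)
    rw [map_add, map_add, map_smul, hPa, h1, map_zero] at h2
    refine hc (n + 1) (by lia) _ ?_
    push_cast
    refine Eq.trans ?_ h2
    module
  have h3 : ∀ x, T (P' x) = 0 := by
    intro x
    have h4 := h0 (P' x)
    rw [h1, hPa'] at h4
    refine hc (n + 1) (by lia) _ ?_
    push_cast
    refine Eq.trans ?_ h4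
    module
  refine ContinuousLinearMap.ext fun x => hc n hn _ ?_
  have h4 := h0 x
  rw [h2, h3] at h4
  simpa using h4

/-- A solution of the Fuchsian equation `t f' + B f = R f`, with `R` vanishing at `0`, is zero
if it vanishes at `0` and `B` has no negative integer eigenvalue. -/
theorem eventually_eq_zero_of_fuchs [CompleteSpace F] {B : F →L[𝕜] F}
    (hB : ∀ n : ℕ, n ≠ 0 → ∀ x, (n : 𝕜) • x + B x = 0 → x = 0)
    {f : 𝕜 → F} {R : 𝕜 → (F →L[𝕜] F)} (hf : AnalyticAt 𝕜 f 0)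
    (hf0 : f 0 = 0) (hR : ContinuousAt R 0) (hR0 : R 0 = 0)
    (h : ∀ᶠ t in 𝓝 0, t • deriv f t + B (f t) = R t (f t)) :
    ∀ᶠ t in 𝓝 0, f t = 0 := by
  by_contra hne
  -- If f does not vanish near 0, then f = tⁿ g with g(0) ≠ 0, and n ≥ 1 since f(0) = 0. Division of
  -- the equation by tⁿ and passage to the limit t → 0 give n g(0) + B g(0) = 0, against `hB`.
  obtain ⟨n, g, hg, hg0, hfg⟩ := hf.exists_eventuallyEq_pow_smul_nonzero_iff.2 hne
  simp only [sub_zero] at hfg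
  have hn : n ≠ 0 := by
    rintro rfl
    have h1 := hfg.self_of_nhds
    rw [hf0, pow_zero, one_smul] at h1
    exact hg0 h1.symm
  obtain ⟨m, rfl⟩ := Nat.exists_eq_succ_of_ne_zero hn
  have hder : ∀ᶠ t in 𝓝 (0 : 𝕜), deriv f t
      = t ^ (m + 1) • deriv g t + (((m + 1 : ℕ) : 𝕜) * t ^ m) • g t := by
    filter_upwards [hfg.eventually_nhds, hg.eventually_analyticAt] with t ht hgt
    rw [Filter.EventuallyEq.deriv_eq ht]
    have h1 := (hasDerivAt_pow (m + 1) t).fun_smul hgt.differentiableAt.hasDerivAt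
    simpa using h1.deriv
  have hlim : ∀ᶠ t in 𝓝[≠] (0 : 𝕜), t • deriv g t + ((m + 1 : ℕ) : 𝕜) • g t + B (g t)
      - R t (g t) = 0 := by
    filter_upwards [nhdsWithin_le_nhds h, nhdsWithin_le_nhds hder, nhdsWithin_le_nhds hfg,
      self_mem_nhdsWithin] with t h1 h2 h3 ht
    have ht' : t ^ (m + 1) ≠ 0 := pow_ne_zero _ ht
    rw [h2, h3] at h1
    refine (smul_eq_zero.1 (?_ : t ^ (m + 1) • _ = (0 : F))).resolve_left ht'
    rw [← sub_eq_zero] at h1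
    rw [← h1]
    simp only [map_smul]
    rw [Nat.succ_eq_add_one, pow_succ]
    module
  have hcont : ContinuousAt (fun t => t • deriv g t + ((m + 1 : ℕ) : 𝕜) • g t + B (g t)
      - R t (g t)) 0 := by
    have hgc := hg.continuousAt
    have hgd := hg.deriv.continuousAt
    exact (((continuousAt_id.smul hgd).add (hgc.const_smul _)).add
      (B.continuous.continuousAt.comp hgc)).sub (hR.clm_apply hgc)
  have hz := tendsto_nhds_unique (hcont.tendsto.mono_left nhdsWithin_le_nhds)
    ((Filter.tendsto_congr' hlim).2 tendsto_const_nhds)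
  refine hg0 (hB _ hn _ ?_)
  simpa [hR0] using hz

/-- On the line through q, the parameters t with tq in the ball form a convex set containing 0 and
1, so the identity theorem in one variable applies. -/
theorem eqOn_zero_ball_of_radial {W : Type*} [NormedAddCommGroup W] [NormedSpace 𝕜 W] {r : ℝ}
    {f : W → F} (hf : AnalyticOnNhd 𝕜 f (Metric.ball 0 r)) (hr : 0 < r)
    (h : ∀ q, ∀ᶠ t in 𝓝 (0 : 𝕜), f (t • q) = 0) (q : W) (hq : q ∈ Metric.ball (0 : W) r) :
    f q = 0 := by
  let := NormedSpace.restrictScalars ℝ 𝕜 W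
  let T : 𝕜 →L[𝕜] W := (ContinuousLinearMap.id 𝕜 𝕜).smulRight q
  have hT : ∀ t, T t = t • q := fun t => rfl
  have hpre : IsPreconnected ((fun t : 𝕜 => t • q) ⁻¹' Metric.ball (0 : W) r) := by
    refine Convex.isPreconnected ?_
    intro t ht u hu a b ha hb hab
    simp only [mem_preimage, mem_ball_zero_iff, norm_smul] at *
    have h1 : ‖a • t + b • u‖ ≤ a * ‖t‖ + b * ‖u‖ := by
      refine (norm_add_le _ _).trans ?_
      rw [norm_smul, norm_smul, Real.norm_of_nonneg ha, Real.norm_of_nonneg hb]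
    have h2 : ‖a • t + b • u‖ * ‖q‖ ≤ a * (‖t‖ * ‖q‖) + b * (‖u‖ * ‖q‖) := by
      nlinarith [norm_nonneg q]
    refine h2.trans_lt ?_
    rcases ha.eq_or_lt with rfl | ha
    · have : b = 1 := by linarith
      subst this
      simpa using hu
    · nlinarith
  have han : AnalyticOnNhd 𝕜 (fun t : 𝕜 => f (t • q)) ((fun t : 𝕜 => t • q) ⁻¹' Metric.ball 0 r) := by
    intro t ht
    exact AnalyticAt.fun_comp (g := f) (f := T) (hf _ ht) (T.analyticAt t)
  have h1 := han.eqOn_zero_of_preconnected_of_eventuallyEq_zero hpre (z₀ := 0) (by simpa using hr)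
    (h q) (x := 1) (by simpa using hq)
  simpa using h1

end Fuchs

section Euler

variable {A : Type*} [NormedRing A] [NormedAlgebra 𝕜 A] [CompleteSpace A]

theorem hasDerivAt_expTail_smul (k : ℕ) (a : A) :
    HasDerivAt (fun t : 𝕜 => expTail 𝕜 k (t • a)) (dExpTail 𝕜 k a a) 1 := by
  have h1 : HasFDerivAt (expTail 𝕜 k) (fderiv 𝕜 (expTail 𝕜 k) ((1 : 𝕜) • a)) ((1 : 𝕜) • a) :=
    (analyticAt_expTail 𝕜 A k _).differentiableAt.hasFDerivAt
  have h2 := h1.comp_hasDerivAt (1 : 𝕜) ((hasDerivAt_id (1 : 𝕜)).smul_const a)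
  simp only [one_smul] at h2
  exact h2

theorem dExpTail_zero_self (a : A) : dExpTail 𝕜 0 a a = a * expTail 𝕜 0 a := by
  have h1 := (hasDerivAt_expTail_smul (𝕜 := 𝕜) 0 a).unique (hasDerivAt_expTail_zero a 1)
  simpa using h1

/-- Euler's relation: two expressions for the derivative of t^(k+1) E_{k+1}(ta) are compared at t =
1. -/
theorem dExpTail_succ_self (k : ℕ) (a : A) :
    dExpTail 𝕜 (k + 1) a a = expTail 𝕜 k a - ((k + 1 : ℕ) : 𝕜) • expTail 𝕜 (k + 1) a := by
  have h1 := ((hasDerivAt_pow (k + 1) (1 : 𝕜)).fun_smul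
    (hasDerivAt_expTail_smul (𝕜 := 𝕜) (k + 1) a)).unique (hasDerivAt_pow_smul_expTail_succ k a 1)
  rw [eq_sub_iff_add_eq]
  simpa using h1

end Euler

variable {L : Type*} [NormedAddCommGroup L] [NormedSpace 𝕜 L]
variable {V : Type*} [NormedAddCommGroup V] [NormedSpace 𝕜 V] [FiniteDimensional 𝕜 V]

namespace LieQuasiData

variable {G : LieQuasiData 𝕜 V} {S : Splitting 𝕜 L V}

theorem dTailS_zero_self (q : StrongDual 𝕜 L) (u : V × StrongDual 𝕜 V) :
    G.dTailS S 0 q q u = G.adS S q (G.tailS S 0 q u) := by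
  have := FiniteDimensional.complete 𝕜 (V × StrongDual 𝕜 V)
  exact DFunLike.congr_fun (dExpTail_zero_self (𝕜 := 𝕜) (G.adS S q)) u

theorem dTailS_succ_self (k : ℕ) (q : StrongDual 𝕜 L) (u : V × StrongDual 𝕜 V) :
    G.dTailS S (k + 1) q q u = G.tailS S k q u - ((k + 1 : ℕ) : 𝕜) • G.tailS S (k + 1) q u := by
  have := FiniteDimensional.complete 𝕜 (V × StrongDual 𝕜 V)
  exact DFunLike.congr_fun (dExpTail_succ_self (𝕜 := 𝕜) k (G.adS S q)) u

namespace IsBidynamical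

variable (h : G.IsBidynamical S)
include h

/-- The radial derivative of the frame. -/
theorem fderiv_frame_self (q : StrongDual 𝕜 L) (u : V × StrongDual 𝕜 V) :
    fderiv 𝕜 (G.frame S) q q u = G.adS S q (G.frame S q u) + S.pM (G.frame S q u)
      - S.pL (G.frame S q u) - G.frame S q (S.pM u) := by
  rw [h.pM_frame, fderiv_frame_apply, fderiv_frameTail_apply, fderiv_frameTail_apply,
    dTailS_zero_self, dTailS_succ_self, dTailS_succ_self, dTailS_succ_self, frame_apply,
    frame_apply]
  have h1 := G.adS_tailS_succ S 0 q (S.pM u)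
  have h2 := G.frameTail_apply S 0 q (S.pM u)
  have h3 := G.frameTail_apply S 1 q (S.pM u)
  rw [S.pM_pM, sub_self, map_zero, zero_add] at h2 h3
  rw [h2, h3, map_sub (G.adS S q), map_sub S.pL, S.pL_pL]
  have h4 := G.frameTail_apply S 0 q u
  have h5 := G.frameTail_apply S 1 q u
  have h6 : G.adS S q (G.frameTail S 0 q u) = G.adS S q (G.tailS S 0 q (u - S.pM u))
      + G.tailS S 0 q (S.pM u) - S.pM u := by
    rw [h4, map_add, h1]
    simp [add_sub_assoc]
  rw [h6]
  have h7 : G.tailS S 0 q (u - S.pM u) - ((0 + 1 : ℕ) : 𝕜) • G.tailS S (0 + 1) q (u - S.pM u)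
      + (G.tailS S 1 q (S.pM u) - ((1 + 1 : ℕ) : 𝕜) • G.tailS S (1 + 1) q (S.pM u))
      = G.frameTail S 0 q u - G.frameTail S 1 q u - G.tailS S (1 + 1) q (S.pM u) := by
    rw [h4, h5]
    push_cast
    module
  rw [h7, map_sub S.pL, map_sub S.pL]
  push_cast
  simp only [one_smul]
  abel

end IsBidynamical

end LieQuasiData

end Bidynamical
end

/-! ### Every canonical ℓ-matrix is given by the frame -/

open Set
open scoped Topology Nat

noncomputable section

namespace Bidynamical

variable {𝕜 : Type*} [RCLike 𝕜]

section Generic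

variable {W E F H : Type*} [NormedAddCommGroup W] [NormedSpace 𝕜 W] [NormedAddCommGroup E]
  [NormedSpace 𝕜 E] [NormedAddCommGroup F] [NormedSpace 𝕜 F] [NormedAddCommGroup H]
  [NormedSpace 𝕜 H]

theorem fderiv_apply_apply_apply {f : W → (E →L[𝕜] F)} {q : W} (hf : DifferentiableAt 𝕜 f q)
    (η : StrongDual 𝕜 F) (ξ : E) (α : W) :
    fderiv 𝕜 (fun q => η (f q ξ)) q α = η (fderiv 𝕜 f q α ξ) := by
  have h : fderiv 𝕜 (fun q => η (f q ξ)) q = _ :=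
    (η.hasFDerivAt.comp q (hf.hasFDerivAt.clm_apply (hasFDerivAt_const ξ q))).fderiv
  rw [h]
  simp

theorem fderiv_apply_clm_apply {f : W → (E →L[𝕜] F)} {q : W} (hf : DifferentiableAt 𝕜 f q)
    (T : W →L[𝕜] E) (α : W) :
    fderiv 𝕜 (fun q => f q (T q)) q α = fderiv 𝕜 f q α (T q) + f q (T α) := by
  have h : fderiv 𝕜 (fun q => f q (T q)) q = _ :=
    (hf.hasFDerivAt.clm_apply T.hasFDerivAt).fderiv
  rw [h]
  simp [add_comm]

theorem fderiv_comp_sub_apply {f : W → (E →L[𝕜] F)} {g : W → (H →L[𝕜] E)} {k : W → (H →L[𝕜] F)}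
    {q : W} (hf : DifferentiableAt 𝕜 f q) (hg : DifferentiableAt 𝕜 g q)
    (hk : DifferentiableAt 𝕜 k q) (α : W) (x : H) :
    fderiv 𝕜 (fun q => f q ∘L g q - k q) q α x
      = fderiv 𝕜 f q α (g q x) + f q (fderiv 𝕜 g q α x) - fderiv 𝕜 k q α x := by
  have h : fderiv 𝕜 (fun q => f q ∘L g q - k q) q = _ :=
    ((hf.hasFDerivAt.clm_comp hg.hasFDerivAt).sub hk.hasFDerivAt).fderiv
  rw [h]
  simp [add_comm]

/-- A solution of the radial Fuchsian equation `∂_q f + P f + f P' = R f` near `0`. -/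
theorem eqOn_zero_of_fuchs [CompleteSpace F] {P : F →L[𝕜] F} {P' : E →L[𝕜] E} (hP : P ∘L P = P)
    (hP' : P' ∘L P' = P') {f : W → (E →L[𝕜] F)} {R : W → (F →L[𝕜] F)} {r : ℝ} (hr : 0 < r)
    (hf : AnalyticOnNhd 𝕜 f (Metric.ball 0 r)) (hf0 : f 0 = 0) (hR : ContinuousAt R 0)
    (hR0 : R 0 = 0)
    (h : ∀ q ∈ Metric.ball 0 r, ∀ x,
      fderiv 𝕜 f q q x + P (f q x) + f q (P' x) = R q (f q x)) :
    ∀ q ∈ Metric.ball 0 r, f q = 0 := by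
  refine eqOn_zero_ball_of_radial hf hr fun q => ?_
  let T : 𝕜 →L[𝕜] W := (ContinuousLinearMap.id 𝕜 𝕜).smulRight q
  have hT : ∀ t, T t = t • q := fun t => rfl
  have hT0 : (0 : 𝕜) • q = 0 := zero_smul _ _
  have hmem : ∀ᶠ t in 𝓝 (0 : 𝕜), t • q ∈ Metric.ball (0 : W) r := by
    have h1 : ContinuousAt T 0 := T.continuous.continuousAt
    refine h1 ?_
    rw [map_zero]
    exact Metric.ball_mem_nhds 0 hr
  refine eventually_eq_zero_of_fuchs
    (B := ContinuousLinearMap.compL 𝕜 E F F P + (ContinuousLinearMap.compL 𝕜 E E F).flip P')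
    (R := fun t => ContinuousLinearMap.compL 𝕜 E F F (R (t • q))) ?_ ?_ ?_ ?_ ?_ ?_
  · intro n hn T hT
    refine eq_zero_of_smul_add_eq_zero hP hP' hn ?_
    rw [← hT, add_assoc]
    rfl
  · exact AnalyticAt.fun_comp (g := f) (f := T) (hf _ (by simpa [hT] using hr)) (T.analyticAt 0)
  · rw [hT0, hf0]
  · refine (ContinuousLinearMap.compL 𝕜 E F F).continuous.continuousAt.comp ?_
    refine ContinuousAt.comp (g := R) (f := T) ?_ T.continuous.continuousAt
    rw [map_zero]
    exact hR
  · rw [hT0, hR0, map_zero]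
  · filter_upwards [hmem] with t ht
    refine ContinuousLinearMap.ext fun x => ?_
    have h1 := h _ ht x
    have h2 : HasDerivAt (fun t : 𝕜 => f (t • q)) (fderiv 𝕜 f (t • q) q) t := by
      have h3 : HasFDerivAt f (fderiv 𝕜 f (t • q)) (t • q) :=
        (hf _ ht).differentiableAt.hasFDerivAt
      have h4 := h3.comp_hasDerivAt t ((hasDerivAt_id t).smul_const q)
      simp only [one_smul] at h4
      exact h4
    rw [h2.deriv]
    rw [map_smul] at h1
    simpa [add_assoc] using h1

end Generic

variable {L : Type*} [NormedAddCommGroup L] [NormedSpace 𝕜 L]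
variable {V : Type*} [NormedAddCommGroup V] [NormedSpace 𝕜 V] [FiniteDimensional 𝕜 V]

namespace LieQuasiData

variable {G : LieQuasiData 𝕜 V} {S : Splitting 𝕜 L V}

/-- The radial derivative of the canonical `ℓ`-matrix. -/
theorem IsCanonicalOn.fderiv_self (hG : G.IsLieQuasiBialgebra) {U : Set (StrongDual 𝕜 L)}
    {ℓ : StrongDual 𝕜 L → (StrongDual 𝕜 V →L[𝕜] V)} (hℓ : G.IsCanonicalOn S U ℓ)
    {q : StrongDual 𝕜 L} (hq : q ∈ U) (η : StrongDual 𝕜 V) :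
    fderiv 𝕜 ℓ q q η = (G.adS S q (ℓ q η, η)).1 - ℓ q (G.adS S q (ℓ q η, η)).2
      - ℓ q (S.s (tr S.i η)) - S.i (S.p (ℓ q η)) := by
  have hU : ∀ᶠ q' in 𝓝 q, q' ∈ U := hℓ.isOpen.mem_nhds hq
  have hd := (hℓ.analytic q hq).differentiableAt
  have hs : ∀ ξ η : StrongDual 𝕜 V, η (ℓ q ξ) = -ξ (ℓ q η) := hℓ.dynamical.skew q hq
  have h1 : ∀ α, ∀ ξ η : StrongDual 𝕜 V, η (fderiv 𝕜 ℓ q α ξ) = -ξ (fderiv 𝕜 ℓ q α η) := by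
    intro α ξ η
    have h2 : (fun q => η (ℓ q ξ)) =ᶠ[𝓝 q] fun q => -ξ (ℓ q η) :=
      hU.mono fun q hq => hℓ.dynamical.skew q hq ξ η
    have h3 := DFunLike.congr_fun (h2.fderiv_eq (𝕜 := 𝕜)) α
    rw [fderiv_fun_neg] at h3
    simpa [fderiv_apply_apply_apply hd] using h3
  have h2 : ∀ α, fderiv 𝕜 ℓ q α (S.s q) = -ℓ q (S.s α) := by
    intro α
    have h2 : (fun q => ℓ q (S.s q)) =ᶠ[𝓝 q] fun q => 0 := hU.mono fun q hq => hℓ.apply_s q hq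
    have h3 := DFunLike.congr_fun (h2.fderiv_eq (𝕜 := 𝕜)) α
    rw [fderiv_apply_clm_apply hd] at h3
    rw [eq_neg_iff_add_eq_zero, h3]
    simp
  refine eq_of_forall_dual (𝕜 := 𝕜) fun ζ => ?_
  -- With sq as one argument, the derivative paired with the other two is radial. The two remaining
  -- derivatives are evaluated by skewness and by differentiating `ℓ q (s q) = 0`.
  have hYB := hℓ.dynamical.yangBaxter q hq (S.s q) η ζ
  have hgr := G.dForm_dAd_graph hG (ℓ q) (S.s q) η ζ
  rw [S.tr_i_s] at hYB
  rw [hℓ.apply_s q hq] at hYB hgr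
  have h3 := h1 (tr S.i η) ζ (S.s q)
  have h4 : η (fderiv 𝕜 ℓ q (tr S.i ζ) (S.s q)) = ζ (S.i (S.p (ℓ q η))) := by
    rw [h2, map_neg, hs, neg_neg]
    rfl
  rw [h2, map_neg, neg_neg] at h3
  rw [h3, h4] at hYB
  rw [dForm_apply, ← adS_apply] at hgr
  have h5 := hs ζ (G.adS S q (ℓ q η, η)).2
  simp only [map_sub]
  linear_combination hYB - hgr + h5

variable (h : G.IsBidynamical S)
include h

/-- The graph of the canonical `ℓ`-matrix at `q` contains the image of `g*` by the frame. -/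
theorem IsBidynamical.comp_frameSnd {U : Set (StrongDual 𝕜 L)}
    {ℓ : StrongDual 𝕜 L → (StrongDual 𝕜 V →L[𝕜] V)} (hℓ : G.IsCanonicalOn S U ℓ)
    {q : StrongDual 𝕜 L} (hq : q ∈ U) : ℓ q ∘L G.frameSnd S q = G.frameFst S q := by
  have := FiniteDimensional.complete 𝕜 V
  obtain ⟨r, hr, hrU⟩ := Metric.isOpen_iff.1 hℓ.isOpen 0 hℓ.zero_mem
  let P : V →L[𝕜] V := S.i ∘L S.p
  let P' : StrongDual 𝕜 V →L[𝕜] StrongDual 𝕜 V := S.s ∘L tr S.i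
  -- `R q x` measures how far ad_{sq}(x, 0) is from the graph of `ℓ q`; it vanishes at q = 0 because
  -- ad_{sq} does.
  let R : StrongDual 𝕜 L → (V →L[𝕜] V) := fun q =>
    ContinuousLinearMap.fst 𝕜 V (StrongDual 𝕜 V)
        ∘L (G.adS S q ∘L ContinuousLinearMap.inl 𝕜 V (StrongDual 𝕜 V))
      - ℓ q ∘L (ContinuousLinearMap.snd 𝕜 V (StrongDual 𝕜 V)
        ∘L (G.adS S q ∘L ContinuousLinearMap.inl 𝕜 V (StrongDual 𝕜 V)))
  have hRc : ContinuousAt R 0 := by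
    have h1 : ContinuousAt (fun q => G.adS S q ∘L ContinuousLinearMap.inl 𝕜 V (StrongDual 𝕜 V)) 0 :=
      (G.adS S).continuous.continuousAt.clm_comp continuousAt_const
    exact (continuousAt_const.clm_comp h1).sub
      ((hℓ.analytic 0 hℓ.zero_mem).continuousAt.clm_comp (continuousAt_const.clm_comp h1))
  have hR0 : R 0 = 0 := by
    simp [R]
  have han : ∀ q ∈ U, AnalyticAt 𝕜 (fun q => ℓ q ∘L G.frameSnd S q) q := fun q hq =>
    analyticAt_clm_comp (hℓ.analytic q hq) (G.analyticAt_frameSnd S q)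
  -- The radial equations of ℓ and of the frame combine into a homogeneous Fuchsian equation for the
  -- defect, which is 0 at the origin.
  have hz : ∀ q ∈ Metric.ball 0 r, ℓ q ∘L G.frameSnd S q - G.frameFst S q = 0 := by
    refine eqOn_zero_of_fuchs (P := P) (P' := P') (R := R) ?_ ?_ hr
      (fun q hq => (han q (hrU hq)).sub (G.analyticAt_frameFst S q)) ?_ hRc hR0 ?_
    · exact ContinuousLinearMap.ext fun x => by simp [P, S.p_i]
    · exact ContinuousLinearMap.ext fun x => by simp [P']
    · rw [hℓ.map_zero, frameFst_zero]
      simp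
    · intro q hq η
      have hd := (hℓ.analytic q (hrU hq)).differentiableAt
      rw [fderiv_comp_sub_apply hd (G.analyticAt_frameSnd S q).differentiableAt
        (G.analyticAt_frameFst S q).differentiableAt, hℓ.fderiv_self h.isLieQuasiBialgebra (hrU hq)]
      have h1 := h.fderiv_frame_self q (0, η)
      rw [fderiv_frame_fst_snd] at h1
      have h2 : fderiv 𝕜 (G.frameFst S) q q η = _ := congrArg Prod.fst h1
      have h3 : fderiv 𝕜 (G.frameSnd S) q q η = _ := congrArg Prod.snd h1
      have h4 : S.pM ((0, η) : V × StrongDual 𝕜 V) = (0, P' η) := rfl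
      have h5 : G.frame S q (0, η) = (G.frameFst S q η, G.frameSnd S q η) := rfl
      have h6 : G.frame S q (0, P' η) = (G.frameFst S q (P' η), G.frameSnd S q (P' η)) := rfl
      have h7 : (ℓ q (G.frameSnd S q η), G.frameSnd S q η)
          = (G.frameFst S q η, G.frameSnd S q η)
            + (ℓ q (G.frameSnd S q η) - G.frameFst S q η, 0) := by simp
      have h8 : ∀ x, R q x = (G.adS S q (x, 0)).1 - ℓ q (G.adS S q (x, 0)).2 := fun x => rfl
      rw [h2, h3, h4, h5, h6, h7, h8, S.pL_apply, S.pM_apply]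
      simp only [Prod.fst_sub, Prod.fst_add, Prod.snd_sub, Prod.snd_add, map_add, map_sub, P, P',
        ContinuousLinearMap.comp_apply, sub_apply, add_zero, sub_zero]
      abel
  have hE : EqOn (fun q => ℓ q ∘L G.frameSnd S q) (G.frameFst S) U :=
    AnalyticOnNhd.eqOn_of_preconnected_of_eventuallyEq (𝕜 := 𝕜) han
      (fun q _ => G.analyticAt_frameFst S q) hℓ.isPreconnected hℓ.zero_mem
      (Filter.Eventually.mono (Metric.ball_mem_nhds 0 hr) fun q hq => sub_eq_zero.1 (hz q hq))
  exact hE hq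

end LieQuasiData
end Bidynamical
end

/-! ### Gluing of canonical ℓ-matrices, and the linear algebra of K -/

open Set
open scoped Topology Nat

noncomputable section

namespace Bidynamical

variable {𝕜 : Type*} [RCLike 𝕜]
variable {L : Type*} [NormedAddCommGroup L] [NormedSpace 𝕜 L]
variable {V : Type*} [NormedAddCommGroup V] [NormedSpace 𝕜 V] [FiniteDimensional 𝕜 V]

/-! ### The canonical `ℓ`-matrix on its domain of analyticity -/

namespace LieQuasiData.IsBidynamical

variable {G : LieQuasiData 𝕜 V} {S : Splitting 𝕜 L V} (h : G.IsBidynamical S)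
include h

omit h in
theorem eq_of_surjective {F : Type*} [NormedAddCommGroup F] {U : Set (StrongDual 𝕜 L)}
    (hU : IsOpen U) {f g : StrongDual 𝕜 L → F} (q : StrongDual 𝕜 L) (hq : q ∈ U)
    (hf : ContinuousAt f q) (hg : ContinuousAt g q)
    (hfg : ∀ q ∈ U, Function.Surjective (G.frameSnd S q) → f q = g q) : f q = g q :=
  sub_eq_zero.1 (eq_zero_of_surjective (G := G) (S := S) hU (fun q => f q - g q) q hq (hf.sub hg)
    fun q hq hN => sub_eq_zero.2 (hfg q hq hN))

/-- The intersection of the two domains need not be connected, so the identity theorem is not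
available there. But `comp_frameSnd` holds throughout each domain, which forces equality wherever
`frameSnd` is onto, and density does the rest. -/
theorem isCanonicalOn_unique {U U' : Set (StrongDual 𝕜 L)}
    {ℓ ℓ' : StrongDual 𝕜 L → (StrongDual 𝕜 V →L[𝕜] V)} (hℓ : G.IsCanonicalOn S U ℓ)
    (hℓ' : G.IsCanonicalOn S U' ℓ') {q : StrongDual 𝕜 L} (hq : q ∈ U) (hq' : q ∈ U') :
    ℓ q = ℓ' q := by
  refine eq_of_surjective (G := G) (S := S) (hℓ.isOpen.inter hℓ'.isOpen) q ⟨hq, hq'⟩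
    (hℓ.analytic q hq).continuousAt (hℓ'.analytic q hq').continuousAt fun q hq hN => ?_
  refine ContinuousLinearMap.ext fun ξ => ?_
  obtain ⟨η, rfl⟩ := hN ξ
  have h2 := DFunLike.congr_fun (h.comp_frameSnd hℓ hq.1) η
  have h3 := DFunLike.congr_fun (h.comp_frameSnd hℓ' hq.2) η
  exact h2.trans h3.symm

theorem lcan_eq {U : Set (StrongDual 𝕜 L)} {ℓ : StrongDual 𝕜 L → (StrongDual 𝕜 V →L[𝕜] V)}
    (hℓ : G.IsCanonicalOn S U ℓ) {q : StrongDual 𝕜 L} (hq : q ∈ U) : G.lcan S q = ℓ q := by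
  have hex : ∃ ℓ U, G.IsCanonicalOn S U ℓ ∧ q ∈ U := ⟨ℓ, U, hℓ, hq⟩
  obtain ⟨U', hU', hq'⟩ := hex.choose_spec
  rw [lcan, dif_pos hex]
  exact h.isCanonicalOn_unique hU' hℓ hq' hq

theorem isCanonicalOn_lcan : G.IsCanonicalOn S (G.analyticityDomain S) (G.lcan S) := by
  obtain ⟨U₀, ℓ₀, h₀, hev⟩ := h.exists_isCanonicalOn
  have hD : G.analyticityDomain S = ⋃₀ {U | ∃ ℓ, G.IsCanonicalOn S U ℓ} := by
    ext q
    constructor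
    · rintro ⟨ℓ, U, hℓ, hq⟩
      exact ⟨U, ⟨ℓ, hℓ⟩, hq⟩
    · rintro ⟨U, ⟨ℓ, hℓ⟩, hq⟩
      exact ⟨ℓ, U, hℓ, hq⟩
  refine h.isCanonicalOn_of_frame ?_ ?_ ⟨ℓ₀, U₀, h₀, h₀.zero_mem⟩ ?_ ?_
  · rw [hD]
    exact isOpen_sUnion fun U ⟨ℓ, hℓ⟩ => hℓ.isOpen
  · rw [hD]
    exact isPreconnected_sUnion 0 _ (fun U ⟨ℓ, hℓ⟩ => hℓ.zero_mem) fun U ⟨ℓ, hℓ⟩ => hℓ.isPreconnected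
  · rintro q ⟨ℓ, U, hℓ, hq⟩
    refine (hℓ.analytic q hq).congr ?_
    exact Filter.Eventually.mono (hℓ.isOpen.mem_nhds hq) fun q hq => (h.lcan_eq hℓ hq).symm
  · filter_upwards [hev, h₀.isOpen.mem_nhds h₀.zero_mem] with q hq hqU
    rw [h.lcan_eq h₀ hqU, hq]

end LieQuasiData.IsBidynamical

/-! ### The dual -/

namespace Splitting

variable {S : Splitting 𝕜 L V}

/-- The projection of the double on `l ⊕ l^⊥` along `m ⊕ m^⊥`. -/
def pH (S : Splitting 𝕜 L V) : (V × StrongDual 𝕜 V) →L[𝕜] (V × StrongDual 𝕜 V) :=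
  S.inclDual ∘L S.projDual

omit [FiniteDimensional 𝕜 V] in
theorem pH_apply (u : V × StrongDual 𝕜 V) :
    S.pH u = (S.i (S.p u.1), u.2 - S.s (tr S.i u.2)) := rfl

omit [FiniteDimensional 𝕜 V] in
theorem inclDual_injective : Function.Injective S.inclDual := Subtype.val_injective

omit [FiniteDimensional 𝕜 V] in
theorem inclDual_projDual (u : V × StrongDual 𝕜 V) : S.inclDual (S.projDual u) = S.pH u := rfl

omit [FiniteDimensional 𝕜 V] in
theorem pL_inclDual_fst (X : S.DualSpace) : S.i (S.p (S.inclDual X).1) = (S.inclDual X).1 := by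
  obtain ⟨⟨x, ξ⟩, ⟨z, hz⟩, hξ⟩ := X
  have hz' : S.i z = x := hz
  change S.i (S.p x) = x
  rw [← hz', S.p_i]

omit [FiniteDimensional 𝕜 V] in
theorem tr_i_inclDual_snd (X : S.DualSpace) : tr S.i (S.inclDual X).2 = 0 := X.2.2

omit [FiniteDimensional 𝕜 V] in
theorem projDual_inclDual (X : S.DualSpace) : S.projDual (S.inclDual X) = X := by
  refine inclDual_injective ?_
  rw [inclDual_projDual, pH_apply, pL_inclDual_fst, tr_i_inclDual_snd]
  simp

omit [FiniteDimensional 𝕜 V] in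
theorem projDual_eq_zero_iff (u : V × StrongDual 𝕜 V) :
    S.projDual u = 0 ↔ S.p u.1 = 0 ∧ u.2 = S.s (tr S.i u.2) := by
  rw [← (inclDual_injective (S := S)).eq_iff, inclDual_projDual, map_zero, pH_apply, Prod.ext_iff]
  simp only [Prod.fst_zero, Prod.snd_zero, sub_eq_zero]
  refine and_congr_left fun _ => ⟨fun h => ?_, fun h => by rw [h, map_zero]⟩
  rw [← S.p_i (S.p u.1), h, map_zero]

theorem dForm_eq_zero_of_projDual {u v : V × StrongDual 𝕜 V} (hu : S.projDual u = 0)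
    (hv : S.projDual v = 0) : dForm 𝕜 V u v = 0 := by
  obtain ⟨h1, h2⟩ := (projDual_eq_zero_iff u).1 hu
  obtain ⟨h3, h4⟩ := (projDual_eq_zero_iff v).1 hv
  rw [dForm_apply, h2, h4, s_apply, s_apply, h1, h3, map_zero, map_zero, add_zero]

theorem dForm_inclDual_inclDual (X Y : S.DualSpace) :
    dForm 𝕜 V (S.inclDual X) (S.inclDual Y) = 0 := by
  rw [dForm_apply, ← pL_inclDual_fst X, ← pL_inclDual_fst Y, ← tr_apply, ← tr_apply S.i (S.inclDual Y).2,
    tr_i_inclDual_snd, tr_i_inclDual_snd]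
  simp

/-- Since m ⊕ m^⊥ is isotropic, the pairing sees only the component of u in g^⋆. -/
theorem dForm_complDual (f : StrongDual 𝕜 S.DualSpace) (u : V × StrongDual 𝕜 V) :
    dForm 𝕜 V (S.complDual f) u = f (S.projDual u) := by
  have h1 : u = S.inclDual (S.projDual u) + (u - S.inclDual (S.projDual u)) := by abel
  have h2 : dForm 𝕜 V (S.complDual f) (u - S.inclDual (S.projDual u)) = 0 :=
    dForm_eq_zero_of_projDual (S.projDual_complDual f) (by
      rw [map_sub, projDual_inclDual, sub_self])
  conv_lhs => rw [h1, map_add, h2, add_zero]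
  exact S.complDual_pairing f (S.projDual u)

theorem complDual_snd (f : StrongDual 𝕜 S.DualSpace) :
    (S.complDual f).2 = S.s (tr S.dual.i f) := rfl

/-- The functional on `g^⋆` given by the pairing with `u`. -/
def pairDual (S : Splitting 𝕜 L V) (u : V × StrongDual 𝕜 V) : StrongDual 𝕜 S.DualSpace :=
  dForm 𝕜 V u ∘L S.inclDual

theorem complDual_pairDual (u : V × StrongDual 𝕜 V) : S.complDual (S.pairDual u) = u - S.pH u := by
  have h0 : S.projDual (u - S.pH u) = 0 := by
    rw [map_sub, ← inclDual_projDual, projDual_inclDual, sub_self]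
  refine eq_of_forall_dForm fun W => ?_
  have h1 : dForm 𝕜 V u (S.inclDual (S.projDual W))
      = dForm 𝕜 V (u - S.pH u) (S.inclDual (S.projDual W)) := by
    rw [map_sub (dForm 𝕜 V), sub_apply, ← inclDual_projDual, dForm_inclDual_inclDual, sub_zero]
  have h2 : dForm 𝕜 V (u - S.pH u) (W - S.inclDual (S.projDual W)) = 0 :=
    dForm_eq_zero_of_projDual h0 (by rw [map_sub, projDual_inclDual, sub_self])
  rw [dForm_complDual]
  rw [map_sub, sub_eq_zero] at h2
  rw [h2]
  exact h1

theorem K_apply (X : S.DualSpace × StrongDual 𝕜 S.DualSpace) :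
    S.K X = S.inclDual X.1 - S.complDual X.2 := rfl

theorem projDual_K (X : S.DualSpace × StrongDual 𝕜 S.DualSpace) : S.projDual (S.K X) = X.1 := by
  rw [K_apply, map_sub, projDual_inclDual, projDual_complDual, sub_zero]

/-- Both l ⊕ l^⊥ and m ⊕ m^⊥ are isotropic, so changing the sign on one of them reverses the form.
-/
theorem dForm_K (X Y : S.DualSpace × StrongDual 𝕜 S.DualSpace) :
    dForm 𝕜 V (S.K X) (S.K Y) = -dForm 𝕜 S.DualSpace X Y := by
  have h1 := dForm_complDual (S := S) X.2 (S.inclDual Y.1)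
  have h2 := dForm_complDual (S := S) Y.2 (S.inclDual X.1)
  have h3 := dForm_complDual (S := S) X.2 (S.complDual Y.2)
  rw [projDual_inclDual] at h1 h2
  rw [projDual_complDual, map_zero] at h3
  rw [LieQuasiData.dForm_comm] at h2
  rw [K_apply, K_apply, map_sub (dForm 𝕜 V), sub_apply, map_sub, map_sub, h1, h2, h3,
    dForm_inclDual_inclDual, dForm_apply]
  ring

theorem K_bijective : Function.Bijective S.K := by
  constructor
  · rw [injective_iff_map_eq_zero]
    intro X hX
    refine Prod.ext ?_ (ContinuousLinearMap.ext fun Y => ?_)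
    · rw [← projDual_K X, hX, map_zero]
      rfl
    · have h1 := dForm_K X (Y, 0)
      rw [hX, map_zero] at h1
      simpa using h1.symm
  · intro u
    refine ⟨(S.projDual u, S.pairDual (-u)), ?_⟩
    rw [K_apply, complDual_pairDual, inclDual_projDual, map_neg]
    abel

theorem K_jDual (X : S.DualSpace) : S.K (S.jDual X) = S.inclDual X := by
  rw [K_apply]
  change S.inclDual X - S.complDual 0 = _
  rw [map_zero, sub_zero]

/-- This sign is why the gauge transform is by e^{-sq} and why the dual frame at q corresponds to
the frame at -q. -/
theorem K_inr_s (q : StrongDual 𝕜 L) : S.K (0, S.dual.s q) = -(0, S.s q) := by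
  rw [K_apply, map_zero, zero_sub]
  congr 1
  refine eq_of_forall_dForm fun W => ?_
  rw [dForm_complDual]
  change q (S.p (S.i (S.p W.1))) = _
  rw [S.p_i]
  simp

theorem K_pL (X : S.DualSpace × StrongDual 𝕜 S.DualSpace) : S.K (S.dual.pL X) = S.pL (S.K X) := by
  have h1 := (projDual_eq_zero_iff _).1 (S.projDual_complDual X.2)
  rw [K_apply, K_apply, map_sub, pL_apply S (S.complDual X.2), h1.1]
  change S.inclDual (S.dual.i (S.dual.p X.1)) - S.complDual 0 = _
  rw [map_zero, map_zero, sub_zero]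
  change _ = S.pL (S.inclDual X.1) - 0
  rw [sub_zero]
  rfl

theorem K_pM (X : S.DualSpace × StrongDual 𝕜 S.DualSpace) : S.K (S.dual.pM X) = S.pM (S.K X) := by
  rw [K_apply X, map_sub, pM_apply S (S.inclDual X.1), tr_i_inclDual_snd, pM_apply S, complDual_snd,
    tr_i_s, pM_apply S.dual, K_inr_s]
  simp

end Splitting

end Bidynamical
end

/-! ### The dual is bidynamical and K is a Lie isomorphism -/

open Set
open scoped Topology Nat

noncomputable section

namespace Bidynamical

variable {𝕜 : Type*} [RCLike 𝕜]
variable {L : Type*} [NormedAddCommGroup L] [NormedSpace 𝕜 L]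
variable {V : Type*} [NormedAddCommGroup V] [NormedSpace 𝕜 V] [FiniteDimensional 𝕜 V]

namespace LieQuasiData

variable {G : LieQuasiData 𝕜 V} {S : Splitting 𝕜 L V}

theorem dual_bracket (X Y : S.DualSpace) :
    (G.dual S).bracket X Y = S.projDual (G.dAd (S.inclDual X) (S.inclDual Y)) := rfl

theorem dual_cobracket (X : S.DualSpace) (f : StrongDual 𝕜 S.DualSpace) :
    (G.dual S).cobracket X f = -S.projDual (G.dAd (S.inclDual X) (S.complDual f)) := rfl

theorem dual_assoc (f g : StrongDual 𝕜 S.DualSpace) :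
    (G.dual S).assoc f g = S.projDual (G.dAd (S.complDual f) (S.complDual g)) := rfl

theorem dForm_dual_dAd (X Y Z : S.DualSpace × StrongDual 𝕜 S.DualSpace) :
    dForm 𝕜 S.DualSpace ((G.dual S).dAd X Y) Z
      = dForm 𝕜 V (S.complDual Z.2) (G.dAd (S.inclDual X.1) (S.inclDual Y.1))
        - dForm 𝕜 V (S.complDual Z.2) (G.dAd (S.inclDual X.1) (S.complDual Y.2))
        + dForm 𝕜 V (S.complDual Z.2) (G.dAd (S.inclDual Y.1) (S.complDual X.2))
        + dForm 𝕜 V (S.complDual Z.2) (G.dAd (S.complDual X.2) (S.complDual Y.2))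
        - dForm 𝕜 V (S.complDual Y.2) (G.dAd (S.inclDual X.1) (S.inclDual Z.1))
        + dForm 𝕜 V (S.complDual X.2) (G.dAd (S.inclDual Y.1) (S.inclDual Z.1))
        + dForm 𝕜 V (S.complDual X.2) (G.dAd (S.inclDual Z.1) (S.complDual Y.2)) := by
  simp only [Splitting.dForm_complDual]
  rw [dForm_apply, dAd_fst, dAd_snd_apply]
  simp only [dual_bracket, dual_cobracket, dual_assoc, map_add, map_sub, map_neg]
  ring

namespace IsBidynamical

variable (h : G.IsBidynamical S)
include h

/-- The subspace `l ⊕ l^⊥` of the double is a subalgebra. -/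
theorem dForm_dAd_inclDual (X Y Z : S.DualSpace) :
    dForm 𝕜 V (G.dAd (S.inclDual X) (S.inclDual Y)) (S.inclDual Z) = 0 := by
  have hl : ∀ (X : S.DualSpace), ∃ z ξ, S.inclDual X = (S.i z, ξ) ∧ tr S.i ξ = 0 := fun X =>
    ⟨_, _, Prod.ext (Splitting.pL_inclDual_fst X).symm rfl, Splitting.tr_i_inclDual_snd X⟩
  obtain ⟨x, ξ, hX, hξ⟩ := hl X
  obtain ⟨y, η, hY, hη⟩ := hl Y
  obtain ⟨z, ζ, hZ, hζ⟩ := hl Z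
  have hb : ∀ (ξ : StrongDual 𝕜 V) (x y : L), tr S.i ξ = 0 → ξ (G.bracket (S.i x) (S.i y)) = 0 := by
    intro ξ x y hξ
    rw [← h.i_p_bracket, ← tr_apply, hξ]
    rfl
  rw [hX, hY, hZ, dForm_apply, dAd_fst, dAd_snd_apply]
  simp only [h.cobracket_l, map_add, map_zero, hb _ _ _ hξ, hb _ _ _ hη,
    h.assoc_mod_l ξ η ζ hξ hη hζ, LinearMap.zero_apply]
  simpa using hb _ _ _ hζ

/-- Both sides are expanded in the values of the invariant 3-form of d on g^⋆ and its complement.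
Its value on g^⋆ is 0 as g^⋆ is an isotropic subalgebra; the others match by cyclic invariance, the
signs in K being absorbed by the reversed cobracket. -/
theorem dForm_dAd_K (X Y Z : S.DualSpace × StrongDual 𝕜 S.DualSpace) :
    dForm 𝕜 V (G.dAd (S.K X) (S.K Y)) (S.K Z)
      = -dForm 𝕜 S.DualSpace ((G.dual S).dAd X Y) Z := by
  have hβ := h.isQuadraticLie
  have hs : ∀ u v w, dForm 𝕜 V (G.dAd u v) w = -dForm 𝕜 V (G.dAd v u) w := by
    intro u v w
    rw [hβ.skew, map_neg]
    rfl
  rw [dForm_dual_dAd, Splitting.K_apply, Splitting.K_apply, Splitting.K_apply]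
  simp only [dForm_comm (S.complDual _)]
  have h0 := h.dForm_dAd_inclDual X.1 Y.1 Z.1
  generalize S.inclDual X.1 = x at *
  generalize S.inclDual Y.1 = y at *
  generalize S.inclDual Z.1 = z at *
  generalize S.complDual X.2 = a at *
  generalize S.complDual Y.2 = b at *
  generalize S.complDual Z.2 = c at *
  simp only [map_sub, sub_apply]
  have h1 : dForm 𝕜 V (G.dAd x z) b = -dForm 𝕜 V (G.dAd x b) z := by
    rw [hβ.rotate x b, hβ.rotate b z, hs]
  have h2 := hβ.rotate a y z
  have h3 := hs a y c
  have h4 : dForm 𝕜 V (G.dAd z b) a = -dForm 𝕜 V (G.dAd a b) z := by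
    rw [hs z b, hβ.rotate a b z]
  linear_combination h0 - h2 + h3 - h1 + h4

theorem K_dAd (X Y : S.DualSpace × StrongDual 𝕜 S.DualSpace) :
    S.K ((G.dual S).dAd X Y) = G.dAd (S.K X) (S.K Y) := by
  refine eq_of_forall_dForm (𝕜 := 𝕜) fun W => ?_
  obtain ⟨Z, rfl⟩ := (Splitting.K_bijective (S := S)).2 W
  rw [h.dForm_dAd_K, Splitting.dForm_K]

/-- The structure is transported along the bijection K; the reversed sign of the form does not
affect invariance. -/
theorem isQuadraticLie_dual : IsQuadraticLie (G.dual S).dAd (dForm 𝕜 S.DualSpace) := by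
  have hβ := h.isQuadraticLie
  have hK := (Splitting.K_bijective (S := S)).1
  refine ⟨fun X Y => hK ?_, fun X Y Z => hK ?_, dForm_comm, fun X Y Z => ?_⟩
  · rw [map_neg, h.K_dAd, h.K_dAd, hβ.skew]
  · rw [map_add]
    simp only [h.K_dAd]
    exact hβ.jacobi _ _ _
  · rw [← neg_inj, ← Splitting.dForm_K, ← Splitting.dForm_K, h.K_dAd, h.K_dAd, hβ.inv]

/-- Reductivity makes m ⊕ m^⊥ stable under l. This is the vanishing of the dual cobracket on l. -/
theorem projDual_dAd_inl_i (z : L) {u : V × StrongDual 𝕜 V} (hu : S.projDual u = 0) :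
    S.projDual (G.dAd (S.i z, 0) u) = 0 := by
  have h1 := (Splitting.projDual_eq_zero_iff u).1 hu
  have hL := h.pL_dAd_inl_i z u
  have hM := h.pM_dAd_inl_i z (0, u.2)
  rw [Splitting.pM_apply S (0, u.2)] at hM
  simp only at hM
  rw [← h1.2, h.dAd_inl_i_inr, Splitting.pM_apply] at hM
  refine (Splitting.projDual_eq_zero_iff _).2 ⟨?_, ?_⟩
  · rw [Splitting.pL_apply, Splitting.pL_apply, h1.1, map_zero] at hL
    have h2 := congrArg (fun w => S.p w.1) hL
    simp only [S.p_i] at h2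
    rw [h2]
    have h3 : ((0, 0) : V × StrongDual 𝕜 V) = 0 := rfl
    rw [h3, map_zero]
    exact map_zero _
  · rw [h.dAd_inl_i]
    exact (congrArg Prod.snd hM).symm

theorem dual : (G.dual S).IsBidynamical S.dual := by
  refine ⟨isLieQuasiBialgebra_of_isQuadraticLie h.isQuadraticLie_dual, fun z w => ?_, fun z u hu => ?_,
    fun z => LinearMap.ext fun f => ?_, fun f g k hf hg hk => ?_⟩
  · obtain ⟨v, hv⟩ := h.subalgebra z w
    refine ⟨v, Splitting.inclDual_injective ?_⟩
    rw [dual_bracket, Splitting.inclDual_projDual]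
    change (S.i v, (0 : StrongDual 𝕜 V)) = S.pH (G.dAd (S.i z, 0) (S.i w, 0))
    rw [h.dAd_inl_i_inl, ← hv, Splitting.pH_apply, S.p_i]
    simp
  · have h1 : (S.inclDual u).1 = 0 := by
      rw [← Splitting.pL_inclDual_fst]
      have h2 : S.p (S.inclDual u).1 = 0 := hu
      rw [h2, map_zero]
    have h2 : S.inclDual u = (0, (S.inclDual u).2) := Prod.ext h1 rfl
    rw [dual_bracket, h2]
    change S.p (S.i (S.p (G.dAd (S.i z, 0) _).1)) = 0
    rw [h.dAd_inl_i_inr, map_zero, map_zero, map_zero]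
  · rw [dual_cobracket]
    have h1 := h.projDual_dAd_inl_i z (S.projDual_complDual f)
    exact neg_eq_zero.2 h1
  -- A functional vanishing on l corresponds to an element of m. As g is an isotropic subalgebra of
  -- d, the invariant 3-form vanishes on such elements.
  · have h1 : ∀ f, tr S.dual.i f = 0 → S.complDual f = ((S.complDual f).1, 0) := by
      intro f hf
      refine Prod.ext rfl ?_
      rw [Splitting.complDual_snd, hf, map_zero]
    rw [dual_assoc, ← Splitting.dForm_complDual, h1 f hf, h1 g hg, h1 k hk]
    simp [dAd_snd_apply]

end IsBidynamical

end LieQuasiData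

end Bidynamical
end

/-! ### The gauge operator and the frame of the dual -/

open Set
open scoped Topology Nat

noncomputable section

namespace Bidynamical

variable {𝕜 : Type*} [RCLike 𝕜]
theorem expTail_one_mul_neg_zero {A : Type*} [NormedRing A] [NormedAlgebra 𝕜 A] [CompleteSpace A]
    (a : A) : expTail 𝕜 1 a * expTail 𝕜 0 (-a) = expTail 𝕜 1 (-a) := by
  have h : Commute (-a) a := (Commute.refl a).neg_left
  rw [expTail_one_neg, (commute_expTail (commute_expTail h 0).symm 1).eq]

variable {L : Type*} [NormedAddCommGroup L] [NormedSpace 𝕜 L]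
variable {V : Type*} [NormedAddCommGroup V] [NormedSpace 𝕜 V] [FiniteDimensional 𝕜 V]

namespace LieQuasiData

theorem tailS_neg_tailS (G : LieQuasiData 𝕜 V) (S : Splitting 𝕜 L V) (q : StrongDual 𝕜 L)
    (u : V × StrongDual 𝕜 V) : G.tailS S 0 (-q) (G.tailS S 0 q u) = u := by
  have := FiniteDimensional.complete 𝕜 (V × StrongDual 𝕜 V)
  have h1 := DFunLike.congr_fun (expTail_neg_mul (𝕜 := 𝕜) (G.adS S q)) u
  rw [← map_neg] at h1
  exact h1

theorem tailS_tailS_neg (G : LieQuasiData 𝕜 V) (S : Splitting 𝕜 L V) (q : StrongDual 𝕜 L)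
    (u : V × StrongDual 𝕜 V) : G.tailS S 0 q (G.tailS S 0 (-q) u) = u := by
  have h1 := G.tailS_neg_tailS S (-q) u
  rwa [neg_neg] at h1

theorem tailS_one_neg (G : LieQuasiData 𝕜 V) (S : Splitting 𝕜 L V) (q : StrongDual 𝕜 L)
    (u : V × StrongDual 𝕜 V) : G.tailS S 1 q (G.tailS S 0 (-q) u) = G.tailS S 1 (-q) u := by
  have := FiniteDimensional.complete 𝕜 (V × StrongDual 𝕜 V)
  have h1 := DFunLike.congr_fun (expTail_one_mul_neg_zero (𝕜 := 𝕜) (G.adS S q)) u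
  rw [← map_neg] at h1
  exact h1

theorem tailS_neg_one (G : LieQuasiData 𝕜 V) (S : Splitting 𝕜 L V) (q : StrongDual 𝕜 L)
    (u : V × StrongDual 𝕜 V) : G.tailS S 0 q (G.tailS S 1 (-q) u) = G.tailS S 1 q u := by
  have := FiniteDimensional.complete 𝕜 (V × StrongDual 𝕜 V)
  have h1 := DFunLike.congr_fun (expTail_one_neg (𝕜 := 𝕜) (G.adS S (-q))) u
  rw [← map_neg, neg_neg] at h1
  exact h1.symm

theorem tailS_one_tailS_one_neg (G : LieQuasiData 𝕜 V) (S : Splitting 𝕜 L V) (q : StrongDual 𝕜 L)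
    (u : V × StrongDual 𝕜 V) :
    G.tailS S 1 q (G.tailS S 1 (-q) u) = G.tailS S 2 q u + G.tailS S 2 (-q) u := by
  have := FiniteDimensional.complete 𝕜 (V × StrongDual 𝕜 V)
  have h1 := DFunLike.congr_fun (expTail_one_mul_neg (𝕜 := 𝕜) (G.adS S q)) u
  rw [← map_neg] at h1
  exact h1

/-- The operator `Y ↦ e^{-A} ((T (e^A Y)_{g*} - (e^A Y)_g) + p_l ψ(A) Y - ψ(A) p_{m^⊥} Y)
+ p_{m ⊕ m^⊥} Y` of the double, where `A = ad_{s q}` and `ψ(A) = (e^A - 1) / A`. -/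
def gaugeOp (G : LieQuasiData 𝕜 V) (S : Splitting 𝕜 L V) (q : StrongDual 𝕜 L)
    (T : StrongDual 𝕜 V →L[𝕜] V) : (V × StrongDual 𝕜 V) →L[𝕜] (V × StrongDual 𝕜 V) :=
  G.tailS S 0 (-q) ∘L (ContinuousLinearMap.inl 𝕜 V (StrongDual 𝕜 V)
      ∘L ((T ∘L ContinuousLinearMap.snd 𝕜 V (StrongDual 𝕜 V)
        - ContinuousLinearMap.fst 𝕜 V (StrongDual 𝕜 V)) ∘L G.tailS S 0 q)
      + S.pL ∘L G.tailS S 1 q - G.tailS S 1 q ∘L S.pM)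
    + (ContinuousLinearMap.id 𝕜 _ - S.pH)

theorem gaugeOp_apply (G : LieQuasiData 𝕜 V) (S : Splitting 𝕜 L V) (q : StrongDual 𝕜 L)
    (T : StrongDual 𝕜 V →L[𝕜] V) (Y : V × StrongDual 𝕜 V) :
    G.gaugeOp S q T Y = G.tailS S 0 (-q)
      ((T (G.tailS S 0 q Y).2 - (G.tailS S 0 q Y).1, 0) + S.pL (G.tailS S 1 q Y)
        - G.tailS S 1 q (S.pM Y)) + (Y - S.pH Y) := rfl

theorem analyticAt_gaugeOp (G : LieQuasiData 𝕜 V) (S : Splitting 𝕜 L V) {q : StrongDual 𝕜 L}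
    {ℓ : StrongDual 𝕜 L → (StrongDual 𝕜 V →L[𝕜] V)} (hℓ : AnalyticAt 𝕜 ℓ q) :
    AnalyticAt 𝕜 (fun q => G.gaugeOp S q (ℓ q)) q := by
  have h1 : AnalyticAt 𝕜 (fun q => G.tailS S 0 (-q)) q :=
    AnalyticAt.fun_comp (g := G.tailS S 0) (f := fun q => -q) (G.analyticAt_tailS S 0 (-q))
      analyticAt_id.neg
  have h2 := G.analyticAt_tailS S 1 q
  have h3 := analyticAt_clm_comp ((analyticAt_clm_comp hℓ
    (analyticAt_const (v := ContinuousLinearMap.snd 𝕜 V (StrongDual 𝕜 V)))).sub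
      (analyticAt_const (v := ContinuousLinearMap.fst 𝕜 V (StrongDual 𝕜 V))))
      (G.analyticAt_tailS S 0 q)
  exact (analyticAt_clm_comp h1 (((analyticAt_clm_comp analyticAt_const h3).add
    (analyticAt_clm_comp analyticAt_const h2)).sub
      (analyticAt_clm_comp h2 analyticAt_const))).add analyticAt_const

namespace IsBidynamical

variable {G : LieQuasiData 𝕜 V} {S : Splitting 𝕜 L V} (h : G.IsBidynamical S)
include h

theorem K_adS (q : StrongDual 𝕜 L) (X : S.DualSpace × StrongDual 𝕜 S.DualSpace) :
    S.K ((G.dual S).adS S.dual q X) = G.adS S (-q) (S.K X) := by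
  rw [adS_apply, h.K_dAd, Splitting.K_inr_s, map_neg (G.adS S), adS_apply, map_neg G.dAd]

theorem K_tailS (k : ℕ) (q : StrongDual 𝕜 L) (X : S.DualSpace × StrongDual 𝕜 S.DualSpace) :
    S.K ((G.dual S).tailS S.dual k q X) = G.tailS S k (-q) (S.K X) := by
  have := FiniteDimensional.complete 𝕜 (V × StrongDual 𝕜 V)
  have := FiniteDimensional.complete 𝕜 (S.DualSpace × StrongDual 𝕜 S.DualSpace)
  exact map_expTail_apply S.K _ _ (h.K_adS q) k X

theorem K_frameTail (k : ℕ) (q : StrongDual 𝕜 L) (X : S.DualSpace × StrongDual 𝕜 S.DualSpace) :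
    S.K ((G.dual S).frameTail S.dual k q X) = G.frameTail S k (-q) (S.K X) := by
  rw [frameTail_apply, frameTail_apply, map_add, h.K_tailS, h.K_tailS, map_sub, Splitting.K_pM]

theorem K_frame (q : StrongDual 𝕜 L) (X : S.DualSpace × StrongDual 𝕜 S.DualSpace) :
    S.K ((G.dual S).frame S.dual q X) = G.frame S (-q) (S.K X) := by
  rw [frame_apply, frame_apply, map_sub, Splitting.K_pL, h.K_frameTail, h.K_frameTail]

omit h in
theorem frame_of_pM_eq_zero (q : StrongDual 𝕜 L) {u : V × StrongDual 𝕜 V} (hu : S.pM u = 0) :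
    G.tailS S 0 q u = G.frame S q u + S.pL (G.tailS S 1 q u) := by
  rw [frame_apply, frameTail_apply, frameTail_apply, hu, sub_zero, map_zero, map_zero, add_zero,
    add_zero, sub_add_cancel]

omit h in
theorem frame_of_pM_eq_self (q : StrongDual 𝕜 L) {u : V × StrongDual 𝕜 V} (hu : S.pM u = u) :
    G.tailS S 1 q u = G.frame S q u + S.pL (G.tailS S 2 q u) := by
  rw [frame_apply, frameTail_apply, frameTail_apply, hu, sub_self, map_zero, map_zero]
  simp only [zero_add]
  exact (sub_add_cancel (G.tailS S 1 q u) (S.pL (G.tailS S 2 q u))).symm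

theorem exists_tailS_inclDual (q : StrongDual 𝕜 L) (X : S.DualSpace) :
    ∃ η, G.tailS S 0 q (S.inclDual X) = G.frame S q (0, η) + S.pL (G.tailS S 1 q (S.inclDual X)) := by
  obtain ⟨z, ξ, hX, hξ⟩ : ∃ z ξ, S.inclDual X = (S.i z, 0) + (0, ξ) ∧ tr S.i ξ = 0 :=
    ⟨_, _, Prod.ext (by simpa using (Splitting.pL_inclDual_fst X).symm)
      (by simp only [Prod.snd_add, zero_add]), Splitting.tr_i_inclDual_snd X⟩
  -- For z in l the vector Az = s(ad*_z q) lies in m^⊥, and e^A z = z + E_1(A) Az. The frame of Az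
  -- is E_1(A) Az up to p_l E_2(A) Az, and E_2(A) Az = E_1(A) z - z.
  refine ⟨S.s (G.adTL S z q) + ξ, ?_⟩
  have hη : ∀ η θ : StrongDual 𝕜 V, ((0, η + θ) : V × StrongDual 𝕜 V) = (0, η) + (0, θ) := by
    intro η θ
    simp
  have hz : S.pM (0, ξ) = 0 := by
    rw [Splitting.pM_apply, hξ, map_zero]
    rfl
  have h1 := G.tailS_succ_adS S 0 q (S.i z, 0)
  have h2 := G.tailS_succ_adS S 1 q (S.i z, 0)
  have h3 : S.pM (0, S.s (G.adTL S z q)) = (0, S.s (G.adTL S z q)) := by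
    rw [Splitting.pM_apply, Splitting.tr_i_s]
  have h4 : S.pL (S.i z, 0) = (S.i z, 0) := by
    rw [Splitting.pL_apply, S.p_i]
  have h5 := frame_of_pM_eq_self (G := G) q h3
  rw [h.adS_inl_i] at h1 h2
  rw [h2] at h5
  rw [h5, map_sub S.pL, map_smul S.pL, h4] at h1
  simp only [Nat.factorial_zero, Nat.factorial_one, Nat.cast_one, inv_one, one_smul,
    ← add_sub_assoc, sub_left_inj] at h1
  rw [hX, map_add, frame_of_pM_eq_zero q hz, hη, map_add (G.frame S q), map_add (G.tailS S 1 q),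
    map_add S.pL, ← h1]
  abel

section

variable {T : StrongDual 𝕜 V →L[𝕜] V} {q : StrongDual 𝕜 L}
  (hT : T ∘L G.frameSnd S q = G.frameFst S q)
include hT

omit h in
theorem graph_frame_add (η : StrongDual 𝕜 V) (u : V × StrongDual 𝕜 V) :
    T (G.frame S q (0, η) + S.pL u).2 - (G.frame S q (0, η) + S.pL u).1 = -(S.pL u).1 := by
  have h1 : T (G.frame S q (0, η)).2 = (G.frame S q (0, η)).1 := DFunLike.congr_fun hT η
  rw [Prod.snd_add, Prod.fst_add, map_add, h1, Splitting.pL_apply, map_zero]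
  abel

/-- Up to p_l E_1(A) X, the vector e^A X lies on the graph of T. The graph term of `gaugeOp`
therefore cancels its term p_l E_1(A), while p_{m^⊥} and the projection on m ⊕ m^⊥ kill X. -/
theorem gaugeOp_inclDual (X : S.DualSpace) : G.gaugeOp S q T (S.inclDual X) = 0 := by
  obtain ⟨η, hη⟩ := h.exists_tailS_inclDual q X
  have h1 : S.pH (S.inclDual X) = S.inclDual X := by
    rw [← Splitting.inclDual_projDual, Splitting.projDual_inclDual]
  have h2 : S.pM (S.inclDual X) = 0 := by
    rw [Splitting.pM_apply, Splitting.tr_i_inclDual_snd, map_zero]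
    rfl
  have h3 : ∀ u, ((-(S.pL u).1, 0) : V × StrongDual 𝕜 V) + S.pL u = 0 := by
    intro u
    rw [Splitting.pL_apply]
    simp
  rw [gaugeOp_apply, hη, graph_frame_add hT, h1, h2, h3, map_zero, sub_zero, map_zero, sub_self,
    add_zero]

theorem gaugeOp_frame_neg {w : V × StrongDual 𝕜 V} (hw : S.projDual w = 0) :
    G.gaugeOp S q T (G.frame S (-q) w) = -S.pH (G.frame S (-q) w) := by
  set v := G.frameTail S 0 (-q) w with hv
  set b := S.pL (G.frameTail S 1 (-q) w) with hb
  have hb' : b = S.inclDual (S.dual.i (S.p (G.frameTail S 1 (-q) w).1)) := rfl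
  have hbp : S.pH b = b := by
    rw [hb', ← Splitting.inclDual_projDual, Splitting.projDual_inclDual]
  have hR : G.gaugeOp S q T b = 0 := by rw [hb', h.gaugeOp_inclDual hT]
  rw [frame_apply, map_sub, map_sub, hR, hbp, sub_zero]
  obtain ⟨hw1, hw2⟩ := (Splitting.projDual_eq_zero_iff w).1 hw
  set x := w - S.pM w with hx
  set c := S.pM w with hc
  have hcc : S.pM c = c := S.pM_pM w
  have hx2 : x.2 = 0 := by
    rw [hx, hc, Splitting.pM_apply, Prod.snd_sub, sub_eq_zero]
    exact hw2
  have hvE : v = G.tailS S 0 (-q) x + G.tailS S 1 (-q) c := rfl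
  have hbE : b = S.pL (G.tailS S 1 (-q) x + G.tailS S 2 (-q) c) := rfl
  -- The exponential at q undoes the one at -q on x, and e^A E_1(-A) = E_1(A) on c.
  have hav : G.tailS S 0 q v = x + G.tailS S 1 q c := by
    rw [hvE, map_add, tailS_tailS_neg, tailS_neg_one]
  have hpv : S.pL (G.tailS S 1 q v) = b + S.pL (G.tailS S 2 q c) := by
    rw [hvE, map_add, tailS_one_neg, tailS_one_tailS_one_neg, hbE]
    simp only [map_add]
    abel
  have hmv : S.pM v = c - G.adS S q b := by
    rw [hv, h.pM_frameTail, map_neg, neg_apply, ← sub_eq_add_neg]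
  have hmv' : G.tailS S 1 q (S.pM v) = G.tailS S 1 q c - (G.tailS S 0 q b - b) := by
    have h1 := G.tailS_succ_adS S 0 q b
    simp only [Nat.factorial_zero, Nat.cast_one, inv_one, one_smul] at h1
    rw [hmv, map_sub, ← h1]
  have hc0 : c = (0, c.2) := Prod.ext (congrArg Prod.fst hcc).symm rfl
  -- The vector x lies in g and contributes -x. The vector E_1(A) c is a frame vector plus p_l
  -- E_2(A) c, and T reproduces the frame part.
  have hlam : ((T (G.tailS S 0 q v).2 - (G.tailS S 0 q v).1, 0) : V × StrongDual 𝕜 V)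
      = -x - S.pL (G.tailS S 2 q c) := by
    have h1 := graph_frame_add hT c.2 (G.tailS S 2 q c)
    rw [← hc0, ← frame_of_pM_eq_self q hcc] at h1
    rw [hav, Prod.snd_add, Prod.fst_add, hx2, zero_add]
    have h2 : T (G.tailS S 1 q c).2 - (x.1 + (G.tailS S 1 q c).1)
        = -x.1 - (S.pL (G.tailS S 2 q c)).1 := by
      rw [sub_eq_iff_eq_add.1 h1]
      abel
    rw [h2]
    refine Prod.ext rfl ?_
    rw [Prod.snd_sub, Prod.snd_neg, hx2, Splitting.pL_apply]
    simp
  have hsum : -x - S.pL (G.tailS S 2 q c) + (b + S.pL (G.tailS S 2 q c))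
      - (G.tailS S 1 q c - (G.tailS S 0 q b - b)) = G.tailS S 0 q b - G.tailS S 0 q v := by
    rw [hav]
    abel
  rw [gaugeOp_apply, hlam, hpv, hmv', hsum, map_sub (G.tailS S 0 (-q)), tailS_neg_tailS,
    tailS_neg_tailS]
  abel

/-- K turns a vector of the dual frame at q into a vector of the frame at -q with the complementary
part negated. As `gaugeOp` kills the g^⋆ part, `gaugeOp_frame_neg` says that it realises the graph
identity of the dual. -/
theorem gaugeOp_complDual (g : StrongDual 𝕜 S.DualSpace) :
    G.gaugeOp S q T (S.complDual ((G.dual S).frameSnd S.dual q g))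
      = S.inclDual ((G.dual S).frameFst S.dual q g) := by
  have h1 := h.K_frame q (0, g)
  have h2 : S.projDual (S.K (0, g)) = 0 := Splitting.projDual_K _
  have h3 := h.gaugeOp_frame_neg hT h2
  have h4 : S.K ((G.dual S).frame S.dual q (0, g)) = S.inclDual ((G.dual S).frameFst S.dual q g)
      - S.complDual ((G.dual S).frameSnd S.dual q g) := rfl
  rw [← h1, h4, map_sub, h.gaugeOp_inclDual hT, zero_sub, neg_inj, map_sub,
    ← Splitting.inclDual_projDual, ← Splitting.inclDual_projDual, Splitting.projDual_inclDual,
    Splitting.projDual_complDual, map_zero, sub_zero] at h3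
  exact h3

end

end IsBidynamical

end LieQuasiData

end Bidynamical
end

/-! ### The gauge transform by e^{-sq} computed in the double -/

open Set
open scoped Topology Nat

noncomputable section

namespace Bidynamical

variable {𝕜 : Type*} [RCLike 𝕜]

theorem expTail_zero_add_of_commute {A : Type*} [NormedRing A] [NormedAlgebra 𝕜 A] [CompleteSpace A]
    {a b : A} (h : Commute a b) :
    expTail 𝕜 0 (a + b) = expTail 𝕜 0 a * expTail 𝕜 0 b := by
  let := NormedAlgebra.restrictScalars ℚ 𝕜 A
  rw [expTail_zero_left, expTail_zero_left, expTail_zero_left, NormedSpace.exp_add_of_commute h]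

section Conj

variable {E F : Type*} [NormedAddCommGroup E] [NormedSpace 𝕜 E]
  [NormedAddCommGroup F] [NormedSpace 𝕜 F] [CompleteSpace F]

theorem expTail_compL (a : F →L[𝕜] F) (T : E →L[𝕜] F) :
    expTail 𝕜 0 (ContinuousLinearMap.compL 𝕜 E F F a) T = expTail 𝕜 0 a ∘L T := by
  refine ContinuousLinearMap.ext fun x => ?_
  exact map_expTail_apply (ContinuousLinearMap.apply 𝕜 F x) _ _ (fun T => rfl) 0 T

variable [CompleteSpace E]

theorem expTail_compL_flip (b : E →L[𝕜] E) (T : E →L[𝕜] F) :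
    expTail 𝕜 0 ((ContinuousLinearMap.compL 𝕜 E E F).flip b) T = T ∘L expTail 𝕜 0 b := by
  refine ContinuousLinearMap.ext fun x => ?_
  have h1 := (ContinuousLinearMap.apply 𝕜 F x).hasSum
    (hasSum_expTail_apply (𝕜 := 𝕜) 0 ((ContinuousLinearMap.compL 𝕜 E E F).flip b) T)
  have h2 := T.hasSum (hasSum_expTail_apply (𝕜 := 𝕜) 0 b x)
  have h3 : ∀ (n : ℕ) (T : E →L[𝕜] F),
      (((ContinuousLinearMap.compL 𝕜 E E F).flip b) ^ n) T = T ∘L b ^ n := by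
    intro n
    induction n with
    | zero => intro T; rfl
    | succ n ih =>
      intro T
      rw [pow_succ, mul_apply_eq_comp, ih, pow_succ']
      rfl
  refine h1.unique ?_
  simp only [ContinuousLinearMap.apply_apply, h3, smul_apply, ContinuousLinearMap.comp_apply]
  simpa using h2

/-- The exponential of the infinitesimal action `T ↦ a T + T b`. -/
theorem expTail_compL_add (a : F →L[𝕜] F) (b : E →L[𝕜] E) (T : E →L[𝕜] F) :
    expTail 𝕜 0 (ContinuousLinearMap.compL 𝕜 E F F a
      + (ContinuousLinearMap.compL 𝕜 E E F).flip b) T = expTail 𝕜 0 a ∘L T ∘L expTail 𝕜 0 b := by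
  have hc : Commute (ContinuousLinearMap.compL 𝕜 E F F a)
      ((ContinuousLinearMap.compL 𝕜 E E F).flip b) := ContinuousLinearMap.ext fun T => rfl
  rw [expTail_zero_add_of_commute hc, mul_apply_eq_comp, expTail_compL_flip, expTail_compL]

/-- Since (e^D - 1)/D composed with D is e^D - 1, the group cocycle integrating a coboundary is a
coboundary. -/
theorem expDiv_compL_add (a : F →L[𝕜] F) (b : E →L[𝕜] E) (T : E →L[𝕜] F) :
    expDiv 𝕜 (ContinuousLinearMap.compL 𝕜 E F F a + (ContinuousLinearMap.compL 𝕜 E E F).flip b)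
      (a ∘L T + T ∘L b) = expTail 𝕜 0 a ∘L T ∘L expTail 𝕜 0 b - T := by
  have h1 := DFunLike.congr_fun (expTail_succ_mul (𝕜 := 𝕜) 0 (ContinuousLinearMap.compL 𝕜 E F F a
    + (ContinuousLinearMap.compL 𝕜 E E F).flip b)) T
  rw [← expTail_compL_add]
  simp only [Nat.factorial_zero, Nat.cast_one, inv_one, one_smul] at h1
  exact h1

end Conj

variable {L : Type*} [NormedAddCommGroup L] [NormedSpace 𝕜 L]
variable {V : Type*} [NormedAddCommGroup V] [NormedSpace 𝕜 V] [FiniteDimensional 𝕜 V]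

theorem sharp_dForm (Y : V × StrongDual 𝕜 V) : sharp 𝕜 V (dForm 𝕜 V Y) = Y := by
  refine Prod.ext (eq_of_forall_dual (𝕜 := 𝕜) fun ξ => ?_) (ContinuousLinearMap.ext fun x => ?_)
  · refine (apply_ofBidual _ _).trans ?_
    simp
  · change dForm 𝕜 V Y (x, 0) = _
    simp

theorem dForm_sharp (f : StrongDual 𝕜 (V × StrongDual 𝕜 V)) : dForm 𝕜 V (sharp 𝕜 V f) = f := by
  refine ContinuousLinearMap.ext fun W => ?_
  have h1 : W.2 (sharp 𝕜 V f).1 = f (0, W.2) := apply_ofBidual _ _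
  have h2 : (sharp 𝕜 V f).2 W.1 = f (W.1, 0) := rfl
  rw [dForm_apply, h1, h2, ← map_add]
  simp

namespace LieQuasiData

variable {G : LieQuasiData 𝕜 V} {S : Splitting 𝕜 L V}

theorem double_ad_negS (q : StrongDual 𝕜 L) : G.double.ad (S.negS q) = G.adS S (-q) := by
  rw [double_ad, adS_apply, map_neg]
  rfl

theorem AdExp_negS (q : StrongDual 𝕜 L) : G.double.AdExp (S.negS q) = G.tailS S 0 (-q) := by
  rw [AdExp, double_ad_negS]
  exact (expTail_zero_left (𝕜 := 𝕜) _).symm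

theorem logDerivExp_negS (q α : StrongDual 𝕜 L) :
    G.double.logDerivExp S.negS q α = -G.tailS S 1 (-q) (0, S.s α) := by
  have h1 : S.negS = ⇑(-(ContinuousLinearMap.inr 𝕜 V (StrongDual 𝕜 V) ∘L S.s)) := by
    funext q
    exact Prod.ext (by simp [Splitting.negS]) (by simp [Splitting.negS])
  have h2 : fderiv 𝕜 S.negS q = -(ContinuousLinearMap.inr 𝕜 V (StrongDual 𝕜 V) ∘L S.s) := by
    rw [h1, ContinuousLinearMap.fderiv]
  rw [logDerivExp, double_ad_negS, h2, ContinuousLinearMap.comp_apply, neg_apply, map_neg]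
  rfl

theorem cocycleExp_double (x : V × StrongDual 𝕜 V) :
    G.double.cocycleExp x = expTail 𝕜 0 (G.double.ad x) ∘L rMatrix 𝕜 V
      ∘L expTail 𝕜 0 (G.double.adT x) - rMatrix 𝕜 V := by
  have := FiniteDimensional.complete 𝕜 (V × StrongDual 𝕜 V)
  exact expDiv_compL_add (G.double.ad x) (G.double.adT x) (rMatrix 𝕜 V)

theorem rMatrix_dForm (Y : V × StrongDual 𝕜 V) :
    rMatrix 𝕜 V (dForm 𝕜 V Y) = (2⁻¹ : 𝕜) • Y - (Y.1, 0) := by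
  have h1 : rMatrix 𝕜 V (dForm 𝕜 V Y) = (2⁻¹ : 𝕜) • ((0, (sharp 𝕜 V (dForm 𝕜 V Y)).2)
      - ((sharp 𝕜 V (dForm 𝕜 V Y)).1, 0)) := rfl
  rw [h1, sharp_dForm]
  refine Prod.ext ?_ ?_
  · simp only [Prod.smul_fst, Prod.fst_sub]
    module
  · simp

namespace IsBidynamical

variable (h : G.IsBidynamical S)
include h

/-- As ad_{sq} is skew for the form, transposition under d* = d changes the sign of q. -/
theorem tr_tailS_dForm (k : ℕ) (q : StrongDual 𝕜 L) (Y : V × StrongDual 𝕜 V) :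
    tr (G.tailS S k (-q)) (dForm 𝕜 V Y) = dForm 𝕜 V (G.tailS S k q Y) := by
  have := FiniteDimensional.complete 𝕜 (V × StrongDual 𝕜 V)
  refine ContinuousLinearMap.ext fun W => ?_
  have h1 := h.isQuadraticLie.adjoint_expTail k (0, S.s q) Y W
  rw [tr_apply]
  refine Eq.trans ?_ h1.symm
  rw [tailS, map_neg]
  rfl

/-- Under d* = d the r-matrix is ½ - p_g. The scalar ½ is invariant and drops out of Ad r Ad* - r,
which leaves the variation of p_g. -/
theorem cocycleExp_negS (q : StrongDual 𝕜 L) (Y : V × StrongDual 𝕜 V) :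
    G.double.cocycleExp (S.negS q) (dForm 𝕜 V Y)
      = (Y.1, 0) - G.tailS S 0 (-q) ((G.tailS S 0 q Y).1, 0) := by
  have := FiniteDimensional.complete 𝕜 (V × StrongDual 𝕜 V)
  have := FiniteDimensional.complete 𝕜 (StrongDual 𝕜 (V × StrongDual 𝕜 V))
  have h1 : expTail 𝕜 0 (G.double.adT (S.negS q)) (dForm 𝕜 V Y) = dForm 𝕜 V (G.tailS S 0 q Y) := by
    refine ContinuousLinearMap.ext fun W => ?_
    have h2 := expTail_adjoint (𝕜 := 𝕜) (ContinuousLinearMap.id 𝕜 (StrongDual 𝕜 (V × StrongDual 𝕜 V)))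
      (G.double.adT (S.negS q)) (G.double.ad (S.negS q)) (fun _ _ => rfl) 0 (dForm 𝕜 V Y) W
    refine h2.trans ?_
    rw [double_ad_negS, ← h.tr_tailS_dForm]
    rfl
  rw [cocycleExp_double, sub_apply, ContinuousLinearMap.comp_apply, ContinuousLinearMap.comp_apply,
    h1, rMatrix_dForm, rMatrix_dForm, double_ad_negS]
  change G.tailS S 0 (-q) _ - _ = _
  rw [map_sub, map_smul, tailS_neg_tailS]
  abel

theorem gaugeExp_dForm [FiniteDimensional 𝕜 L] (q : StrongDual 𝕜 L)
    (ℓ : StrongDual 𝕜 L → (StrongDual 𝕜 V →L[𝕜] V)) (Y : V × StrongDual 𝕜 V) :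
    (G.double.gaugeExp (S.j ∘L S.i) S.negS (fun q' => S.j ∘L ℓ q' ∘L tr S.j) q
      - S.projL + S.projMPerp) (dForm 𝕜 V Y) = G.gaugeOp S q (ℓ q) Y := by
  have h1 : tr (G.double.AdExp (S.negS q)) (dForm 𝕜 V Y) = dForm 𝕜 V (G.tailS S 0 q Y) := by
    rw [AdExp_negS, h.tr_tailS_dForm]
  have h2 : ∀ Z, tr S.j (dForm 𝕜 V Z) = Z.2 := by
    intro Z
    ext x
    simp [Splitting.j]
  have h3 : ∀ Z, tr (S.j ∘L S.i) (dForm 𝕜 V Z) = tr S.i Z.2 := by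
    intro Z
    ext x
    simp [Splitting.j]
  have h4 : ofBidual (tr (G.double.logDerivExp S.negS q) (dForm 𝕜 V Y))
      = -S.p (G.tailS S 1 q Y).1 := by
    refine eq_of_forall_dual (𝕜 := 𝕜) fun α => ?_
    rw [apply_ofBidual, tr_apply, logDerivExp_negS, map_neg, map_neg, ← tr_apply,
      h.tr_tailS_dForm]
    simp
  have h5 : S.projL (dForm 𝕜 V Y) = S.pL Y := by
    refine (congrArg S.pL (sharp_dForm Y) : _)
  have h6 : S.projMPerp (dForm 𝕜 V Y) = S.pM Y := by
    refine (congrArg S.pM (sharp_dForm Y) : _)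
  have h7 : S.j (S.i (-S.p (G.tailS S 1 q Y).1)) = -S.pL (G.tailS S 1 q Y) := by
    rw [map_neg, map_neg]
    rfl
  have h8 : ∀ x, S.j x = (x, 0) := fun x => rfl
  -- From e^A = 1 + A E_1(A) and p_{m^⊥} A = A p_l. The second term meets E_1(-A) of the logarithmic
  -- derivative, and E_1(-A) A = 1 - e^{-A} by `h10`.
  have h9 : ((0, S.s (tr S.i (G.tailS S 0 q Y).2)) : V × StrongDual 𝕜 V)
      = S.pM Y + G.adS S q (S.pL (G.tailS S 1 q Y)) := by
    change S.pM (G.tailS S 0 q Y) = _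
    have h10 := G.adS_tailS_succ S 0 q Y
    simp only [Nat.factorial_zero, Nat.cast_one, inv_one, one_smul] at h10
    rw [← h.pM_adS, ← map_add, h10, add_sub_cancel]
  have h10 := G.tailS_succ_adS S 0 (-q) (S.pL (G.tailS S 1 q Y))
  simp only [Nat.factorial_zero, Nat.cast_one, inv_one, one_smul] at h10
  rw [map_neg, neg_apply, map_neg, neg_eq_iff_eq_neg, neg_sub] at h10
  have h11 : ∀ u : V × StrongDual 𝕜 V, G.tailS S 1 (-q) u
      = G.tailS S 0 (-q) (G.tailS S 1 q u) := by
    intro u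
    have h12 := G.tailS_neg_one S (-q) u
    rw [neg_neg] at h12
    exact h12.symm
  have h12 : Y - S.pH Y = (Y.1, 0) - S.pL Y + S.pM Y := by
    rw [Splitting.pH_apply, Splitting.pL_apply, Splitting.pM_apply]
    refine Prod.ext ?_ ?_ <;> simp
  have h13 : ((ℓ q (G.tailS S 0 q Y).2 - (G.tailS S 0 q Y).1, 0) : V × StrongDual 𝕜 V)
      = (ℓ q (G.tailS S 0 q Y).2, 0) - ((G.tailS S 0 q Y).1, 0) := by
    simp
  rw [add_apply, sub_apply, h5, h6, gaugeExp, add_apply, add_apply, sub_apply]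
  simp only [ContinuousLinearMap.comp_apply]
  have h14 : (G.double.AdExp (S.negS q)) (S.j (ℓ q (G.tailS S 0 q Y).2))
      = G.tailS S 0 (-q) (ℓ q (G.tailS S 0 q Y).2, 0) := by
    rw [AdExp_negS]
    rfl
  rw [h1, h2, h3, h4, h7, logDerivExp_negS, h9, h.cocycleExp_negS, h14, gaugeOp_apply, h12, h13,
    map_add (G.tailS S 1 (-q)), map_sub (G.tailS S 0 (-q)), map_add (G.tailS S 0 (-q)),
    map_sub (G.tailS S 0 (-q)), h10, ← h11]
  abel

end IsBidynamical

end LieQuasiData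

end Bidynamical
end

/-! ### Equality of the domains and the final formula -/

open Set
open scoped Topology Nat

noncomputable section

namespace Bidynamical

variable {𝕜 : Type*} [RCLike 𝕜]
variable {L : Type*} [NormedAddCommGroup L] [NormedSpace 𝕜 L]
variable {V : Type*} [NormedAddCommGroup V] [NormedSpace 𝕜 V] [FiniteDimensional 𝕜 V]

namespace LieQuasiData

/-- The map which recovers `T` from the operator `incl ∘ T' ∘ pairDual = gaugeOp q T`. -/
def gaugeOpInv (G : LieQuasiData 𝕜 V) (S : Splitting 𝕜 L V) (q : StrongDual 𝕜 L)
    (T' : StrongDual 𝕜 S.DualSpace →L[𝕜] S.DualSpace) : StrongDual 𝕜 V →L[𝕜] V :=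
  ContinuousLinearMap.fst 𝕜 V (StrongDual 𝕜 V) ∘L
    ((G.tailS S 0 q ∘L ((S.inclDual ∘L (T' ∘L (tr S.inclDual ∘L dForm 𝕜 V)))
        - (ContinuousLinearMap.id 𝕜 _ - S.pH))
      - S.pL ∘L G.tailS S 1 q + G.tailS S 1 q ∘L S.pM)
    ∘L (G.tailS S 0 (-q) ∘L ContinuousLinearMap.inr 𝕜 V (StrongDual 𝕜 V)))

theorem gaugeOpInv_apply (G : LieQuasiData 𝕜 V) (S : Splitting 𝕜 L V) (q : StrongDual 𝕜 L)
    (T' : StrongDual 𝕜 S.DualSpace →L[𝕜] S.DualSpace) (η : StrongDual 𝕜 V)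
    {Y : V × StrongDual 𝕜 V} (hY : Y = G.tailS S 0 (-q) (0, η)) :
    G.gaugeOpInv S q T' η = (G.tailS S 0 q (S.inclDual (T' (S.pairDual Y)) - (Y - S.pH Y))
      - S.pL (G.tailS S 1 q Y) + G.tailS S 1 q (S.pM Y)).1 := by
  rw [hY]
  rfl

theorem analyticAt_gaugeOpInv (G : LieQuasiData 𝕜 V) (S : Splitting 𝕜 L V) {q : StrongDual 𝕜 L}
    {ℓ : StrongDual 𝕜 L → (StrongDual 𝕜 S.DualSpace →L[𝕜] S.DualSpace)} (hℓ : AnalyticAt 𝕜 ℓ q) :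
    AnalyticAt 𝕜 (fun q => G.gaugeOpInv S q (ℓ q)) q := by
  have h1 : AnalyticAt 𝕜 (fun q => G.tailS S 0 (-q)) q :=
    AnalyticAt.fun_comp (g := G.tailS S 0) (f := fun q => -q) (G.analyticAt_tailS S 0 (-q))
      analyticAt_id.neg
  have h2 := G.analyticAt_tailS S 1 q
  have h3 := (analyticAt_clm_comp (analyticAt_const (v := S.inclDual)) (analyticAt_clm_comp hℓ
    (analyticAt_const (v := tr S.inclDual ∘L dForm 𝕜 V)))).sub
      (analyticAt_const (v := ContinuousLinearMap.id 𝕜 _ - S.pH))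
  have h4 := ((analyticAt_clm_comp (G.analyticAt_tailS S 0 q) h3).sub
    (analyticAt_clm_comp (analyticAt_const (v := S.pL)) h2)).add
      (analyticAt_clm_comp h2 (analyticAt_const (v := S.pM)))
  exact analyticAt_clm_comp
    (analyticAt_const (v := ContinuousLinearMap.fst 𝕜 V (StrongDual 𝕜 V)))
    (analyticAt_clm_comp h4 (analyticAt_clm_comp h1
      (analyticAt_const (v := ContinuousLinearMap.inr 𝕜 V (StrongDual 𝕜 V)))))

theorem gaugeOpInv_eq (G : LieQuasiData 𝕜 V) (S : Splitting 𝕜 L V) {q : StrongDual 𝕜 L}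
    {T : StrongDual 𝕜 V →L[𝕜] V} {T' : StrongDual 𝕜 S.DualSpace →L[𝕜] S.DualSpace}
    (hT : ∀ Y, S.inclDual (T' (S.pairDual Y)) = G.gaugeOp S q T Y) : G.gaugeOpInv S q T' = T := by
  refine ContinuousLinearMap.ext fun η => ?_
  rw [G.gaugeOpInv_apply S q T' η rfl, hT, gaugeOp_apply, tailS_tailS_neg, add_sub_cancel_right,
    tailS_tailS_neg]
  simp only [Prod.fst_add, Prod.fst_sub]
  abel

namespace IsBidynamical

variable {G : LieQuasiData 𝕜 V} {S : Splitting 𝕜 L V} (h : G.IsBidynamical S)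
include h

/-- The coefficients of `gaugeOp` are entire in q, so the formula is analytic wherever the ℓ-matrix
of G is, and `gaugeOp_complDual` is the frame identity for the dual. -/
theorem isCanonicalOn_dual : (G.dual S).IsCanonicalOn S.dual (G.analyticityDomain S)
    (fun q => S.projDual ∘L (G.gaugeOp S q (G.lcan S q) ∘L S.complDual)) := by
  have hc := h.isCanonicalOn_lcan
  refine h.dual.isCanonicalOn_of_frame hc.isOpen hc.isPreconnected hc.zero_mem (fun q hq => ?_) ?_
  · exact analyticAt_clm_comp analyticAt_const
      (analyticAt_clm_comp (G.analyticAt_gaugeOp S (hc.analytic q hq)) analyticAt_const)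
  · filter_upwards [hc.isOpen.mem_nhds hc.zero_mem] with q hq
    refine ContinuousLinearMap.ext fun g => ?_
    refine (congrArg S.projDual (h.gaugeOp_complDual (h.comp_frameSnd hc hq) g)).trans ?_
    rw [Splitting.projDual_inclDual]

theorem inclDual_lcan_dual {q : StrongDual 𝕜 L} (hq : q ∈ G.analyticityDomain S)
    (Y : V × StrongDual 𝕜 V) : S.inclDual ((G.dual S).lcan S.dual q (S.pairDual Y))
      = G.gaugeOp S q (G.lcan S q) Y := by
  have hc := h.isCanonicalOn_lcan
  have hd := h.isCanonicalOn_dual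
  -- That the operator takes values in g^⋆ is known on the image of the dual `frameSnd`; it extends
  -- to all q in the domain by density and continuity.
  have key : ∀ f, S.pH (G.gaugeOp S q (G.lcan S q) (S.complDual f))
      = G.gaugeOp S q (G.lcan S q) (S.complDual f) := by
    intro f
    have hcont : ContinuousAt (fun q => G.gaugeOp S q (G.lcan S q) (S.complDual f)) q :=
      (analyticAt_clm_apply (G.analyticAt_gaugeOp S (hc.analytic q hq)) analyticAt_const).continuousAt
    refine eq_of_surjective (G := G.dual S) (S := S.dual) hc.isOpen q hq
      (S.pH.continuous.continuousAt.comp hcont) hcont fun q hq hN => ?_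
    obtain ⟨g, rfl⟩ := hN f
    change S.pH (G.gaugeOp S q (G.lcan S q) (S.complDual _)) = G.gaugeOp S q (G.lcan S q) _
    rw [h.gaugeOp_complDual (h.comp_frameSnd hc hq), ← Splitting.inclDual_projDual,
      Splitting.projDual_inclDual]
  have h1 : G.gaugeOp S q (G.lcan S q) (S.pH Y) = 0 :=
    h.gaugeOp_inclDual (h.comp_frameSnd hc hq) (S.projDual Y)
  have h2 : G.gaugeOp S q (G.lcan S q) Y
      = G.gaugeOp S q (G.lcan S q) (S.complDual (S.pairDual Y)) := by
    rw [Splitting.complDual_pairDual, map_sub, h1, sub_zero]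
  rw [h2, ← key, h.dual.lcan_eq hd hq]
  rfl

/-- One inclusion is `isCanonicalOn_dual`. For the other, the relation is solved for the ℓ-matrix of
G by `gaugeOpInv`, also entire in q, so analyticity passes back. The frame identity is needed only
near 0, where both ℓ-matrices are defined. -/
theorem analyticityDomain_dual :
    (G.dual S).analyticityDomain S.dual = G.analyticityDomain S := by
  have hc := h.isCanonicalOn_lcan
  have hd := h.dual.isCanonicalOn_lcan
  refine Subset.antisymm (fun q hq => ?_) fun q hq => ⟨_, _, h.isCanonicalOn_dual, hq⟩
  refine ⟨fun q => G.gaugeOpInv S q ((G.dual S).lcan S.dual q), _, ?_, hq⟩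
  refine h.isCanonicalOn_of_frame hd.isOpen hd.isPreconnected hd.zero_mem (fun q hq => ?_) ?_
  · exact G.analyticAt_gaugeOpInv S (hd.analytic q hq)
  · filter_upwards [hc.isOpen.mem_nhds hc.zero_mem] with q hq
    rw [G.gaugeOpInv_eq S (h.inclDual_lcan_dual hq), h.comp_frameSnd hc hq]

theorem K_lcan_dual [FiniteDimensional 𝕜 L] {q : StrongDual 𝕜 L}
    (hq : q ∈ G.analyticityDomain S) :
    S.K ∘L S.jDual ∘L (G.dual S).lcan S.dual q ∘L tr S.jDual ∘L tr S.K
      = G.double.gaugeExp (S.j ∘L S.i) S.negS (fun q' => S.j ∘L G.lcan S q' ∘L tr S.j) q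
        - S.projL + S.projMPerp := by
  refine ContinuousLinearMap.ext fun f => ?_
  rw [← dForm_sharp f, h.gaugeExp_dForm, ← h.inclDual_lcan_dual hq]
  have h1 : tr S.jDual (tr S.K (dForm 𝕜 V (sharp 𝕜 V f))) = S.pairDual (sharp 𝕜 V f) := by
    refine ContinuousLinearMap.ext fun X => ?_
    rw [tr_apply, tr_apply, Splitting.K_jDual]
    rfl
  simp only [ContinuousLinearMap.comp_apply]
  rw [h1, Splitting.K_jDual]

end IsBidynamical

end LieQuasiData

end Bidynamical
end

open Bidynamical in
theorem mainTheorem11 {𝕜 : Type*} [RCLike 𝕜]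
    {L : Type*} [NormedAddCommGroup L] [NormedSpace 𝕜 L] [FiniteDimensional 𝕜 L]
    {V : Type*} [NormedAddCommGroup V] [NormedSpace 𝕜 V] [FiniteDimensional 𝕜 V]
    (G : LieQuasiData 𝕜 V) (S : Splitting 𝕜 L V) (hG : G.IsBidynamical S) :
    -- the canonical `ℓ`-matrix is well defined and analytic on its domain of analyticity
    (G.IsCanonicalOn S (G.analyticityDomain S) (G.lcan S) ∧
      ∀ U ℓ, G.IsCanonicalOn S U ℓ → Set.EqOn ℓ (G.lcan S) U) ∧
    -- the dual of `G` is again bidynamical, so the same holds for it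
    (G.dual S).IsBidynamical S.dual ∧
    -- `K` is an isomorphism of Lie algebras between the doubles
    (Function.Bijective S.K ∧ ∀ X Y, S.K ((G.dual S).double.bracket X Y)
      = G.double.bracket (S.K X) (S.K Y)) ∧
    -- both canonical `ℓ`-matrices have the same domain of analyticity
    (G.dual S).analyticityDomain S.dual = G.analyticityDomain S ∧
    -- the link between the two canonical `ℓ`-matrices
    ∀ q ∈ G.analyticityDomain S,
      S.K ∘L S.jDual ∘L (G.dual S).lcan S.dual q ∘L tr S.jDual ∘L tr S.K
        = G.double.gaugeExp (S.j ∘L S.i) S.negS (fun q' => S.j ∘L G.lcan S q' ∘L tr S.j) q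
          - S.projL + S.projMPerp :=
  ⟨⟨hG.isCanonicalOn_lcan, fun _ _ hℓ _ hq => (hG.lcan_eq hℓ hq).symm⟩, hG.dual,
    ⟨Splitting.K_bijective, hG.K_dAd⟩, hG.analyticityDomain_dual, fun _ hq => hG.K_lcan_dual hq⟩
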